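/- Write $\log=\log_2$, $H_2(p)=-p\log p-(1-p)\log(1-p)$, let $H_2^{-1}:[0,1]\to[0,\tfrac12]$ be the inverse of $H_2$ on $[0,\tfrac12]$, and let $$\kappa_Z(\delta)=\sup_{0<r<1-H_2(\delta)} r\Bigl(1-\frac{\delta}{H_2^{-1}(1-r)}\Bigr)$$ be the rate given by the Zyablov bound. In the Light Bulb Problem with correlation $\rho\neq0$, $|\rho|\le 1$, we are given (by random access) $n\ge2$ bit strings $X_0,\dots,X_{n-1}$ of length $N$. All bits are independent and uniform, except that for one unknown pair $i\ne j$ we have, independently for each position $k$, $\Pr((X_i)_k=(X_j)_k)=\frac{1+\rho}{2}$. The task is to find the pair $\{i,j\}$. The numbers $n$ and $\rho$ are known to the algorithm ($|\rho|$ through the queries $q\mapsto\lfloor|\rho|q\rfloor$). Algorithms are programs of a randomized random access machine with logarithmic cost; the running time bounds hold for all inputs and all coin flips. Put $\delta=\frac{1-|\rho|}{2}$. The constants (including the one in $N=\Omega(\log^2 n)$), the degree of the polylogarithm and the $o(1)$, which refers to $n\to\infty$, may depend on $\rho$. (1) There is a randomized algorithm which, whenever $N=\Omega(\log^2 n)$,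 runs in time $$O(n\,\mathrm{polylog}\,n)\cdot 2^{(1-\kappa_Z(\delta)-\delta)\frac{4\ln2\cdot\log n}{\rho^2}(1+o(1))}$$ and finds the correlated pair with probability at least $1-1/n^2$ over the instance and the coin flips. (2) There are a preprocessing algorithm and a randomized algorithm with the following properties. Given $n$ and $\rho$, but not the strings, the preprocessing algorithm halts, for all sufficiently large $n$ within time $n^{2.773/\rho^2}$, and leaves in memory the unique-decoding lookup table of a Gilbert code of block length $m=\frac{4\ln2\cdot\log n}{\rho^2}(1+o(1))$ with $d=\lceil\frac{(1-|\rho|)m}{2}\rceil$. Here a Gilbert code is any set $C\subseteq\{0,1\}^m$ obtained by starting with $S=\{0,1\}^m$, $C=\emptyset$ and, while $S\neq\emptyset$, moving some $x\in S$ to $C$ and deleting from $S$ the Hamming ball of radius $d$ around $x$; the table entry of $x\in\{0,1\}^m$ is the codeword within distance $\lfloor\frac{d-1}{2}\rfloor$ of $x$ if there is one, and $\perp$ otherwise. Started on the memory left by the preprocessing, the second algorithm, whenever $N=\Omega(\log^2 n)$, runs in time $$O(n\,\mathrm{polylog}\,n)\cdot 2^{(H_2(\delta)-\delta)\frac{4\ln2\cdot\log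 n}{\rho^2}(1+o(1))}$$ and finds the correlated pair with probability at least $1-1/n^2$ over the instance and its own coin flips. -/

import Mathlib

open MeasureTheory ProbabilityTheory Filter Topology

noncomputable section

namespace LightBulb

/-! ### Entropy and the Zyablov rate -/

/-- The binary entropy function `H₂(p) = -p log₂ p - (1-p) log₂ (1-p)`. -/
def H2 (p : ℝ) : ℝ := Real.binEntropy p / Real.log 2

/-- The inverse of the increasing bijection `H₂ : [0, 1/2] → [0, 1]`. -/
def H2inv (y : ℝ) : ℝ := Function.invFunOn H2 (Set.Icc 0 (1 / 2)) y

/-- The Zyablov bound: `sup` over inner rates `0 < r < 1 - H₂(δ)` of `r (1 - δ / H₂⁻¹(1 - r))`. -/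
def kappaZ (δ : ℝ) : ℝ :=
  sSup ((fun r : ℝ => r * (1 - δ / H2inv (1 - r))) '' Set.Ioo 0 (1 - H2 δ))

/-- The expected relative distance `(1 - |ρ|) / 2` of a pair with correlation `|ρ|`. -/
def relDist (ρ : ℝ) : ℝ := (1 - |ρ|) / 2

/-- The number `4 ln 2 · log₂ n / ρ²` of sampled coordinates. -/
def sampleDim (ρ : ℝ) (n : ℕ) : ℝ := 4 * Real.log 2 * Real.logb 2 n / ρ ^ 2

/-! ### The machine model: randomized random access machines with logarithmic cost -/

/-- Read-only data of a run: the correlation parameter, random access to the input bit strings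
(bit `b` of string `a` is `bits a b`), and the sequence of fair coin flips. -/
structure Env where
  corr : ℝ
  bits : ℕ → ℕ → Bool
  coins : ℕ → Bool

/-- A machine state: registers, random access memory, and the number of coins used so far. -/
structure State where
  reg : ℕ → ℕ
  mem : ℕ → ℕ
  used : ℕ

/-- Elementary instructions; arguments are register names, except the literal of `const`. -/
inductive Instr : Type
  | const (r c : ℕ)
  | add (r a b : ℕ)
  | sub (r a b : ℕ)
  | mul (r a b : ℕ)
  | div (r a b : ℕ)
  | load (r a : ℕ)
  | store (a r : ℕ)
  | coin (r : ℕ)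
  | bit (r a b : ℕ)
  | corr (r a : ℕ)

/-- Assign the value `v` to register `r`. -/
def State.setReg (s : State) (r v : ℕ) : State := { s with reg := Function.update s.reg r v }

/-- The effect of an elementary instruction. The parameter `ρ` is accessible through the queries
`q ↦ ⌊|ρ| q⌋` (its sign is put into a register at the start, see `start`). -/
def Instr.run (e : Env) : Instr → State → State
  | .const r c, s => s.setReg r c
  | .add r a b, s => s.setReg r (s.reg a + s.reg b)
  | .sub r a b, s => s.setReg r (s.reg a - s.reg b)
  | .mul r a b, s => s.setReg r (s.reg a * s.reg b)
  | .div r a b, s => s.setReg r (s.reg a / s.reg b)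
  | .load r a, s => s.setReg r (s.mem (s.reg a))
  | .store a r, s => { s with mem := Function.update s.mem (s.reg a) (s.reg r) }
  | .coin r, s => { s.setReg r (e.coins s.used).toNat with used := s.used + 1 }
  | .bit r a b, s => s.setReg r (e.bits (s.reg a) (s.reg b)).toNat
  | .corr r a, s => s.setReg r ⌊|e.corr| * (s.reg a : ℝ)⌋₊

/-- Logarithmic cost: one plus the binary lengths of the operands and addresses involved. -/
def Instr.cost : Instr → State → ℕ
  | .const _ c, _ => 1 + c.size
  | .add _ a b, s => 1 + (s.reg a).size + (s.reg b).size
  | .sub _ a b, s => 1 + (s.reg a).size + (s.reg b).size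
  | .mul _ a b, s => 1 + (s.reg a).size + (s.reg b).size
  | .div _ a b, s => 1 + (s.reg a).size + (s.reg b).size
  | .load _ a, s => 1 + (s.reg a).size + (s.mem (s.reg a)).size
  | .store a r, s => 1 + (s.reg a).size + (s.reg r).size
  | .coin _, _ => 1
  | .bit _ a b, s => 1 + (s.reg a).size + (s.reg b).size
  | .corr _ a, s => 1 + (s.reg a).size

/-- Programs: instructions, composition, branching and loops on a register being nonzero. -/
inductive Prog : Type
  | skip
  | instr (i : Instr)
  | seq (p q : Prog)
  | ite (r : ℕ) (p q : Prog)
  | loop (r : ℕ) (p : Prog)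

/-- `Exec e p s s' t`: started in state `s`, the program `p` halts in state `s'` after
running time `t`. -/
inductive Exec (e : Env) : Prog → State → State → ℕ → Prop
  | skip (s : State) : Exec e .skip s s 1
  | instr (i : Instr) (s : State) : Exec e (.instr i) s (i.run e s) (i.cost s)
  | seq {p q : Prog} {s s' s'' : State} {t t' : ℕ} :
      Exec e p s s' t → Exec e q s' s'' t' → Exec e (.seq p q) s s'' (t + t')
  | ite_true {r : ℕ} {p q : Prog} {s s' : State} {t : ℕ} :
      s.reg r ≠ 0 → Exec e p s s' t → Exec e (.ite r p q) s s' (1 + (s.reg r).size + t)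
  | ite_false {r : ℕ} {p q : Prog} {s s' : State} {t : ℕ} :
      s.reg r = 0 → Exec e q s s' t → Exec e (.ite r p q) s s' (1 + (s.reg r).size + t)
  | loop_done {r : ℕ} {p : Prog} {s : State} :
      s.reg r = 0 → Exec e (.loop r p) s s (1 + (s.reg r).size)
  | loop_step {r : ℕ} {p : Prog} {s s' s'' : State} {t t' : ℕ} :
      s.reg r ≠ 0 → Exec e p s s' t → Exec e (.loop r p) s' s'' t' →
      Exec e (.loop r p) s s'' (1 + (s.reg r).size + t + t')

/-- The initial state with memory contents `mem`: register `0` holds `n`, register `1` tells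
whether `ρ` is negative, all other registers are zero. -/
def start (n : ℕ) (ρ : ℝ) (mem : ℕ → ℕ) : State where
  reg := fun r => if r = 0 then n else if r = 1 ∧ ρ < 0 then 1 else 0
  mem := mem
  used := 0

/-- The data for a run on the strings `X`; positions outside the strings read as `0`. -/
def inputEnv {n N : ℕ} (ρ : ℝ) (X : Fin n → Fin N → Bool) (ω : ℕ → Bool) : Env where
  corr := ρ
  bits := fun a b => if h : a < n ∧ b < N then X ⟨a, h.1⟩ ⟨b, h.2⟩ else false
  coins := ω

/-- The data for a preprocessing run, which has no access to any strings. -/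
def preEnv (ρ : ℝ) (ω : ℕ → Bool) : Env where
  corr := ρ
  bits := fun _ _ => false
  coins := ω

/-! ### The Light Bulb Problem -/

/-- The law of a bit that is `true` with probability `p` (for `p ∈ [0, 1]`). -/
def bitLaw (p : ℝ) : Measure Bool :=
  bernoulliMeasure true false (Set.projIcc 0 1 zero_le_one p)

instance (p : ℝ) : IsProbabilityMeasure (bitLaw p) := by
  unfold bitLaw; infer_instance

/-- The law of an infinite sequence of independent fair coin flips. -/
def coinLaw : Measure (ℕ → Bool) := Measure.infinitePi fun _ => bitLaw (1 / 2)

/-- String `j` is replaced by the sum modulo two of strings `i` and `j`. -/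
def plant {n N : ℕ} (i j : Fin n) (Z : Fin n → Fin N → Bool) : Fin n → Fin N → Bool :=
  fun l k => if l = j then xor (Z i k) (Z j k) else Z l k

/-- The law of `n` random strings of length `N` with a planted pair `i ≠ j` of correlation `ρ`:
all strings other than `j` consist of independent uniform bits, and string `j` is string `i`
with each bit flipped independently with probability `(1 - ρ) / 2`. -/
def lightBulbLaw (n N : ℕ) (ρ : ℝ) (i j : Fin n) : Measure (Fin n → Fin N → Bool) :=
  (Measure.pi fun l : Fin n => Measure.pi fun _ : Fin N =>
    bitLaw (if l = j then (1 - ρ) / 2 else 1 / 2)).map (plant i j)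

/-- Started with memory contents `mem`, the program `Q` solves the Light Bulb Problem with
parameters `n`, `N`, `ρ` in time `T`: it halts within time `T` on all inputs and coin flips, and
for every planted pair it finds this pair (as the contents of registers `0` and `1`, in either
order) with probability at least `1 - 1 / n ^ 2` over the instance and the coin flips. -/
def Solves (Q : Prog) (n N : ℕ) (ρ : ℝ) (mem : ℕ → ℕ) (T : ℝ) : Prop :=
  (∀ (X : Fin n → Fin N → Bool) (ω : ℕ → Bool), ∃ (s : State) (t : ℕ),
    Exec (inputEnv ρ X ω) Q (start n ρ mem) s t ∧ (t : ℝ) ≤ T) ∧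
  ∀ i j : Fin n, i ≠ j →
    ENNReal.ofReal (1 - 1 / (n : ℝ) ^ 2) ≤ ((lightBulbLaw n N ρ i j).prod coinLaw)
      {z | ∃ (s : State) (t : ℕ), Exec (inputEnv ρ z.1 z.2) Q (start n ρ mem) s t ∧
        ({s.reg 0, s.reg 1} : Set ℕ) = {(i : ℕ), (j : ℕ)}}

/-! ### Gilbert's greedy codes and their decoding tables -/

/-- `GreedyRun m d S C`: after some steps of the greedy algorithm, `S` is the set of remaining
vectors and `C` the set of codewords chosen so far. -/
inductive GreedyRun (m d : ℕ) : Set (Fin m → Bool) → Set (Fin m → Bool) → Prop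
  | init : GreedyRun m d Set.univ ∅
  | pick {S C : Set (Fin m → Bool)} (x : Fin m → Bool) : GreedyRun m d S C → x ∈ S →
      GreedyRun m d (S \ {y | hammingDist x y ≤ d}) (insert x C)

/-- `C` is a Gilbert code: a possible result of the greedy algorithm. -/
def IsGilbertCode (m d : ℕ) (C : Set (Fin m → Bool)) : Prop := GreedyRun m d ∅ C

/-- The memory holds a unique-decoding table of `C`, starting at the address stored in cell `0`
and indexed by vectors read as binary numbers: the entry of `x` is `w + 1` if `w ∈ C` lies
within distance `⌊(d - 1) / 2⌋` of `x`, and `0` (no decoding) if there is no such codeword. -/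
def HoldsDecodingTable (m d : ℕ) (C : Set (Fin m → Bool)) (mem : ℕ → ℕ) : Prop :=
  ∀ x : Fin m → Bool,
    (∀ w ∈ C, 2 * hammingDist x w + 1 ≤ d → mem (mem 0 + Nat.ofBits x) = Nat.ofBits w + 1) ∧
    ((∀ w ∈ C, ¬ 2 * hammingDist x w + 1 ≤ d) → mem (mem 0 + Nat.ofBits x) = 0)

end LightBulb

end

set_option linter.unusedSimpArgs false

namespace LightBulb

/-! ### A program logic for running times -/

/-! One search program gives both time bounds, and it uses no code: sampling bits already meets the
exponents. Put δ = (1 - |ρ|)/2. Every string is hashed to its bits at k random positions; if ρ < 0,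
the strings on one side of the comparison are complemented. The planted pair collides with
probability about (1 - δ)^k ≥ 2^(-2δk), every other pair with probability about 2^(-k). Since 1 - 2δ
= |ρ|, a length k slightly above log n / |ρ| makes the probability of any false collision with a
given planted string at most half the probability of the true collision (`card_hit_ge`). About
2^(2δk) log n repetitions with fresh seeds then find the pair (`coinLaw_no_hit_le`), each in time n
polylog n because every string looks up only one earlier entry of the hash table. The positions come
from a set of size O(log n), on which all pairs show their expected correlations up to a small
error, by Hoeffding's inequality and a union bound (`not_typical_le`). `solves_lightBulbProg`
combines these facts.

The exponent 2δ log n / |ρ|, enlarged by a constant factor to allow for rounding, is at most δ · 4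
ln 2 · log n / ρ² (`exists_repBits_le`). Concavity of the entropy gives δ ≤ H₂(δ) - δ, which is the
exponent of the second part. The Zyablov rate satisfies κ_Z(δ) ≤ 1 - H₂(δ) (`kappaZ_le`), so the
exponent of the first part is no smaller. The error terms o(1) can be taken to be zero.

The preprocessing has to build the table in time 2^m poly(m), because 2.773 barely exceeds 4 ln 2.
Every set with pairwise distances above d and covering radius at most d is a possible result of the
greedy algorithm (`isGilbertCode_of_dist`), so a linear code may be built dimension by dimension:
when passing from k to k + 1 bits, a single new generator v far from the code suffices, since
translation by v carries the new half of the space into the half that is already covered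
(`IsPartialCode.succ_of_far`). The distances of all vectors from the code are found together by one
sweep per coordinate (`runs_fillProg`). The block length needs ln n, which is read off from the sum
of ⌊n/j⌋ (`tendsto_codeDim`).

Running times are verified by a small program logic, `Runs`, which counts steps in units of the
largest possible cost of an instruction. -/

@[simp] theorem State.reg_setReg (s : State) (r v x : ℕ) :
    (s.setReg r v).reg x = if x = r then v else s.reg x := by
  simp [State.setReg, Function.update_apply]

@[simp] theorem State.mem_setReg (s : State) (r v : ℕ) : (s.setReg r v).mem = s.mem := rfl

@[simp] theorem State.used_setReg (s : State) (r v : ℕ) : (s.setReg r v).used = s.used := rfl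

/-- All registers hold numbers of at most `B` bits. -/
def Bounded (B : ℕ) (s : State) : Prop := ∀ r, s.reg r < 2 ^ B

theorem Bounded.setReg {B : ℕ} {s : State} (h : Bounded B s) {r v : ℕ} (hv : v < 2 ^ B) :
    Bounded B (s.setReg r v) := by
  intro x
  rw [State.reg_setReg]
  split_ifs
  exacts [hv, h x]

theorem Bounded.size {B : ℕ} {s : State} (h : Bounded B s) (r : ℕ) : (s.reg r).size ≤ B :=
  Nat.size_le.2 (h r)

/-- Started in `s`, the program halts within `T * (2 * B + 2)` time units, in a state with registers
of at most `B` bits that satisfies `Q`. -/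
def Runs (e : Env) (B : ℕ) (p : Prog) (s : State) (T : ℕ) (Q : State → Prop) : Prop :=
  ∃ (s' : State) (t : ℕ), Exec e p s s' t ∧ t ≤ T * (2 * B + 2) ∧ Bounded B s' ∧ Q s'

section Rules

variable {e : Env} {B : ℕ} {p q : Prog} {s : State} {T T' : ℕ} {Q Q' : State → Prop}

theorem Runs.mono (h : Runs e B p s T Q) (hT : T ≤ T')
    (hQ : ∀ s', Bounded B s' → Q s' → Q' s') : Runs e B p s T' Q' := by
  obtain ⟨s', t, h1, h2, h3, h4⟩ := h
  exact ⟨s', t, h1, h2.trans (Nat.mul_le_mul_right _ hT), h3, hQ s' h3 h4⟩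

/-- The specification of `q` is the postcondition of `p`, so that a long program is verified from
left to right without naming intermediate assertions. -/
theorem Runs.seq (h : Runs e B p s T (fun s' => Bounded B s' → Runs e B q s' T' Q)) :
    Runs e B (.seq p q) s (T + T') Q := by
  obtain ⟨s', t, h1, h2, h3, h4⟩ := h
  obtain ⟨s'', t', h1', h2', h3', h4'⟩ := h4 h3
  exact ⟨s'', t + t', .seq h1 h1', by rw [add_mul]; omega, h3', h4'⟩

theorem Runs.skip (hs : Bounded B s) (hQ : Q s) : Runs e B .skip s 1 Q :=
  ⟨s, 1, .skip s, by omega, hs, hQ⟩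

theorem Runs.ite {r : ℕ} (hs : Bounded B s) (h1 : s.reg r ≠ 0 → Runs e B p s T Q)
    (h0 : s.reg r = 0 → Runs e B q s T Q) : Runs e B (.ite r p q) s (T + 1) Q := by
  have hr := hs.size r
  by_cases h : s.reg r = 0
  · obtain ⟨s', t, g1, g2, g3⟩ := h0 h
    exact ⟨s', _, .ite_false h g1, by rw [add_mul]; omega, g3⟩
  · obtain ⟨s', t, g1, g2, g3⟩ := h1 h
    exact ⟨s', _, .ite_true h g1, by rw [add_mul]; omega, g3⟩

/-- The rule for loops; the argument of `I` is the number of remaining iterations. -/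
theorem Runs.loop {r : ℕ} (I : ℕ → State → Prop)
    (h0 : ∀ s, Bounded B s → I 0 s → s.reg r = 0)
    (hstep : ∀ k s, Bounded B s → I (k + 1) s → s.reg r ≠ 0 ∧ Runs e B p s T (I k))
    (k : ℕ) : ∀ s, Bounded B s → I k s → Runs e B (.loop r p) s (k * (T + 1) + 1) (I 0) := by
  induction k with
  | zero =>
    intro s hs hI
    have hr := hs.size r
    exact ⟨s, _, .loop_done (h0 s hs hI), by omega, hs, hI⟩
  | succ k ih =>
    intro s hs hI
    have hr := hs.size r
    obtain ⟨hne, s', t, g1, g2, g3, g4⟩ := hstep k s hs hI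
    obtain ⟨s'', t', g1', g2', g3'⟩ := ih s' g3 g4
    refine ⟨s'', _, .loop_step hne g1 g1', ?_, g3'⟩
    have : ((k + 1) * (T + 1) + 1) * (2 * B + 2)
      = T * (2 * B + 2) + (2 * B + 2) + (k * (T + 1) + 1) * (2 * B + 2) := by ring
    omega

end Rules

/-! ### Straight-line code -/

/-- Straight-line code. -/
def block : List Instr → Prog
  | [] => .skip
  | i :: l => .seq (.instr i) (block l)

/-- The effect of straight-line code. -/
noncomputable def runBlock (e : Env) : List Instr → State → State
  | [], s => s
  | i :: l, s => runBlock e l (i.run e s)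

/-- The instruction produces and accesses only numbers of at most `B` bits, if the registers
hold such numbers. -/
def Instr.Safe (B : ℕ) : Instr → State → Prop
  | .const _ c, _ => c < 2 ^ B
  | .add _ a b, s => s.reg a + s.reg b < 2 ^ B
  | .mul _ a b, s => s.reg a * s.reg b < 2 ^ B
  | .load _ a, s => s.mem (s.reg a) < 2 ^ B
  | _, _ => True

/-- All instructions of the straight-line code are safe. -/
noncomputable def BlockSafe (e : Env) (B : ℕ) : List Instr → State → Prop
  | [], _ => True
  | i :: l, s => i.Safe B s ∧ BlockSafe e B l (i.run e s)

/-- This explains the time unit `2 * B + 2` in `Runs`: an instruction is charged for at most two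
numbers, each of at most `B` bits. -/
theorem Instr.Safe.cost_le {B : ℕ} {i : Instr} {s : State} (h : i.Safe B s) (hs : Bounded B s) :
    i.cost s ≤ 2 * B + 2 := by
  cases i with
  | const r c => have := Nat.size_le.2 h; simp only [Instr.cost]; omega
  | load r a =>
    have := Nat.size_le.2 h
    have := hs.size a
    simp only [Instr.cost]; omega
  | add r a b | sub r a b | mul r a b | div r a b | store a b | bit r a b =>
    have := hs.size a
    have := hs.size b
    simp only [Instr.cost]; omega
  | coin r => simp only [Instr.cost]; omega
  | corr r a => have := hs.size a; simp only [Instr.cost]; omega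

/-- Only constants, sums, products and loaded values can exceed the word length. Differences,
quotients and bits cannot, nor can the correlation queries, because |ρ| ≤ 1. -/
theorem Instr.Safe.bounded {e : Env} {B : ℕ} {i : Instr} {s : State} (h : i.Safe B s)
    (hB : 1 ≤ B) (he : |e.corr| ≤ 1) (hs : Bounded B s) : Bounded B (i.run e s) := by
  have h2 : 1 < 2 ^ B := Nat.one_lt_two_pow (by omega)
  cases i with
  | const r c => exact hs.setReg h
  | add r a b => exact hs.setReg h
  | mul r a b => exact hs.setReg h
  | load r a => exact hs.setReg h
  | sub r a b => exact hs.setReg ((Nat.sub_le _ _).trans_lt (hs a))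
  | div r a b => exact hs.setReg ((Nat.div_le_self _ _).trans_lt (hs a))
  | store a b => exact hs
  | bit r a b => exact hs.setReg ((Bool.toNat_le _).trans_lt h2)
  | coin r =>
    exact (hs.setReg (r := r) ((Bool.toNat_le (e.coins s.used)).trans_lt h2) : Bounded B _)
  | corr r a =>
    refine hs.setReg (lt_of_le_of_lt ?_ (hs a))
    refine Nat.floor_le_of_le ?_
    exact mul_le_of_le_one_left (Nat.cast_nonneg _) he

theorem Runs.block {e : Env} {B : ℕ} (hB : 1 ≤ B) (he : |e.corr| ≤ 1) {Q : State → Prop}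
    (l : List Instr) : ∀ {s : State}, Bounded B s → BlockSafe e B l s → Q (runBlock e l s) →
    Runs e B (block l) s (l.length + 1) Q := by
  induction l with
  | nil => intro s hs _ hQ; exact Runs.skip hs hQ
  | cons i l ih =>
    intro s hs hl hQ
    have h1 : Runs e B (.instr i) s 1
        (fun s' => Bounded B s' → Runs e B (LightBulb.block l) s' (l.length + 1) Q) :=
      ⟨_, _, .instr i s, by rw [one_mul]; exact hl.1.cost_le hs, hl.1.bounded hB he hs,
        fun h => ih h hl.2 hQ⟩
    have := h1.seq
    rwa [add_comm 1] at this

/-- Count register `r` down to zero, executing `p` after each decrement; `tmp` is overwritten. -/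
def forDown (r tmp : ℕ) (p : Prog) : Prog :=
  .loop r (.seq (block [.const tmp 1, .sub r r tmp]) p)

/-- The rule for counting loops: the body is executed with `r` holding `k - 1, …, 0`, and `J i`
is the invariant when `i` iterations remain. -/
theorem Runs.forDown {e : Env} {B : ℕ} (hB : 1 ≤ B) (he : |e.corr| ≤ 1) {r tmp : ℕ} {p : Prog}
    {T : ℕ} (hr : r ≠ tmp) (J : ℕ → State → Prop) (k : ℕ)
    (hstep : ∀ i < k, ∀ s, Bounded B s → s.reg r = i → s.reg tmp = 1 →
      (∃ s₀, J (i + 1) s₀ ∧ s.mem = s₀.mem ∧ s.used = s₀.used ∧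
        ∀ x, x ≠ r → x ≠ tmp → s.reg x = s₀.reg x) →
      Runs e B p s T (fun s' => J i s' ∧ s'.reg r = i))
    {s : State} (hs : Bounded B s) (hk : s.reg r = k) (hJ : J k s) :
    Runs e B (forDown r tmp p) s (k * (T + 4) + 1) (fun s' => J 0 s' ∧ s'.reg r = 0) := by
  have h2 : 1 < 2 ^ B := Nat.one_lt_two_pow (by omega)
  -- The decrement costs three steps: two instructions and the final `skip` of the block.
  refine (Runs.loop (e := e) (B := B) (T := 3 + T) (fun i s' => i ≤ k ∧ J i s' ∧ s'.reg r = i)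
    (fun s _ h => h.2.2) ?_ k s hs ⟨le_rfl, hJ, hk⟩).mono
    (Nat.add_le_add_right (Nat.mul_le_mul_left _ (by omega)) _) (fun s' _ h => h.2)
  rintro i s hs ⟨hi, hJ, hreg⟩
  refine ⟨by omega, Runs.seq ?_⟩
  refine Runs.block hB he _ hs ⟨h2, trivial, trivial⟩ ?_
  intro hb
  refine (hstep i hi _ hb ?_ ?_ ⟨s, hJ, rfl, rfl, ?_⟩).mono le_rfl (fun s' _ h => ⟨by omega, h⟩)
  · simp [runBlock, Instr.run, hreg, hr]
  · simp [runBlock, Instr.run, hr.symm]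
  · intro x hx hx'
    simp [runBlock, Instr.run, hx, hx']

/-! ### The subroutines of the search program -/

/-- The hash value with `k` digits of `x` in base `M` as sampled positions of the string `b`,
appended to the bits of `h`. -/
def hashAcc (b : ℕ → Bool) (M : ℕ) : ℕ → ℕ → ℕ → ℕ
  | 0, h, _ => h
  | k + 1, h, x => hashAcc b M k (2 * h + (b (x % M)).toNat) (x / M)

/-- Hash string number `reg 13`, flipping bits if `reg 30` is set; the result is in `reg 31`.
The modulus is in `reg 5`, the hash length in `reg 6`, the seed in `reg 12`. -/
def hashProg : Prog :=
  .seq (block [.const 31 0, .const 32 0, .add 33 12 32, .add 34 6 32]) <|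
  forDown 34 35 <| block
    [.div 36 33 5, .mul 37 36 5, .sub 37 33 37, .add 33 36 32, .bit 38 13 37,
     .sub 39 38 30, .sub 38 30 38, .add 38 38 39, .add 31 31 31, .add 31 31 38]

/-- Subtraction is truncated, so one of the two differences vanishes. The programs compute exclusive
or in this way. -/
theorem toNat_xor_eq (a b : Bool) :
    (b.toNat - a.toNat) + (a.toNat - b.toNat) = (xor a b).toNat := by
  cases a <;> cases b <;> rfl

/-- The invariant says that hashing the remaining digits of the seed from the current accumulator
still yields the final value. -/
theorem runs_hashProg {e : Env} {B : ℕ} (hB : 1 ≤ B) (he : |e.corr| ≤ 1) {s : State}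
    (hs : Bounded B s) {f : Bool} (hf : s.reg 30 = f.toNat) (hK : s.reg 6 + 2 ≤ B) :
    Runs e B hashProg s (s.reg 6 * 15 + 6) (fun s' =>
      s'.reg 31 = hashAcc (fun c => xor (e.bits (s.reg 13) c) f) (s.reg 5) (s.reg 6) 0 (s.reg 12) ∧
      s'.reg 31 < 2 ^ s.reg 6 ∧
      (∀ r < 31, s'.reg r = s.reg r) ∧ s'.mem = s.mem ∧ s'.used = s.used) := by
  have h12 := hs 12
  have h6 := hs 6
  set b : ℕ → Bool := fun c => xor (e.bits (s.reg 13) c) f with hb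
  have hp : (0 : ℕ) < 2 ^ B := by positivity
  refine (Runs.seq (T := 5) (T' := s.reg 6 * 15 + 1) (Runs.block hB he _ hs ?_ ?_)).mono
    (by omega) (fun _ _ h => h)
  · simp [BlockSafe, Instr.Safe, Instr.run, h12, h6]
  intro hs1
  refine (Runs.forDown hB he (by decide) (T := 11) (fun i s' =>
      (∀ r < 31, s'.reg r = s.reg r) ∧ s'.mem = s.mem ∧ s'.used = s.used ∧ s'.reg 32 = 0 ∧
      s'.reg 31 < 2 ^ (s.reg 6 - i) ∧
      hashAcc b (s.reg 5) i (s'.reg 31) (s'.reg 33) =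
        hashAcc b (s.reg 5) (s.reg 6) 0 (s.reg 12)) (s.reg 6) ?_ hs1 ?_ ?_).mono le_rfl ?_
  · rintro i hi s' hs' hri - ⟨s₀, ⟨hfr, hm, hu, h32, h31, hacc⟩, hm', hu', hx⟩
    have hfr' : ∀ r < 31, s'.reg r = s.reg r := fun r hr => by
      rw [hx r (by omega) (by omega), hfr r hr]
    rw [← hx 31 (by decide) (by decide)] at h31 hacc
    rw [← hx 32 (by decide) (by decide)] at h32
    rw [← hx 33 (by decide) (by decide)] at hacc
    have h33 := hs' 33
    have hpow : 2 ^ (s.reg 6 - i) = 2 * 2 ^ (s.reg 6 - (i + 1)) := by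
      rw [← pow_succ']; congr 1; omega
    have hpow2 : 2 * 2 ^ (s.reg 6 - i) ≤ 2 ^ B := by
      rw [← pow_succ']; exact Nat.pow_le_pow_right (by norm_num) (by omega)
    have hdm : s'.reg 33 / s.reg 5 * s.reg 5 ≤ s'.reg 33 := Nat.div_mul_le_self _ _
    have hdd : s'.reg 33 / s.reg 5 ≤ s'.reg 33 := Nat.div_le_self _ _
    -- There is no remainder instruction; the remainder is computed from the quotient.
    have hmod : s'.reg 33 - s'.reg 33 / s.reg 5 * s.reg 5 = s'.reg 33 % s.reg 5 := by
      have := Nat.div_add_mod' (s'.reg 33) (s.reg 5); omega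
    have hbit : ∀ c : ℕ, (f.toNat - (e.bits (s.reg 13) c).toNat) +
        ((e.bits (s.reg 13) c).toNat - f.toNat) = (b c).toNat := fun c => toNat_xor_eq _ _
    have hbl : ∀ c, (b c).toNat ≤ 1 := fun c => Bool.toNat_le _
    have hblc := hbl (s'.reg 33 % s.reg 5)
    have h5 := hfr' 5 (by decide)
    have h13 := hfr' 13 (by decide)
    have h30 := hfr' 30 (by decide)
    rw [hf] at h30
    have h1B : 2 ≤ 2 ^ B := by
      calc 2 = 2 ^ 1 := rfl
        _ ≤ 2 ^ B := Nat.pow_le_pow_right (by norm_num) hB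
    refine Runs.block hB he _ hs' ?_ ?_
    · simp [BlockSafe, Instr.Safe, Instr.run, h5, h13, h30, h32, hmod, hbit]
      omega
    · simp [runBlock, Instr.run, h5, h13, h30, h32, hmod, hbit, hm', hm, hu', hu, hri]
      refine ⟨fun r hr => ?_, by omega, ?_⟩
      · rw [← hfr' r hr]
        simp [show r ≠ 31 by omega, show r ≠ 38 by omega, show r ≠ 39 by omega,
          show r ≠ 33 by omega, show r ≠ 37 by omega, show r ≠ 36 by omega]
      · rw [← hacc, hashAcc, two_mul]
  · simp [runBlock, Instr.run]
  · simp [runBlock, Instr.run]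
    intro r hr
    simp [show r ≠ 31 by omega, show r ≠ 32 by omega, show r ≠ 33 by omega, show r ≠ 34 by omega]
  · rintro s' - ⟨⟨hfr, hm, hu, -, h31, hacc⟩, -⟩
    exact ⟨hacc, h31, hfr, hm, hu⟩

/-- The number of positions `k < M` at which `y` agrees with `x`, flipped if `f` is set. -/
def agree (x y : ℕ → Bool) (f : Bool) (M : ℕ) : ℕ :=
  ((Finset.range M).filter fun k => xor (x k) f = y k).card

theorem agree_succ (x y : ℕ → Bool) (f : Bool) (M : ℕ) :
    agree x y f (M + 1) = agree x y f M + (1 - (xor (xor (x M) f) (y M)).toNat) := by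
  unfold agree
  rw [Finset.range_add_one, Finset.filter_insert]
  split_ifs with h
  · rw [Finset.card_insert_of_notMem (by simp), h]; simp
  · have : (xor (xor (x M) f) (y M)) = true := by
      revert h; cases x M <;> cases f <;> cases y M <;> simp
    rw [this]; simp

theorem agree_le (x y : ℕ → Bool) (f : Bool) (M : ℕ) : agree x y f M ≤ M := by
  unfold agree
  simpa using Finset.card_filter_le (Finset.range M) fun k => xor (x k) f = y k

/-- Compare string `reg 13`, flipped if `reg 1` is set, with string `reg 15` in the first `reg 5`
positions; `reg 31` tells whether the number of agreements times `reg 11` is at least `reg 10`. -/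
def testProg : Prog :=
  .seq (block [.const 31 0, .const 32 0, .add 34 5 32]) <|
  .seq (forDown 34 35 <| block
    [.bit 36 13 34, .bit 37 15 34, .sub 38 36 1, .sub 36 1 36, .add 36 36 38,
     .sub 38 36 37, .sub 36 37 36, .add 36 36 38, .const 38 1, .sub 36 38 36, .add 31 31 36]) <|
  block [.mul 31 31 11, .sub 31 10 31, .const 32 1, .sub 31 32 31]

/-- The flag is `1 - (threshold - count * weight)` with truncated subtraction, hence nonzero exactly
when the threshold is reached. Positions are visited in descending order, so the agreements already
counted and those below the current position add up to the total. -/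
theorem runs_testProg {e : Env} {B : ℕ} (hB : 1 ≤ B) (he : |e.corr| ≤ 1) {s : State}
    (hs : Bounded B s) {f : Bool} (hf : s.reg 1 = f.toNat) (hM : s.reg 5 * s.reg 11 < 2 ^ B) :
    Runs e B testProg s (s.reg 5 * 16 + 10) (fun s' =>
      (s'.reg 31 ≠ 0 ↔
        s.reg 10 ≤ agree (e.bits (s.reg 13)) (e.bits (s.reg 15)) f (s.reg 5) * s.reg 11) ∧
      (∀ r < 31, s'.reg r = s.reg r) ∧ s'.mem = s.mem ∧ s'.used = s.used) := by
  have h5 := hs 5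
  set A : ℕ → ℕ := agree (e.bits (s.reg 13)) (e.bits (s.reg 15)) f with hA
  have hp : (0 : ℕ) < 2 ^ B := by positivity
  have h1B : 2 ≤ 2 ^ B := by
    calc 2 = 2 ^ 1 := rfl
      _ ≤ 2 ^ B := Nat.pow_le_pow_right (by norm_num) hB
  refine (Runs.seq (T := 4) (T' := s.reg 5 * 16 + 6) (Runs.block hB he _ hs ?_ ?_)).mono
    (by omega) (fun _ _ h => h)
  · simp [BlockSafe, Instr.Safe, Instr.run, h5]
  intro hs1
  refine Runs.seq (T := s.reg 5 * 16 + 1) (T' := 5) ?_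
  refine (Runs.forDown hB he (by decide) (T := 12) (fun i s' =>
      (∀ r < 31, s'.reg r = s.reg r) ∧ s'.mem = s.mem ∧ s'.used = s.used ∧
      s'.reg 31 + A i = A (s.reg 5)) (s.reg 5) ?_ hs1 ?_ ?_).mono le_rfl ?_
  · rintro i hi s' hs' hri - ⟨s₀, ⟨hfr, hm, hu, hacc⟩, hm', hu', hx⟩
    have hfr' : ∀ r < 31, s'.reg r = s.reg r := fun r hr => by
      rw [hx r (by omega) (by omega), hfr r hr]
    rw [← hx 31 (by decide) (by decide)] at hacc
    have h1 := hfr' 1 (by decide)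
    have h13 := hfr' 13 (by decide)
    have h15 := hfr' 15 (by decide)
    rw [hf] at h1
    have hsucc : A (i + 1) = _ := agree_succ _ _ _ _
    have hAM : A (s.reg 5) ≤ s.reg 5 := agree_le _ _ _ _
    have e1 := toNat_xor_eq (e.bits (s.reg 13) i) f
    have e2 := toNat_xor_eq (xor (e.bits (s.reg 13) i) f) (e.bits (s.reg 15) i)
    have e3 := Bool.toNat_le (xor (e.bits (s.reg 13) i) f)
    have e5 := Bool.toNat_le (e.bits (s.reg 15) i)
    have hA' : agree (e.bits (s.reg 13)) (e.bits (s.reg 15)) f i = A i := rfl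
    rw [hA'] at hsucc
    generalize (xor (xor (e.bits (s.reg 13) i) f) (e.bits (s.reg 15) i)).toNat = z at e2 hsucc
    generalize (xor (e.bits (s.reg 13) i) f).toNat = y at e1 e2 e3
    refine Runs.block hB he _ hs' ?_ ?_
    · simp [BlockSafe, Instr.Safe, Instr.run, h1, h13, h15, hri, e1, e2]
      omega
    · simp [runBlock, Instr.run, h1, h13, h15, e1, e2, hm', hm, hu', hu, hri]
      refine ⟨fun r hr => ?_, ?_⟩
      · rw [← hfr' r hr]
        simp [show r ≠ 31 by omega, show r ≠ 36 by omega, show r ≠ 37 by omega,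
          show r ≠ 38 by omega]
      · rw [← hacc, hsucc]; omega
  · simp [runBlock, Instr.run]
  · simp [runBlock, Instr.run]
    intro r hr
    simp [show r ≠ 31 by omega, show r ≠ 32 by omega, show r ≠ 34 by omega]
  · rintro s' hs' ⟨⟨hfr, hm, hu, hacc⟩, -⟩ -
    have hA0 : A 0 = 0 := rfl
    have h31 : s'.reg 31 = A (s.reg 5) := by omega
    have hAM : A (s.reg 5) * s.reg 11 ≤ s.reg 5 * s.reg 11 :=
      Nat.mul_le_mul_right _ (agree_le _ _ _ _)
    have h10 := hfr 10 (by decide)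
    have h11 := hfr 11 (by decide)
    refine Runs.block hB he _ hs' ?_ ?_
    · simp [BlockSafe, Instr.Safe, Instr.run, h31, h10, h11]
      omega
    · simp [runBlock, Instr.run, h31, h10, h11, hm, hu]
      refine ⟨by omega, fun r hr => ?_⟩
      rw [← hfr r hr]
      simp [show r ≠ 31 by omega, show r ≠ 32 by omega]

/-- The number whose binary digits, from the top, are the first `k` coins. -/
def coinNum (ω : ℕ → Bool) : ℕ → ℕ
  | 0 => 0
  | k + 1 => 2 * coinNum ω k + (ω k).toNat

theorem coinNum_lt (ω : ℕ → Bool) (k : ℕ) : coinNum ω k < 2 ^ k := by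
  induction k with
  | zero => simp [coinNum]
  | succ k ih =>
    have := Bool.toNat_le (ω k)
    rw [coinNum, pow_succ]; omega

/-- Draw a random number with `reg 14` bits into `reg 12`. -/
def seedProg : Prog :=
  .seq (block [.const 12 0, .add 21 14 12]) <|
  forDown 21 22 <| block [.coin 23, .add 12 12 12, .add 12 12 23]

/-- The number of coins used is tracked so that the repetitions can be seen to read disjoint blocks
of coins. -/
theorem runs_seedProg {e : Env} {B : ℕ} (hB : 1 ≤ B) (he : |e.corr| ≤ 1) {s : State}
    (hs : Bounded B s) (hv : s.reg 14 + 1 ≤ B) :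
    Runs e B seedProg s (s.reg 14 * 8 + 4) (fun s' =>
      s'.reg 12 = coinNum (fun q => e.coins (s.used + q)) (s.reg 14) ∧
      (∀ r < 21, r ≠ 12 → s'.reg r = s.reg r) ∧ s'.used = s.used + s.reg 14) := by
  have h14 := hs 14
  set c := coinNum (fun q => e.coins (s.used + q)) with hc
  have hp : (0 : ℕ) < 2 ^ B := by positivity
  refine (Runs.seq (T := 3) (T' := s.reg 14 * 8 + 1) (Runs.block hB he _ hs ?_ ?_)).mono
    (by omega) (fun _ _ h => h)
  · simp [BlockSafe, Instr.Safe, Instr.run, h14]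
  intro hs1
  refine (Runs.forDown hB he (by decide) (T := 4) (fun i s' => i ≤ s.reg 14 ∧
      (∀ r < 21, r ≠ 12 → s'.reg r = s.reg r) ∧ s'.used = s.used + (s.reg 14 - i) ∧
      s'.reg 12 = c (s.reg 14 - i)) (s.reg 14) ?_ hs1 ?_ ?_).mono le_rfl ?_
  · rintro i hi s' hs' hri - ⟨s₀, ⟨hi', hfr, hu, h12⟩, hm', hu', hx⟩
    have hfr' : ∀ r < 21, r ≠ 12 → s'.reg r = s.reg r := fun r hr hr' => by
      rw [hx r (by omega) (by omega), hfr r hr hr']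
    rw [← hx 12 (by decide) (by decide)] at h12
    have hj : s.reg 14 - i = (s.reg 14 - (i + 1)) + 1 := by omega
    have hlt : c (s.reg 14 - i) < 2 ^ (s.reg 14 - i) := coinNum_lt _ _
    have hpow : 2 ^ (s.reg 14 - i) ≤ 2 ^ B := Nat.pow_le_pow_right (by norm_num) (by omega)
    have hcs : c (s.reg 14 - i) = 2 * c (s.reg 14 - (i + 1)) +
        (e.coins s'.used).toNat := by rw [hj, hc, coinNum, hu', hu]
    refine Runs.block hB he _ hs' ?_ ?_
    · simp [BlockSafe, Instr.Safe, Instr.run, h12]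
      omega
    · simp [runBlock, Instr.run, h12, hri]
      refine ⟨by omega, fun r hr hr' => ?_, by omega, by omega⟩
      rw [← hfr' r hr hr']
      simp [hr', show r ≠ 23 by omega]
  · simp [runBlock, Instr.run]
  · simp [runBlock, Instr.run]
    refine ⟨fun r hr hr' => ?_, rfl⟩
    simp [hr', show r ≠ 21 by omega]
  · rintro s' - ⟨⟨-, hfr, hu, h12⟩, -⟩
    exact ⟨h12, hfr, hu⟩

/-- Clear the table entries that the search is going to read. -/
def clearProg : Prog :=
  .seq (block [.const 18 0, .add 13 0 18]) <|
  forDown 13 17 <| .seq (block [.add 30 1 18]) <| .seq hashProg <| block [.store 31 18]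

/-- The hash value of string `l`, flipped if `f` is set, with hash length `K` and seed `R`. -/
def key (e : Env) (M K R : ℕ) (f : Bool) (l : ℕ) : ℕ :=
  hashAcc (fun c => xor (e.bits l c) f) M K 0 R

/-- The search has to work from arbitrary memory, for instance with a decoding table in it. Clearing
all `2 ^ k` possible hash values would be too slow; it suffices to clear the addresses that the scan
will read. -/
theorem runs_clearProg {e : Env} {B : ℕ} (hB : 1 ≤ B) (he : |e.corr| ≤ 1) {s : State}
    (hs : Bounded B s) {f : Bool} (hf : s.reg 1 = f.toNat) (hK : s.reg 6 + 2 ≤ B) :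
    Runs e B clearProg s (s.reg 0 * (s.reg 6 * 15 + 14) + 4) (fun s' =>
      (∀ l < s.reg 0, s'.mem (key e (s.reg 5) (s.reg 6) (s.reg 12) f l) = 0) ∧
      (∀ r < 13, s'.reg r = s.reg r) ∧ s'.reg 14 = s.reg 14 ∧ s'.used = s.used) := by
  have h0 := hs 0
  have hp : (0 : ℕ) < 2 ^ B := by positivity
  refine (Runs.seq (T := 3) (T' := s.reg 0 * (s.reg 6 * 15 + 10 + 4) + 1)
    (Runs.block hB he _ hs ?_ ?_)).mono (by ring_nf; omega) (fun _ _ h => h)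
  · simp [BlockSafe, Instr.Safe, Instr.run, h0]
  intro hs1
  refine (Runs.forDown hB he (by decide) (T := s.reg 6 * 15 + 10) (fun i s' =>
      (∀ l < s.reg 0, i ≤ l → s'.mem (key e (s.reg 5) (s.reg 6) (s.reg 12) f l) = 0) ∧
      (∀ r < 13, s'.reg r = s.reg r) ∧ s'.reg 14 = s.reg 14 ∧ s'.reg 18 = 0 ∧ s'.used = s.used)
      (s.reg 0) ?_ hs1 ?_ ?_).mono le_rfl ?_
  · rintro i hi s' hs' hri - ⟨s₀, ⟨hmem, hfr, h14, h18, hu⟩, hm', hu', hx⟩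
    have hfr' : ∀ r < 13, s'.reg r = s.reg r := fun r hr => by
      rw [hx r (by omega) (by omega), hfr r hr]
    rw [← hx 18 (by decide) (by decide)] at h18
    rw [← hx 14 (by decide) (by decide)] at h14
    rw [← hm'] at hmem
    rw [← hu'] at hu
    have h1 := hfr' 1 (by decide)
    have hr1 := hs' 1
    refine (Runs.seq (T := 2) (T' := s.reg 6 * 15 + 8) (Runs.block hB he _ hs' ?_ ?_)).mono
      (by omega) (fun _ _ h => h)
    · simp [BlockSafe, Instr.Safe, Instr.run, h18, hr1]
    intro hs2
    refine Runs.seq (T := s.reg 6 * 15 + 6) (T' := 2) ?_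
    have g2 : ∀ r < 30, (runBlock e [.add 30 1 18] s').reg r = s'.reg r := fun r hr => by
      simp [runBlock, Instr.run, hr.ne]
    have g30 : (runBlock e [.add 30 1 18] s').reg 30 = f.toNat := by
      simp [runBlock, Instr.run, h18, h1, hf]
    have gm : (runBlock e [.add 30 1 18] s').mem = s'.mem := rfl
    have gu : (runBlock e [.add 30 1 18] s').used = s'.used := rfl
    generalize runBlock e [.add 30 1 18] s' = s2 at hs2 g2 g30 gm gu ⊢
    have g6 : s2.reg 6 = s.reg 6 := by rw [g2 6 (by decide), hfr' 6 (by decide)]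
    refine (runs_hashProg (e := e) hB he hs2 g30 (by rw [g6]; exact hK)).mono (by rw [g6]) ?_
    rintro s'' hs'' ⟨h31, -, hfr'', hm'', hu''⟩ -
    rw [g2 13 (by decide), hri, g2 5 (by decide), hfr' 5 (by decide), g6, g2 12 (by decide),
      hfr' 12 (by decide)] at h31
    rw [gm] at hm''
    rw [gu] at hu''
    refine Runs.block hB he _ hs'' (by simp [BlockSafe, Instr.Safe]) ?_
    have g : ∀ r < 30, s''.reg r = s'.reg r := fun r hr => by
      rw [hfr'' r (by omega), g2 r hr]
    simp only [runBlock, Instr.run, g 18 (by decide), g 14 (by decide), g 13 (by decide), h18, h14,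
      hri, hu, hu'', and_true, true_and]
    refine ⟨fun l hl hil => ?_, fun r hr => ?_⟩
    · rw [Function.update_apply]
      split_ifs with h
      · rfl
      · rcases hil.eq_or_lt with rfl | hil
        · exact absurd h31.symm h
        · rw [hm'']; exact hmem l hl hil
    · rw [g r (by omega), hfr' r hr]
  · simp [runBlock, Instr.run]
  · simp [runBlock, Instr.run]
    refine ⟨fun l hl hl' => by omega, fun r hr => ?_⟩
    simp [show r ≠ 13 by omega, show r ≠ 18 by omega]
  · rintro s' - ⟨⟨hmem, hfr, h14, -, hu⟩, -⟩
    exact ⟨fun l hl => hmem l hl (Nat.zero_le _), hfr, h14, hu⟩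

/-- Strings `a` and `b` pass the test for being correlated. -/
def Passes (e : Env) (M thr q : ℕ) (f : Bool) (a b : ℕ) : Prop :=
  thr ≤ agree (e.bits a) (e.bits b) f M * q

/-- Registers `8` and `9` hold a pair that passes the test. -/
def Found (e : Env) (M thr q : ℕ) (f : Bool) (n : ℕ) (s : State) : Prop :=
  s.reg 8 < s.reg 9 ∧ s.reg 9 < n ∧ Passes e M thr q f (s.reg 8) (s.reg 9)

/-- With the seed `R`, string `i` collides with the later string `j`, no string in between has the
same hash value as `j`, and the pair passes the test. -/
def Hit (e : Env) (M K thr q : ℕ) (f : Bool) (n R i j : ℕ) : Prop :=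
  i < j ∧ j < n ∧ Passes e M thr q f i j ∧ key e M K R f i = key e M K R false j ∧
    ∀ l, i < l → l < j → key e M K R false l ≠ key e M K R false j

/-- Look up the colliding partner of string `reg 13`, test it, and record the pair if it passes. -/
def probeProg : Prog :=
  .seq (block [.add 30 1 18]) <| .seq hashProg <| .seq (block [.load 15 31]) <|
  .ite 15
    (.seq (block [.const 20 1, .sub 15 15 20]) <| .seq testProg <|
      .ite 31 (block [.add 8 13 18, .add 9 15 18]) .skip)
    .skip

/-- Go through the strings, probing each one and then entering it into the table. -/
def scanProg : Prog :=
  .seq (block [.const 18 0, .add 13 0 18]) <|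
  forDown 13 17 <| .seq probeProg <|
    .seq (block [.const 30 0]) <| .seq hashProg <| block [.const 20 1, .add 20 20 13, .store 31 20]

/-- Table entries are indices increased by one, so that zero means empty. A nonzero entry `c` stands
for the string `c - 1`, which comes after the string being probed. -/
theorem runs_probeProg {e : Env} {B : ℕ} (hB : 1 ≤ B) (he : |e.corr| ≤ 1) {s : State}
    (hs : Bounded B s) {f : Bool} (hf : s.reg 1 = f.toNat) (hK : s.reg 6 + 2 ≤ B)
    (hM : s.reg 5 * s.reg 11 < 2 ^ B) (h18 : s.reg 18 = 0) {c : ℕ}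
    (hc : s.mem (key e (s.reg 5) (s.reg 6) (s.reg 12) f (s.reg 13)) = c)
    (hcn : c = 0 ∨ (s.reg 13 + 1 < c ∧ c ≤ s.reg 0)) :
    Runs e B probeProg s (s.reg 6 * 15 + s.reg 5 * 16 + 30) (fun s' =>
      (Found e (s.reg 5) (s.reg 10) (s.reg 11) f (s.reg 0) s' ∨
        (s'.reg 8 = s.reg 8 ∧ s'.reg 9 = s.reg 9)) ∧
      (c ≠ 0 → Passes e (s.reg 5) (s.reg 10) (s.reg 11) f (s.reg 13) (c - 1) →
        Found e (s.reg 5) (s.reg 10) (s.reg 11) f (s.reg 0) s') ∧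
      (∀ r < 15, r ≠ 8 → r ≠ 9 → s'.reg r = s.reg r) ∧ s'.reg 18 = 0 ∧
      s'.mem = s.mem ∧ s'.used = s.used) := by
  have hr1 := hs 1
  have hr0 := hs 0
  refine (Runs.seq (T := 2) (T' := s.reg 6 * 15 + s.reg 5 * 16 + 28)
    (Runs.block hB he _ hs ?_ ?_)).mono (by omega) (fun _ _ h => h)
  · simp [BlockSafe, Instr.Safe, Instr.run, h18, hr1]
  intro hs2
  have g2 : ∀ r < 30, (runBlock e [.add 30 1 18] s).reg r = s.reg r := fun r hr => by
    simp [runBlock, Instr.run, hr.ne]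
  have g30 : (runBlock e [.add 30 1 18] s).reg 30 = f.toNat := by
    simp [runBlock, Instr.run, h18, hf]
  have gm : (runBlock e [.add 30 1 18] s).mem = s.mem := rfl
  have gu : (runBlock e [.add 30 1 18] s).used = s.used := rfl
  generalize runBlock e [.add 30 1 18] s = s2 at hs2 g2 g30 gm gu ⊢
  have g6 : s2.reg 6 = s.reg 6 := g2 6 (by decide)
  refine (Runs.seq (T := s.reg 6 * 15 + 6) (T' := s.reg 5 * 16 + 22) ?_).mono
    (by omega) (fun _ _ h => h)
  refine (runs_hashProg (e := e) hB he hs2 g30 (by rw [g6]; exact hK)).mono (by rw [g6]) ?_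
  rintro s3 hs3 ⟨h31, -, hfr3, hm3, hu3⟩ -
  rw [g2 13 (by decide), g2 5 (by decide), g6, g2 12 (by decide)] at h31
  replace h31 : s3.reg 31 = key e (s.reg 5) (s.reg 6) (s.reg 12) f (s.reg 13) := h31
  rw [gm] at hm3
  rw [gu] at hu3
  replace hfr3 : ∀ r < 30, s3.reg r = s.reg r := fun r hr => by
    rw [hfr3 r (by omega), g2 r hr]
  have hcB : c < 2 ^ B := by omega
  refine (Runs.seq (T := 2) (T' := s.reg 5 * 16 + 20) (Runs.block hB he _ hs3 ?_ ?_)).mono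
    (by omega) (fun _ _ h => h)
  · simp [BlockSafe, Instr.Safe, hm3, h31, hc, hcB]
  intro hs4
  have g4 : ∀ r < 30, r ≠ 15 → (runBlock e [.load 15 31] s3).reg r = s.reg r := fun r hr hr' => by
    simp [runBlock, Instr.run, hr', hfr3 r hr]
  have g15 : (runBlock e [.load 15 31] s3).reg 15 = c := by
    simp [runBlock, Instr.run, hm3, h31, hc]
  have gm4 : (runBlock e [.load 15 31] s3).mem = s.mem := hm3
  have gu4 : (runBlock e [.load 15 31] s3).used = s.used := hu3
  generalize runBlock e [.load 15 31] s3 = s4 at hs4 g4 g15 gm4 gu4 ⊢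
  refine (Runs.ite (T := s.reg 5 * 16 + 19) hs4 ?_ ?_).mono (by omega) (fun _ _ h => h)
  swap
  · intro h0
    refine (Runs.skip hs4 ?_).mono (by omega) (fun _ _ h => h)
    refine ⟨Or.inr ⟨g4 8 (by decide) (by decide), g4 9 (by decide) (by decide)⟩, fun h => ?_,
      fun r hr _ _ => g4 r (by omega) (by omega), ?_, gm4, gu4⟩
    · exact absurd (g15.symm.trans h0) h
    · rw [g4 18 (by decide) (by decide), h18]
  intro hne
  rw [g15] at hne
  have hc' : s.reg 13 + 1 < c ∧ c ≤ s.reg 0 := hcn.resolve_left hne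
  have h1B : 1 < 2 ^ B := Nat.one_lt_two_pow (by omega)
  refine (Runs.seq (T := 3) (T' := s.reg 5 * 16 + 16) (Runs.block hB he _ hs4 ?_ ?_)).mono
    (by omega) (fun _ _ h => h)
  · simp [BlockSafe, Instr.Safe, Instr.run, h1B]
  intro hs5
  have g5 : ∀ r < 30, r ≠ 15 → r ≠ 20 →
      (runBlock e [.const 20 1, .sub 15 15 20] s4).reg r = s.reg r := fun r hr hr' h20 => by
    simp [runBlock, Instr.run, hr', h20, g4 r hr hr']
  have g15' : (runBlock e [.const 20 1, .sub 15 15 20] s4).reg 15 = c - 1 := by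
    simp [runBlock, Instr.run, g15]
  have gm5 : (runBlock e [.const 20 1, .sub 15 15 20] s4).mem = s.mem := gm4
  have gu5 : (runBlock e [.const 20 1, .sub 15 15 20] s4).used = s.used := gu4
  generalize runBlock e [.const 20 1, .sub 15 15 20] s4 = s5 at hs5 g5 g15' gm5 gu5 ⊢
  refine (Runs.seq (T := s.reg 5 * 16 + 10) (T' := 4) ?_).mono (by omega) (fun _ _ h => h)
  have k5 := g5 5 (by decide) (by decide) (by decide)
  have k11 := g5 11 (by decide) (by decide) (by decide)
  refine (runs_testProg hB he hs5 (f := f) ?_ ?_).mono (by rw [k5]) ?_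
  · rw [g5 1 (by decide) (by decide) (by decide), hf]
  · rw [k5, k11]; exact hM
  rintro s6 hs6 ⟨h31, hfr6, hm6, hu6⟩ -
  rw [k5, k11, g15', g5 13 (by decide) (by decide) (by decide),
    g5 10 (by decide) (by decide) (by decide)] at h31
  have hk6 : ∀ r < 30, r ≠ 15 → r ≠ 20 → s6.reg r = s.reg r := fun r hr h1 h2 => by
    rw [hfr6 r (by omega), g5 r hr h1 h2]
  have k18 : s6.reg 18 = 0 := by rw [hk6 18 (by decide) (by decide) (by decide), h18]
  have k13 := hk6 13 (by decide) (by decide) (by decide)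
  have k15 : s6.reg 15 = c - 1 := by rw [hfr6 15 (by decide), g15']
  have hr13 := hs 13
  rw [gm5] at hm6
  rw [gu5] at hu6
  refine (Runs.ite (T := 3) hs6 ?_ ?_).mono (by omega) (fun _ _ h => h)
  · intro hp
    have hpass : Passes e (s.reg 5) (s.reg 10) (s.reg 11) f (s.reg 13) (c - 1) := h31.1 hp
    refine Runs.block hB he _ hs6 ?_ ?_
    · simp [BlockSafe, Instr.Safe, Instr.run, k18, k13, k15]
      omega
    · have hfound : Found e (s.reg 5) (s.reg 10) (s.reg 11) f (s.reg 0)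
          (runBlock e [.add 8 13 18, .add 9 15 18] s6) := by
        refine ⟨?_, ?_, ?_⟩
        · simp [runBlock, Instr.run, k13, k15, k18]; omega
        · simp [runBlock, Instr.run, k13, k15, k18]; omega
        · simpa [runBlock, Instr.run, k13, k15, k18] using hpass
      refine ⟨Or.inl hfound, fun _ _ => hfound, fun r hr h8 h9 => ?_, ?_, hm6, hu6⟩
      · simp [runBlock, Instr.run, h8, h9]
        exact hk6 r (by omega) (by omega) (by omega)
      · simp [runBlock, Instr.run, k18]
  · intro hp
    refine (Runs.skip hs6 ?_).mono (by omega) (fun _ _ h => h)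
    refine ⟨Or.inr ⟨hk6 8 (by decide) (by decide) (by decide),
      hk6 9 (by decide) (by decide) (by decide)⟩, fun _ h => absurd hp (h31.2 h),
      fun r hr _ _ => hk6 r (by omega) (by omega) (by omega), k18, hm6, hu6⟩

/-- Strings are visited in descending order and newer entries overwrite older ones. The cell read
for string `i` is therefore empty or names the smallest index above `i` with that hash value. Each
string causes at most one test, and this is why `Hit` forbids collisions in between. -/
theorem runs_scanProg {e : Env} {B : ℕ} (hB : 1 ≤ B) (he : |e.corr| ≤ 1) {s : State}
    (hs : Bounded B s) {f : Bool} (hf : s.reg 1 = f.toNat) (hK : s.reg 6 + 2 ≤ B)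
    (hM : s.reg 5 * s.reg 11 < 2 ^ B)
    (hmem : ∀ l < s.reg 0, s.mem (key e (s.reg 5) (s.reg 6) (s.reg 12) f l) = 0) :
    Runs e B scanProg s (s.reg 0 * (s.reg 6 * 30 + s.reg 5 * 16 + 46) + 4) (fun s' =>
      (Found e (s.reg 5) (s.reg 10) (s.reg 11) f (s.reg 0) s' ∨
        (s'.reg 8 = s.reg 8 ∧ s'.reg 9 = s.reg 9)) ∧
      (∀ i j, Hit e (s.reg 5) (s.reg 6) (s.reg 10) (s.reg 11) f (s.reg 0) (s.reg 12) i j →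
        Found e (s.reg 5) (s.reg 10) (s.reg 11) f (s.reg 0) s') ∧
      (∀ r < 13, r ≠ 8 → r ≠ 9 → s'.reg r = s.reg r) ∧ s'.reg 14 = s.reg 14 ∧
      s'.used = s.used) := by
  have h0 := hs 0
  have hp : (0 : ℕ) < 2 ^ B := by positivity
  set ky : Bool → ℕ → ℕ := key e (s.reg 5) (s.reg 6) (s.reg 12) with hky
  set Fd : State → Prop := Found e (s.reg 5) (s.reg 10) (s.reg 11) f (s.reg 0) with hFd
  have hFd_congr : ∀ s₁ s₂ : State, s₁.reg 8 = s₂.reg 8 → s₁.reg 9 = s₂.reg 9 → Fd s₁ → Fd s₂ := by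
    rintro s₁ s₂ h8 h9 ⟨a, b, c⟩
    rw [h8, h9] at a c; rw [h9] at b
    exact ⟨a, b, c⟩
  refine (Runs.seq (T := 3) (T' := s.reg 0 * (s.reg 6 * 30 + s.reg 5 * 16 + 42 + 4) + 1)
    (Runs.block hB he _ hs ?_ ?_)).mono (by ring_nf; omega) (fun _ _ h => h)
  · simp [BlockSafe, Instr.Safe, Instr.run, h0]
  intro hs1
  -- The clause about hits has two phases. After `j₀` and before `i₀` has been visited, the cell of
  -- their common hash value holds `j₀ + 1`; after `i₀` a passing pair is recorded.
  refine (Runs.forDown hB he (by decide) (T := s.reg 6 * 30 + s.reg 5 * 16 + 42) (fun i s' =>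
      (∀ l < s.reg 0, s'.mem (ky f l) = 0 ∨ (i < s'.mem (ky f l) ∧ s'.mem (ky f l) ≤ s.reg 0)) ∧
      (Fd s' ∨ (s'.reg 8 = s.reg 8 ∧ s'.reg 9 = s.reg 9)) ∧
      (∀ i₀ j₀, Hit e (s.reg 5) (s.reg 6) (s.reg 10) (s.reg 11) f (s.reg 0) (s.reg 12) i₀ j₀ →
        (i₀ < i → i ≤ j₀ → s'.mem (ky false j₀) = j₀ + 1) ∧ (i ≤ i₀ → Fd s')) ∧
      (∀ r < 13, r ≠ 8 → r ≠ 9 → s'.reg r = s.reg r) ∧ s'.reg 14 = s.reg 14 ∧ s'.reg 18 = 0 ∧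
      s'.used = s.used)
      (s.reg 0) ?_ hs1 ?_ ?_).mono le_rfl ?_
  · rintro i hi s' hs' hri - ⟨s₀, ⟨htab, hfd, hhit, hfr, h14, h18, hu⟩, hm', hu', hx⟩
    have hfr' : ∀ r < 13, r ≠ 8 → r ≠ 9 → s'.reg r = s.reg r := fun r hr h8 h9 => by
      rw [hx r (by omega) (by omega), hfr r hr h8 h9]
    have hx8 := hx 8 (by decide) (by decide)
    have hx9 := hx 9 (by decide) (by decide)
    rw [← hx 18 (by decide) (by decide)] at h18
    rw [← hx 14 (by decide) (by decide)] at h14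
    rw [← hm'] at htab
    rw [← hu'] at hu
    rw [← hx8, ← hx9] at hfd
    replace hfd : Fd s' ∨ s'.reg 8 = s.reg 8 ∧ s'.reg 9 = s.reg 9 :=
      hfd.imp_left (hFd_congr _ _ hx8.symm hx9.symm)
    have k0 := hfr' 0 (by decide) (by decide) (by decide)
    have k1 := hfr' 1 (by decide) (by decide) (by decide)
    have k5 := hfr' 5 (by decide) (by decide) (by decide)
    have k6 := hfr' 6 (by decide) (by decide) (by decide)
    have k10 := hfr' 10 (by decide) (by decide) (by decide)
    have k11 := hfr' 11 (by decide) (by decide) (by decide)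
    have k12 := hfr' 12 (by decide) (by decide) (by decide)
    refine (Runs.seq (T := s.reg 6 * 15 + s.reg 5 * 16 + 30) (T' := s.reg 6 * 15 + 12) ?_).mono
      (by omega) (fun _ _ h => h)
    refine (runs_probeProg hB he hs' (f := f) (by rw [k1, hf]) (by rw [k6]; exact hK)
      (by rw [k5, k11]; exact hM) h18 rfl ?_).mono (by rw [k5, k6]) ?_
    · rw [k5, k6, k12, hri, k0]; exact htab i hi
    rintro s2 hs2 ⟨hf2, hc2, hfr2, h18', hm2, hu2⟩ -
    rw [k5, k6, k10, k11, k12, k0, hri] at hc2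
    rw [k5, k10, k11, k0] at hf2
    replace hc2 : s'.mem (ky f i) ≠ 0 →
      Passes e (s.reg 5) (s.reg 10) (s.reg 11) f i (s'.mem (ky f i) - 1) → Fd s2 := hc2
    have hfd2 : Fd s2 ∨ (s2.reg 8 = s.reg 8 ∧ s2.reg 9 = s.reg 9) := by
      rcases hf2 with h | ⟨h8, h9⟩
      · exact Or.inl h
      · rcases hfd with h | ⟨h8', h9'⟩
        · exact Or.inl (hFd_congr _ _ h8.symm h9.symm h)
        · exact Or.inr ⟨h8.trans h8', h9.trans h9'⟩
    have hkeep : Fd s₀ → Fd s2 := fun h => by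
      rcases hf2 with h2 | ⟨h8, h9⟩
      · exact h2
      · exact hFd_congr _ _ (hx8.symm.trans h8.symm) (hx9.symm.trans h9.symm) h
    refine (Runs.seq (T := 2) (T' := s.reg 6 * 15 + 10) (Runs.block hB he _ hs2 ?_ ?_)).mono
      (by omega) (fun _ _ h => h)
    · simp [BlockSafe, Instr.Safe]
    intro hs3
    have g3 : ∀ r < 30, (runBlock e [.const 30 0] s2).reg r = s2.reg r := fun r hr => by
      simp [runBlock, Instr.run, hr.ne]
    have g30 : (runBlock e [.const 30 0] s2).reg 30 = false.toNat := by
      simp [runBlock, Instr.run]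
    have gm : (runBlock e [.const 30 0] s2).mem = s2.mem := rfl
    have gu : (runBlock e [.const 30 0] s2).used = s2.used := rfl
    generalize runBlock e [.const 30 0] s2 = s3 at hs3 g3 g30 gm gu ⊢
    have j6 : s3.reg 6 = s.reg 6 := by
      rw [g3 6 (by decide), hfr2 6 (by decide) (by decide) (by decide), k6]
    have j5 : s3.reg 5 = s.reg 5 := by
      rw [g3 5 (by decide), hfr2 5 (by decide) (by decide) (by decide), k5]
    have j12 : s3.reg 12 = s.reg 12 := by
      rw [g3 12 (by decide), hfr2 12 (by decide) (by decide) (by decide), k12]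
    have j13 : s3.reg 13 = i := by
      rw [g3 13 (by decide), hfr2 13 (by decide) (by decide) (by decide), hri]
    refine (Runs.seq (T := s.reg 6 * 15 + 6) (T' := 4) ?_).mono (by omega) (fun _ _ h => h)
    refine (runs_hashProg (e := e) hB he hs3 g30 (by rw [j6]; exact hK)).mono (by rw [j6]) ?_
    rintro s4 hs4 ⟨h31, -, hfr4, hm4, hu4⟩ -
    rw [j5, j6, j12, j13] at h31
    replace h31 : s4.reg 31 = ky false i := h31
    rw [gm, hm2] at hm4
    rw [gu, hu2, hu] at hu4
    have i13 : s4.reg 13 = i := by rw [hfr4 13 (by decide), j13]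
    have h1B : 1 < 2 ^ B := Nat.one_lt_two_pow (by omega)
    refine Runs.block hB he _ hs4 ?_ ?_
    · simp [BlockSafe, Instr.Safe, Instr.run, h1B, i13]
      omega
    set s5 := runBlock e [.const 20 1, .add 20 20 13, .store 31 20] s4 with hs5
    have hmem5 : ∀ a, s5.mem a = if a = ky false i then i + 1 else s'.mem a := fun a => by
      simp [hs5, runBlock, Instr.run, i13, h31, hm4, Function.update_apply, add_comm]
    have hreg5 : ∀ r < 30, r ≠ 20 → s5.reg r = s2.reg r := fun r hr hr' => by
      rw [← g3 r hr, ← hfr4 r (by omega)]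
      simp [hs5, runBlock, Instr.run, hr']
    have hfd5 : Fd s2 → Fd s5 := hFd_congr _ _ (hreg5 8 (by decide) (by decide)).symm
      (hreg5 9 (by decide) (by decide)).symm
    refine ⟨⟨fun l hl => ?_, ?_, fun i₀ j₀ hh => ⟨fun hi₀ hj₀ => ?_, fun hi₀ => ?_⟩,
      fun r hr h8 h9 => ?_, ?_, ?_, ?_⟩, ?_⟩
    · rw [hmem5]
      split_ifs
      · right; omega
      · rcases htab l hl with h | h
        · exact Or.inl h
        · right; omega
    · rw [hreg5 8 (by decide) (by decide), hreg5 9 (by decide) (by decide)]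
      exact hfd2.imp_left hfd5
    · rw [hmem5]
      split_ifs with hk
      · rcases hj₀.eq_or_lt with rfl | hlt
        · rfl
        · exact absurd hk.symm (hh.2.2.2.2 i hi₀ hlt)
      · rcases hj₀.eq_or_lt with rfl | hlt
        · exact absurd rfl hk
        · rw [hm']; exact (hhit i₀ j₀ hh).1 (by omega) hlt
    · rcases hi₀.eq_or_lt with rfl | hlt
      · have hmj := (hhit i j₀ hh).1 (by omega) hh.1
        rw [← hm', ← (show ky f i = ky false j₀ from hh.2.2.2.1)] at hmj
        refine hfd5 (hc2 (by omega) ?_)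
        rw [hmj]
        exact hh.2.2.1
      · exact hfd5 (hkeep ((hhit i₀ j₀ hh).2 hlt))
    · rw [hreg5 r (by omega) (by omega), hfr2 r (by omega) h8 h9, hfr' r hr h8 h9]
    · rw [hreg5 14 (by decide) (by decide), hfr2 14 (by decide) (by decide) (by decide), h14]
    · rw [hreg5 18 (by decide) (by decide), h18']
    · simpa [hs5, runBlock, Instr.run] using hu4
    · rw [hreg5 13 (by decide) (by decide), hfr2 13 (by decide) (by decide) (by decide), hri]
  · simp [runBlock, Instr.run]
  · refine ⟨fun l hl => Or.inl (hmem l hl), Or.inr (by simp [runBlock, Instr.run]),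
      fun i₀ j₀ hh => ⟨fun _ h => ?_, fun h => ?_⟩, fun r hr _ _ => ?_, ?_, ?_, ?_⟩
    · have := hh.2.1; omega
    · have := hh.1.trans hh.2.1; omega
    · simp [runBlock, Instr.run, show r ≠ 13 by omega, show r ≠ 18 by omega]
    all_goals simp [runBlock, Instr.run]
  · rintro s' - ⟨⟨-, hfd, hhit, hfr, h14, -, hu⟩, -⟩
    exact ⟨hfd, fun i j h => (hhit i j h).2 (Nat.zero_le _), hfr, h14, hu⟩

/-- Repeatedly (`reg 7` times) draw a seed, and search for a colliding pair. -/
def searchProg : Prog :=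
  forDown 7 24 <| .seq seedProg <| .seq clearProg scanProg

/-- The seed of repetition number `r`, drawn from coins `r * v, …, r * v + v - 1`. -/
def repSeed (ω : ℕ → Bool) (v r : ℕ) : ℕ := coinNum (fun q => ω (r * v + q)) v

theorem Found.congr {e : Env} {M thr q : ℕ} {f : Bool} {n : ℕ} {s₁ s₂ : State}
    (h : Found e M thr q f n s₁) (h8 : s₁.reg 8 = s₂.reg 8) (h9 : s₁.reg 9 = s₂.reg 9) :
    Found e M thr q f n s₂ := by
  obtain ⟨a, b, c⟩ := h
  rw [h8, h9] at a c; rw [h9] at b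
  exact ⟨a, b, c⟩

/-- A recorded pair is replaced only by another pair that passes the test, so a hit in any one
repetition guarantees a passing pair at the end. -/
theorem runs_searchProg {e : Env} {B : ℕ} (hB : 1 ≤ B) (he : |e.corr| ≤ 1) {s : State}
    (hs : Bounded B s) {f : Bool} (hf : s.reg 1 = f.toNat) (hK : s.reg 6 + 2 ≤ B)
    (hM : s.reg 5 * s.reg 11 < 2 ^ B) (hv : s.reg 14 + 1 ≤ B) (hu0 : s.used = 0) :
    Runs e B searchProg s
      (s.reg 7 * (s.reg 14 * 8 + s.reg 0 * (s.reg 6 * 45 + s.reg 5 * 16 + 60) + 16) + 1) (fun s' =>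
      ∀ r < s.reg 7, ∀ i j, Hit e (s.reg 5) (s.reg 6) (s.reg 10) (s.reg 11) f (s.reg 0)
        (repSeed e.coins (s.reg 14) r) i j →
        Found e (s.reg 5) (s.reg 10) (s.reg 11) f (s.reg 0) s') := by
  refine (Runs.forDown hB he (by decide)
    (T := s.reg 14 * 8 + s.reg 0 * (s.reg 6 * 45 + s.reg 5 * 16 + 60) + 12)
    (fun k s' => k ≤ s.reg 7 ∧
      (∀ r < s.reg 7 - k, ∀ i j, Hit e (s.reg 5) (s.reg 6) (s.reg 10) (s.reg 11) f (s.reg 0)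
        (repSeed e.coins (s.reg 14) r) i j →
        Found e (s.reg 5) (s.reg 10) (s.reg 11) f (s.reg 0) s') ∧
      (∀ r < 12, r ≠ 7 → r ≠ 8 → r ≠ 9 → s'.reg r = s.reg r) ∧ s'.reg 14 = s.reg 14 ∧
      s'.used = (s.reg 7 - k) * s.reg 14) (s.reg 7) ?_ hs rfl ?_).mono le_rfl ?_
  · rintro k hk s' hs' hrk - ⟨s₀, ⟨hk', hfd, hfr, h14, hu⟩, hm', hu', hx⟩
    have hfr' : ∀ r < 12, r ≠ 7 → r ≠ 8 → r ≠ 9 → s'.reg r = s.reg r := fun r hr h7 h8 h9 => by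
      rw [hx r h7 (by omega), hfr r hr h7 h8 h9]
    rw [← hx 14 (by decide) (by decide)] at h14
    rw [← hu'] at hu
    have hx8 := hx 8 (by decide) (by decide)
    have hx9 := hx 9 (by decide) (by decide)
    refine (Runs.seq (T := s.reg 14 * 8 + 4)
      (T' := s.reg 0 * (s.reg 6 * 45 + s.reg 5 * 16 + 60) + 8) ?_).mono (by omega)
      (fun _ _ h => h)
    refine (runs_seedProg hB he hs' (by rw [h14]; exact hv)).mono (by rw [h14]) ?_
    rintro s1 hs1 ⟨hseed, hfr1, hu1⟩ -
    have g : ∀ r < 12, r ≠ 7 → r ≠ 8 → r ≠ 9 → s1.reg r = s.reg r := fun r hr h7 h8 h9 => by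
      rw [hfr1 r (by omega) (by omega), hfr' r hr h7 h8 h9]
    have g0 := g 0 (by decide) (by decide) (by decide) (by decide)
    have g1 := g 1 (by decide) (by decide) (by decide) (by decide)
    have g5 := g 5 (by decide) (by decide) (by decide) (by decide)
    have g6 := g 6 (by decide) (by decide) (by decide) (by decide)
    have g10 := g 10 (by decide) (by decide) (by decide) (by decide)
    have g11 := g 11 (by decide) (by decide) (by decide) (by decide)
    have g14 : s1.reg 14 = s.reg 14 := by rw [hfr1 14 (by decide) (by decide), h14]
    have hseed' : s1.reg 12 = repSeed e.coins (s.reg 14) (s.reg 7 - (k + 1)) := by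
      rw [hseed, hu, h14, repSeed]
    refine (Runs.seq (T := s.reg 0 * (s.reg 6 * 15 + 14) + 4)
      (T' := s.reg 0 * (s.reg 6 * 30 + s.reg 5 * 16 + 46) + 4) ?_).mono (by ring_nf; omega)
      (fun _ _ h => h)
    refine (runs_clearProg hB he hs1 (f := f) (by rw [g1, hf]) (by rw [g6]; exact hK)).mono
      (by rw [g0, g6]) ?_
    rintro s2 hs2 ⟨hclear, hfr2, h14', hu2⟩ -
    have k' : ∀ r < 13, s2.reg r = s1.reg r := hfr2
    refine (runs_scanProg hB he hs2 (f := f) (by rw [k' 1 (by decide), g1, hf])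
      (by rw [k' 6 (by decide), g6]; exact hK)
      (by rw [k' 5 (by decide), g5, k' 11 (by decide), g11]; exact hM) ?_).mono
      (by rw [k' 0 (by decide), g0, k' 6 (by decide), g6, k' 5 (by decide), g5]) ?_
    · rw [k' 0 (by decide), k' 5 (by decide), k' 6 (by decide), k' 12 (by decide)]
      exact hclear
    rintro s3 hs3 ⟨hfd3, hhit3, hfr3, h14'', hu3⟩
    rw [k' 5 (by decide), g5, k' 10 (by decide), g10, k' 11 (by decide), g11, k' 0 (by decide),
      g0] at hfd3 hhit3
    rw [k' 6 (by decide), g6, k' 12 (by decide), hseed'] at hhit3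
    refine ⟨⟨by omega, fun r hr i j hh => ?_, fun r hr h7 h8 h9 => ?_, ?_, ?_⟩, ?_⟩
    · rcases Nat.lt_or_ge r (s.reg 7 - (k + 1)) with hlt | hge
      · have h0 := hfd r hlt i j hh
        rcases hfd3 with h | ⟨h8, h9⟩
        · exact h
        · refine h0.congr ?_ ?_
          · rw [h8, k' 8 (by decide), hfr1 8 (by decide) (by decide), hx8]
          · rw [h9, k' 9 (by decide), hfr1 9 (by decide) (by decide), hx9]
      · obtain rfl : r = s.reg 7 - (k + 1) := by omega
        exact hhit3 i j hh
    · rw [hfr3 r (by omega) h8 h9, k' r (by omega), g r hr h7 h8 h9]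
    · rw [h14'', h14', g14]
    · rw [hu3, hu2, hu1, hu, h14, ← Nat.succ_mul]
      congr 1; omega
    · rw [hfr3 7 (by decide) (by decide) (by decide), k' 7 (by decide),
        hfr1 7 (by decide) (by decide), hrk]
  · exact ⟨le_rfl, fun r hr => by omega, fun _ _ _ _ _ => rfl, rfl, by simp [hu0]⟩
  · rintro s' - ⟨⟨-, h, -⟩, -⟩
    simpa using h

/-! ### The parameters of the search -/

/-- If |ρ| < 1, every `t` above 2, 1/|ρ| and 2/(1 - |ρ|) qualifies, since then |ρ|t + 1 < t. If |ρ|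
= 1, then `t = 2` does. The number serves as a lower bound for the distances of |ρ| from 0 and,
unless |ρ| = 1, from 1 that the machine can find by integer queries. -/
theorem exists_scale {ρ : ℝ} (h0 : ρ ≠ 0) (h1 : |ρ| ≤ 1) :
    ∃ t : ℕ, 2 ≤ t ∧ 1 ≤ ⌊|ρ| * t⌋₊ ∧ ⌊|ρ| * t⌋₊ + 1 ≠ t := by
  have hpos : 0 < |ρ| := abs_pos.2 h0
  rcases h1.eq_or_lt with h | h
  · refine ⟨2, le_rfl, ?_, ?_⟩ <;> rw [h] <;> norm_num
  · obtain ⟨t, ht⟩ := exists_nat_gt (max 2 (max (1 / |ρ|) (2 / (1 - |ρ|))))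
    have ht2 : (2 : ℝ) < t := (le_max_left _ _).trans_lt ht
    have ht3 : 1 / |ρ| < t := ((le_max_left _ _).trans (le_max_right _ _)).trans_lt ht
    have ht4 : 2 / (1 - |ρ|) < t := ((le_max_right _ _).trans (le_max_right _ _)).trans_lt ht
    rw [div_lt_iff₀ hpos] at ht3
    rw [div_lt_iff₀ (by linarith)] at ht4
    refine ⟨t, by exact_mod_cast ht2.le, ?_, ?_⟩
    · rw [Nat.one_le_floor_iff]; linarith
    · have hfl : (⌊|ρ| * t⌋₊ : ℝ) ≤ |ρ| * t := Nat.floor_le (by positivity)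
      intro heq
      have : ((⌊|ρ| * t⌋₊ + 1 : ℕ) : ℝ) = t := by rw [heq]
      push_cast at this
      nlinarith

open Classical in
/-- The least `t ≥ 2` whose query certifies `1 / t ≤ |ρ|`, and `|ρ| = 1` or `|ρ| < 1 - 1 / t`. -/
noncomputable def scale (ρ : ℝ) : ℕ :=
  sInf {t : ℕ | 2 ≤ t ∧ 1 ≤ ⌊|ρ| * t⌋₊ ∧ ⌊|ρ| * t⌋₊ + 1 ≠ t}

/-- The binary length of the number `coords` of positions in use. -/
noncomputable def coordBits (ρ : ℝ) (n : ℕ) : ℕ := (scale ρ * scale ρ * n.size * 8192).size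

/-- The number of positions in use. -/
noncomputable def coords (ρ : ℝ) (n : ℕ) : ℕ := 2 ^ coordBits ρ n

/-- The hash length. -/
noncomputable def hashLen (ρ : ℝ) (n : ℕ) : ℕ :=
  (1 + n.size) * (64 * scale ρ) * 8 / (⌊|ρ| * ((64 * scale ρ : ℕ) : ℝ)⌋₊ * 7) + 1

/-- The binary logarithm of the number of repetitions, up to a logarithmic factor. -/
noncomputable def repBits (ρ : ℝ) (n : ℕ) : ℕ :=
  (hashLen ρ n * 8 - ⌊|ρ| * ((hashLen ρ n * 8 : ℕ) : ℝ)⌋₊) * 9 / 64 + 1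

/-- The number of repetitions. -/
noncomputable def reps (ρ : ℝ) (n : ℕ) : ℕ := 8 * n.size * 2 ^ repBits ρ n

/-- The number of coins used in each repetition. -/
noncomputable def seedLen (ρ : ℝ) (n : ℕ) : ℕ := hashLen ρ n * coordBits ρ n

/-- The acceptance threshold of the test. -/
noncomputable def thresh (ρ : ℝ) (n : ℕ) : ℕ := (scale ρ + scale ρ + 1) * coords ρ n

/-- The weight of the agreements in the test. -/
noncomputable def weight (ρ : ℝ) : ℕ := scale ρ + scale ρ + (scale ρ + scale ρ)

/-- A bound for the binary length of all numbers that occur. -/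
noncomputable def wordLen (ρ : ℝ) (n : ℕ) : ℕ :=
  60 + 3 * scale ρ + 3 * n.size + 3 * coordBits ρ n + 3 * hashLen ρ n + repBits ρ n + seedLen ρ n

theorem scale_spec {ρ : ℝ} (h0 : ρ ≠ 0) (h1 : |ρ| ≤ 1) :
    2 ≤ scale ρ ∧ 1 ≤ ⌊|ρ| * scale ρ⌋₊ ∧ ⌊|ρ| * scale ρ⌋₊ + 1 ≠ scale ρ :=
  Nat.sInf_mem (exists_scale h0 h1)

theorem not_of_lt_scale {ρ : ℝ} {t : ℕ} (ht : t < scale ρ) :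
    ¬ (2 ≤ t ∧ 1 ≤ ⌊|ρ| * t⌋₊ ∧ ⌊|ρ| * t⌋₊ + 1 ≠ t) :=
  Nat.notMem_of_lt_sInf (s := {t : ℕ | 2 ≤ t ∧ 1 ≤ ⌊|ρ| * t⌋₊ ∧ ⌊|ρ| * t⌋₊ + 1 ≠ t}) ht

/-! ### The setup -/

/-- Compute `scale` into `reg 2`. -/
def scaleProg : Prog :=
  .seq (block [.const 2 1, .const 15 1]) <|
  .loop 15 <| block [.const 16 1, .add 2 2 16, .corr 17 2, .sub 18 16 17, .add 19 17 16,
    .sub 20 19 2, .sub 21 2 19, .add 20 20 21, .sub 20 16 20, .add 15 18 20]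

/-- Register 15 stays nonzero as long as one of the two conditions fails. Minimality of `scale`
shows that this happens for all smaller candidates, so the number of iterations is known in advance.
-/
theorem runs_scaleProg {e : Env} {B : ℕ} (h0 : e.corr ≠ 0) (he : |e.corr| ≤ 1)
    (hB : scale e.corr + 2 ≤ B) {s : State} (hs : Bounded B s) :
    Runs e B scaleProg s (scale e.corr * 12 + 4) (fun s' =>
      s'.reg 2 = scale e.corr ∧ (∀ r < 2, s'.reg r = s.reg r) ∧ s'.used = s.used) := by
  set t := scale e.corr with ht
  obtain ⟨ht2, -⟩ := scale_spec h0 he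
  rw [← ht] at ht2
  have h1B : 1 < 2 ^ B := Nat.one_lt_two_pow (by omega)
  have htB : t + 2 < 2 ^ B := lt_of_lt_of_le (Nat.lt_two_pow_self (n := t + 2))
    (Nat.pow_le_pow_right (by norm_num) hB)
  refine (Runs.seq (T := 3) (T' := (t - 1) * 12 + 1)
    (Runs.block (by omega) he _ hs ?_ ?_)).mono (by omega) (fun _ _ h => h)
  · simp [BlockSafe, Instr.Safe, h1B]
  intro hs1
  refine (Runs.loop (T := 11) (fun k s' => k + 1 ≤ t ∧ s'.reg 2 = t - k ∧
    (∀ r < 2, s'.reg r = s.reg r) ∧ s'.used = s.used ∧ (s'.reg 15 = 0 ↔ k = 0)) ?_ ?_ (t - 1) _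
    hs1 ?_).mono le_rfl ?_
  · rintro s' - ⟨-, -, -, -, h⟩
    exact h.2 rfl
  · rintro k s' hs' ⟨hk, h2, hfr, hu, h15⟩
    refine ⟨fun h => by simpa using h15.1 h, ?_⟩
    have hstep : t - (k + 1) + 1 = t - k := by omega
    have hfl : ⌊|e.corr| * ((t - k : ℕ) : ℝ)⌋₊ ≤ t - k :=
      Nat.floor_le_of_le (mul_le_of_le_one_left (Nat.cast_nonneg _) he)
    have hgood : k = 0 ↔
        1 ≤ ⌊|e.corr| * ((t - k : ℕ) : ℝ)⌋₊ ∧ ⌊|e.corr| * ((t - k : ℕ) : ℝ)⌋₊ + 1 ≠ t - k := by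
      constructor
      · rintro rfl
        exact (scale_spec h0 he).2
      · intro h
        by_contra hk0
        exact not_of_lt_scale (ρ := e.corr) (t := t - k) (by omega) ⟨by omega, h⟩
    generalize ha : ⌊|e.corr| * ((t - k : ℕ) : ℝ)⌋₊ = a at hfl hgood
    refine Runs.block (by omega) he _ hs' ?_ ?_
    · simp [BlockSafe, Instr.Safe, Instr.run, h2, hstep, ha, h1B, -Nat.cast_add]
      omega
    · simp [runBlock, Instr.run, h2, hstep, ha, hu, -Nat.cast_add]
      refine ⟨by omega, fun r hr => ?_, by omega⟩
      rw [← hfr r (by omega)]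
      simp [show r ≠ 2 by omega, show r ≠ 15 by omega, show r ≠ 16 by omega, show r ≠ 17 by omega,
        show r ≠ 18 by omega, show r ≠ 19 by omega, show r ≠ 20 by omega, show r ≠ 21 by omega]
  · simp [runBlock, Instr.run]
    refine ⟨by omega, by omega, fun r hr => ?_, by omega⟩
    simp [show r ≠ 15 by omega, show r ≠ 2 by omega]
  · rintro s' - ⟨-, h2, hfr, hu, -⟩
    exact ⟨h2, hfr, hu⟩

/-- Compute the binary length of `reg 30` into `reg 31`, and the corresponding power of two into
`reg 32`. -/
def sizeProg : Prog :=
  .seq (block [.const 31 0, .const 32 1, .const 33 2, .const 34 1]) <|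
  .loop 30 <| block [.div 30 30 33, .add 31 31 34, .add 32 32 32]

theorem size_div_two {x : ℕ} (k : ℕ) (h : x.size = k + 1) : (x / 2).size = k := by
  have h1 : x < 2 ^ (k + 1) := Nat.size_le.1 h.le
  have h2 : ¬ x < 2 ^ k := fun hx => by have := Nat.size_le.2 hx; omega
  rw [pow_succ] at h1
  refine le_antisymm (Nat.size_le.2 (by omega)) ?_
  rcases k with _ | k
  · omega
  · rw [pow_succ] at h2
    exact Nat.lt_size.2 (by omega)

theorem runs_sizeProg {e : Env} {B : ℕ} (he : |e.corr| ≤ 1) {s : State} (hs : Bounded B s)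
    (hB : (s.reg 30).size + 2 ≤ B) :
    Runs e B sizeProg s ((s.reg 30).size * 5 + 6) (fun s' =>
      s'.reg 31 = (s.reg 30).size ∧ s'.reg 32 = 2 ^ (s.reg 30).size ∧
      (∀ r < 30, s'.reg r = s.reg r) ∧ s'.used = s.used) := by
  set z := (s.reg 30).size with hz
  have h4B : 4 ≤ 2 ^ B := by
    calc 4 = 2 ^ 2 := rfl
      _ ≤ 2 ^ B := Nat.pow_le_pow_right (by norm_num) (by omega)
  refine (Runs.seq (T := 5) (T' := z * 5 + 1)
    (Runs.block (by omega) he _ hs ?_ ?_)).mono (by omega) (fun _ _ h => h)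
  · simp [BlockSafe, Instr.Safe]
    omega
  intro hs1
  refine (Runs.loop (T := 4) (fun k s' => (s'.reg 30).size = k ∧ s'.reg 31 + k = z ∧
    s'.reg 32 = 2 ^ s'.reg 31 ∧ s'.reg 33 = 2 ∧ s'.reg 34 = 1 ∧
    (∀ r < 30, s'.reg r = s.reg r) ∧ s'.used = s.used) ?_ ?_ z _ hs1 ?_).mono le_rfl ?_
  · rintro s' - ⟨h, -⟩
    exact Nat.size_eq_zero.1 h
  · rintro k s' hs' ⟨h30, h31, h32, h33, h34, hfr, hu⟩
    refine ⟨fun h => by rw [h] at h30; simp at h30, ?_⟩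
    have hlt : s'.reg 31 < B := by omega
    have hp : 2 ^ s'.reg 31 * 2 < 2 ^ B := by
      rw [← pow_succ]; exact Nat.pow_lt_pow_right (by norm_num) (by omega)
    have hBB : B < 2 ^ B := Nat.lt_two_pow_self
    refine Runs.block (by omega) he _ hs' ?_ ?_
    · simp [BlockSafe, Instr.Safe, Instr.run, h32, h33, h34]
      omega
    · simp [runBlock, Instr.run, h32, h33, h34, hu]
      refine ⟨size_div_two k h30, by omega, by rw [pow_succ]; omega, fun r hr => ?_⟩
      rw [← hfr r hr]
      simp [show r ≠ 30 by omega, show r ≠ 31 by omega, show r ≠ 32 by omega]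
  · simp [runBlock, Instr.run, hz]
    intro r hr
    simp [show r ≠ 31 by omega, show r ≠ 32 by omega, show r ≠ 33 by omega, show r ≠ 34 by omega]
  · rintro s' - ⟨-, h31, h32, -, -, hfr, hu⟩
    rw [add_zero] at h31
    exact ⟨h31, by rw [h32, h31], hfr, hu⟩

/-- Compute the parameters of the search. -/
def setupProg : Prog :=
  .seq scaleProg <|
  .seq (block [.const 30 0, .add 30 30 0]) <| .seq sizeProg <|
  .seq (block [.const 18 0, .add 3 31 18, .mul 30 2 2, .mul 30 30 3, .const 16 8192,
    .mul 30 30 16]) <| .seq sizeProg <|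
  .seq (block [.const 18 0, .add 4 31 18, .add 5 32 18, .const 16 64, .mul 16 16 2, .corr 17 16,
    .const 19 7, .mul 17 17 19, .const 19 1, .add 19 19 3, .mul 19 19 16, .const 16 8,
    .mul 19 19 16, .div 19 19 17, .const 16 1, .add 6 19 16]) <|
  .seq (block [.const 16 8, .mul 17 6 16, .corr 19 17, .sub 17 17 19, .const 16 9, .mul 17 17 16,
    .const 16 64, .div 17 17 16, .const 16 1, .add 17 17 16]) <|
  .seq (block [.mul 14 6 4, .add 11 2 2, .add 10 11 16, .mul 10 10 5, .add 11 11 11, .const 7 8,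
    .mul 7 7 3]) <|
  forDown 17 16 <| block [.add 7 7 7]

theorem mul_lt_two_pow {a b x y : ℕ} (ha : a < 2 ^ x) (hb : b < 2 ^ y) : a * b < 2 ^ (x + y) := by
  rw [pow_add]
  exact Nat.mul_lt_mul'' ha hb

theorem lt_two_pow_mono {a x y : ℕ} (ha : a < 2 ^ x) (h : x ≤ y) : a < 2 ^ y :=
  ha.trans_le (Nat.pow_le_pow_right (by norm_num) h)

set_option maxHeartbeats 800000 in
-- All parameters are obtained by integer arithmetic from `n` and the queries. Every intermediate
-- product stays within the word length because `x < 2 ^ x` for each parameter and `wordLen`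
-- contains the parameters with sufficient multiplicity.
theorem runs_setupProg {e : Env} {n : ℕ} (h0 : e.corr ≠ 0) (he : |e.corr| ≤ 1)
    {s : State} (hn : s.reg 0 = n) (hs : Bounded (wordLen e.corr n) s) :
    Runs e (wordLen e.corr n) setupProg s
      (scale e.corr * 12 + n.size * 5 + coordBits e.corr n * 5 + repBits e.corr n * 6 + 80)
      (fun s' => s'.reg 0 = n ∧ s'.reg 1 = s.reg 1 ∧ s'.reg 5 = coords e.corr n ∧
        s'.reg 6 = hashLen e.corr n ∧ s'.reg 7 = reps e.corr n ∧ s'.reg 10 = thresh e.corr n ∧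
        s'.reg 11 = weight e.corr ∧ s'.reg 14 = seedLen e.corr n ∧ s'.used = s.used) := by
  set ρ := e.corr with hρ
  set t := scale ρ with ht
  set K := n.size with hK
  set u := coordBits ρ n with hu
  set k := hashLen ρ n with hk
  set E := repBits ρ n with hE
  set v := seedLen ρ n with hv
  set B := wordLen ρ n with hB
  have hBdef : B = 60 + 3 * t + 3 * K + 3 * u + 3 * k + E + v := rfl
  have hudef : (t * t * K * 8192).size = u := rfl
  have hkdef' : k = (1 + K) * (64 * t) * 8 / (⌊|ρ| * ((64 * t : ℕ) : ℝ)⌋₊ * 7) + 1 := rfl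
  have hEdef' : E = (k * 8 - ⌊|ρ| * ((k * 8 : ℕ) : ℝ)⌋₊) * 9 / 64 + 1 := rfl
  have hvdef : k * u = v := rfl
  have hcoords : coords ρ n = 2 ^ u := rfl
  have hthresh : thresh ρ n = (t + t + 1) * 2 ^ u := rfl
  have hweight : weight ρ = t + t + (t + t) := rfl
  have hreps : reps ρ n = 8 * K * 2 ^ E := rfl
  rw [hcoords, hthresh, hweight, hreps]
  -- The defining equations have been recorded above; from here on the parameters are treated as
  -- unknowns.
  clear_value B v E k u K t
  have ht2 : t < 2 ^ t := Nat.lt_two_pow_self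
  have hK2 : K < 2 ^ K := Nat.lt_two_pow_self
  have hu2 : u < 2 ^ u := Nat.lt_two_pow_self
  have hk2 : k < 2 ^ k := Nat.lt_two_pow_self
  have hE2 : E < 2 ^ E := Nat.lt_two_pow_self
  have hv2 : v < 2 ^ v := Nat.lt_two_pow_self
  have hB2 : B < 2 ^ B := Nat.lt_two_pow_self
  have hBig : 8192 * 2 ≤ 2 ^ B := by
    calc 8192 * 2 = 2 ^ 14 := by norm_num
      _ ≤ 2 ^ B := Nat.pow_le_pow_right (by norm_num) (by omega)
  have hnB : n < 2 ^ B := hn ▸ hs 0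
  have hB1 : 1 ≤ B := by omega
  refine (Runs.seq (T := t * 12 + 4)
    (T' := K * 5 + u * 5 + E * 6 + 76) ?_).mono (by omega) (fun _ _ h => h)
  refine (runs_scaleProg h0 he (by rw [← hρ, ← ht]; omega) hs).mono (by rw [ht]) ?_
  rintro s1 hs1 ⟨h2, hfr1, hu1⟩ -
  rw [← hρ, ← ht] at h2
  have h10 : s1.reg 0 = n := by rw [hfr1 0 (by decide), hn]
  have h11 := hfr1 1 (by decide)
  clear hfr1
  refine (Runs.seq (T := 3) (T' := K * 5 + u * 5 + E * 6 + 73)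
    (Runs.block hB1 he _ hs1 ?_ ?_)).mono (by omega) (fun _ _ h => h)
  · simp [BlockSafe, Instr.Safe, Instr.run, h10, hnB]
  intro hs2
  generalize hd2 : runBlock e _ s1 = s2 at hs2 ⊢
  have h30 : s2.reg 30 = n := by simp [← hd2, runBlock, Instr.run, h10]
  have h20 : s2.reg 0 = n := by simp [← hd2, runBlock, Instr.run, h10]
  have h21 : s2.reg 1 = s.reg 1 := by simp [← hd2, runBlock, Instr.run, h11]
  have h22 : s2.reg 2 = t := by simp [← hd2, runBlock, Instr.run, h2]
  have hu2 : s2.used = s.used := by simp [← hd2, runBlock, Instr.run, hu1]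
  clear hd2
  refine (Runs.seq (T := K * 5 + 6) (T' := u * 5 + E * 6 + 67) ?_).mono (by omega)
    (fun _ _ h => h)
  refine (runs_sizeProg he hs2 (by rw [h30]; omega)).mono (by rw [h30, hK]) ?_
  rintro s3 hs3 ⟨h31, -, hfr3, hu3⟩ -
  rw [h30, ← hK] at h31
  have h30 : s3.reg 0 = n := by rw [hfr3 0 (by decide), h20]
  have h3s : s3.reg 1 = s.reg 1 := by rw [hfr3 1 (by decide), h21]
  have h32 : s3.reg 2 = t := by rw [hfr3 2 (by decide), h22]
  rw [hu2] at hu3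
  clear hfr3
  have htt : t * t < 2 ^ (t + t) := mul_lt_two_pow ht2 ht2
  have httK : t * t * K < 2 ^ (t + t + K) := mul_lt_two_pow htt hK2
  have httK' : t * t * K * 8192 < 2 ^ (t + t + K + 14) := mul_lt_two_pow httK (by norm_num)
  refine (Runs.seq (T := 7) (T' := u * 5 + E * 6 + 60)
    (Runs.block hB1 he _ hs3 ?_ ?_)).mono (by omega) (fun _ _ h => h)
  · have q1 := lt_two_pow_mono htt (y := B) (by omega)
    have q2 := lt_two_pow_mono httK (y := B) (by omega)
    have q3 := lt_two_pow_mono httK' (y := B) (by omega)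
    simp [BlockSafe, Instr.Safe, Instr.run, h31, h32, q1, q2, q3]
    omega
  intro hs4
  generalize hd4 : runBlock e _ s3 = s4 at hs4 ⊢
  have h430 : s4.reg 30 = t * t * K * 8192 := by simp [← hd4, runBlock, Instr.run, h31, h32]
  have h43 : s4.reg 3 = K := by simp [← hd4, runBlock, Instr.run, h31]
  have h40 : s4.reg 0 = n := by simp [← hd4, runBlock, Instr.run, h30]
  have h41 : s4.reg 1 = s.reg 1 := by simp [← hd4, runBlock, Instr.run, h3s]
  have h42 : s4.reg 2 = t := by simp [← hd4, runBlock, Instr.run, h32]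
  have hu4 : s4.used = s.used := by simp [← hd4, runBlock, Instr.run, hu3]
  clear hd4
  have hsz : (s4.reg 30).size = u := by rw [h430, hudef]
  refine (Runs.seq (T := u * 5 + 6) (T' := E * 6 + 54) ?_).mono (by omega) (fun _ _ h => h)
  refine (runs_sizeProg he hs4 (by rw [hsz]; omega)).mono (by rw [hsz]) ?_
  rintro s5 hs5 ⟨h531, h532, hfr5, hu5⟩ -
  rw [hsz] at h531 h532
  have h50 : s5.reg 0 = n := by rw [hfr5 0 (by decide), h40]
  have h51 : s5.reg 1 = s.reg 1 := by rw [hfr5 1 (by decide), h41]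
  have h52 : s5.reg 2 = t := by rw [hfr5 2 (by decide), h42]
  have h53 : s5.reg 3 = K := by rw [hfr5 3 (by decide), h43]
  rw [hu4] at hu5
  clear hfr5
  have h64 : 64 * t < 2 ^ (7 + t) := mul_lt_two_pow (by norm_num) ht2
  obtain ⟨a, ha⟩ : ∃ a, a = ⌊|ρ| * ((64 * t : ℕ) : ℝ)⌋₊ := ⟨_, rfl⟩
  have hale : a ≤ 64 * t :=
    ha.trans_le (Nat.floor_le_of_le (mul_le_of_le_one_left (Nat.cast_nonneg _) he))
  have ha7 : a * 7 < 2 ^ (7 + t + 3) := mul_lt_two_pow (hale.trans_lt h64) (by norm_num)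
  have hK1 : 1 + K < 2 ^ (1 + K) := Nat.lt_two_pow_self
  have hKq : (1 + K) * (64 * t) < 2 ^ (1 + K + (7 + t)) := mul_lt_two_pow hK1 h64
  have hKq8 : (1 + K) * (64 * t) * 8 < 2 ^ (1 + K + (7 + t) + 4) :=
    mul_lt_two_pow hKq (by norm_num)
  have hkdef : k = (1 + K) * (64 * t) * 8 / (a * 7) + 1 := by rw [ha]; exact hkdef'
  have huB : 2 ^ u < 2 ^ B := Nat.pow_lt_pow_right (by norm_num) (by omega)
  refine (Runs.seq (T := 17) (T' := E * 6 + 37)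
    (Runs.block hB1 he _ hs5 ?_ ?_)).mono (by omega) (fun _ _ h => h)
  · have q1 := lt_two_pow_mono h64 (y := B) (by omega)
    have q2 := lt_two_pow_mono ha7 (y := B) (by omega)
    have q3 := lt_two_pow_mono hKq (y := B) (by omega)
    have q4 := lt_two_pow_mono hKq8 (y := B) (by omega)
    simp [BlockSafe, Instr.Safe, Instr.run, h531, h532, h52, h53, ← hρ, ← ha, q1, q2, q3, q4,
      ← hkdef, huB, -Nat.cast_mul]
    omega
  intro hs6
  generalize hd6 : runBlock e _ s5 = s6 at hs6 ⊢
  have h60 : s6.reg 0 = n := by simp [← hd6, runBlock, Instr.run, h50]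
  have h61 : s6.reg 1 = s.reg 1 := by simp [← hd6, runBlock, Instr.run, h51]
  have h62 : s6.reg 2 = t := by simp [← hd6, runBlock, Instr.run, h52]
  have h63 : s6.reg 3 = K := by simp [← hd6, runBlock, Instr.run, h53]
  have h64' : s6.reg 4 = u := by simp [← hd6, runBlock, Instr.run, h531]
  have h65 : s6.reg 5 = 2 ^ u := by simp [← hd6, runBlock, Instr.run, h532]
  have h66 : s6.reg 6 = k := by
    simp [← hd6, runBlock, Instr.run, h52, h53, ← hρ, ← ha, ← hkdef, -Nat.cast_mul]
  have hu6 : s6.used = s.used := by simp [← hd6, runBlock, Instr.run, hu5]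
  clear hd6
  obtain ⟨b, hb⟩ : ∃ b, b = ⌊|ρ| * ((k * 8 : ℕ) : ℝ)⌋₊ := ⟨_, rfl⟩
  have hEdef : E = (k * 8 - b) * 9 / 64 + 1 := by rw [hb]; exact hEdef'
  have hk8 : k * 8 * 9 < 2 ^ (k + 4 + 4) :=
    mul_lt_two_pow (mul_lt_two_pow hk2 (by norm_num)) (by norm_num)
  refine (Runs.seq (T := 11) (T' := E * 6 + 26)
    (Runs.block hB1 he _ hs6 ?_ ?_)).mono (by omega) (fun _ _ h => h)
  · have q1 := lt_two_pow_mono hk8 (y := B) (by omega)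
    simp [BlockSafe, Instr.Safe, Instr.run, h66, ← hρ, ← hb, ← hEdef, -Nat.cast_mul]
    omega
  intro hs7
  generalize hd7 : runBlock e _ s6 = s7 at hs7 ⊢
  have h70 : s7.reg 0 = n := by simp [← hd7, runBlock, Instr.run, h60]
  have h71 : s7.reg 1 = s.reg 1 := by simp [← hd7, runBlock, Instr.run, h61]
  have h72 : s7.reg 2 = t := by simp [← hd7, runBlock, Instr.run, h62]
  have h73 : s7.reg 3 = K := by simp [← hd7, runBlock, Instr.run, h63]
  have h74 : s7.reg 4 = u := by simp [← hd7, runBlock, Instr.run, h64']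
  have h75 : s7.reg 5 = 2 ^ u := by simp [← hd7, runBlock, Instr.run, h65]
  have h76 : s7.reg 6 = k := by simp [← hd7, runBlock, Instr.run, h66]
  have h716 : s7.reg 16 = 1 := by simp [← hd7, runBlock, Instr.run]
  have h717 : s7.reg 17 = E := by
    simp [← hd7, runBlock, Instr.run, h66, ← hρ, ← hb, ← hEdef, -Nat.cast_mul]
  have hu7 : s7.used = s.used := by simp [← hd7, runBlock, Instr.run, hu6]
  clear hd7
  have ht1 : t + t + 1 < 2 ^ (t + 2) := by rw [pow_add]; omega
  have hthr : (t + t + 1) * 2 ^ u < 2 ^ (t + 2 + (u + 1)) :=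
    mul_lt_two_pow ht1 (Nat.pow_lt_pow_right (by norm_num) (by omega))
  have hwt : t + t + (t + t) < 2 ^ (t + 3) := by rw [pow_add]; omega
  have h8K : 8 * K < 2 ^ (4 + K) := mul_lt_two_pow (by norm_num) hK2
  refine (Runs.seq (T := 8) (T' := E * 6 + 18)
    (Runs.block hB1 he _ hs7 ?_ ?_)).mono (by omega) (fun _ _ h => h)
  · have q1 := lt_two_pow_mono hv2 (y := B) (by omega)
    have q2 := lt_two_pow_mono ht1 (y := B) (by omega)
    have q3 := lt_two_pow_mono hthr (y := B) (by omega)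
    have q4 := lt_two_pow_mono hwt (y := B) (by omega)
    have q5 := lt_two_pow_mono h8K (y := B) (by omega)
    simp [BlockSafe, Instr.Safe, Instr.run, h72, h73, h74, h75, h76, h716, hvdef, q1, q2, q3, q4,
      q5]
    omega
  intro hs8
  generalize hd8 : runBlock e _ s7 = s8 at hs8 ⊢
  have h87 : s8.reg 7 = 8 * K := by simp [← hd8, runBlock, Instr.run, h73]
  have h817 : s8.reg 17 = E := by simp [← hd8, runBlock, Instr.run, h717]
  have key : s8.reg 0 = n ∧ s8.reg 1 = s.reg 1 ∧ s8.reg 5 = 2 ^ u ∧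
        s8.reg 6 = k ∧ s8.reg 10 = (t + t + 1) * 2 ^ u ∧
        s8.reg 11 = t + t + (t + t) ∧ s8.reg 14 = v ∧ s8.used = s.used := by
    refine ⟨?_, ?_, ?_, ?_, ?_, ?_, ?_, ?_⟩ <;>
      simp [← hd8, runBlock, Instr.run, h70, h71, h72, h73, h74, h75, h76, h716, hu7, hvdef]
  clear hd8
  refine (Runs.forDown hB1 he (by decide) (T := 2) (fun i s' => i ≤ E ∧
    s'.reg 7 = 8 * K * 2 ^ (E - i) ∧
    (∀ r, r ≠ 7 → r ≠ 17 → r ≠ 16 → s'.reg r = s8.reg r) ∧ s'.used = s8.used) E ?_ hs8 h817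
    ⟨le_rfl, by simp [h87], fun _ _ _ _ => rfl, rfl⟩).mono (by omega) ?_
  · rintro i hi s' hs' hri - ⟨s₀, ⟨-, h7, hfr, hu0⟩, hm', hu', hx⟩
    rw [← hx 7 (by decide) (by decide)] at h7
    have hpow : 8 * K * 2 ^ (E - i) = 8 * K * 2 ^ (E - (i + 1)) * 2 := by
      rw [mul_assoc (8 * K), ← pow_succ]; congr 2; omega
    have hlt : 8 * K * 2 ^ (E - i) < 2 ^ (4 + K + (E + 1)) :=
      mul_lt_two_pow h8K (Nat.pow_lt_pow_right (by norm_num) (by omega))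
    have q := lt_two_pow_mono hlt (y := B) (by omega)
    refine Runs.block hB1 he _ hs' ?_ ?_
    · simp only [BlockSafe, Instr.Safe, h7, and_true]
      rwa [← mul_two, ← hpow]
    · simp only [runBlock, Instr.run, h7, hri, State.reg_setReg, State.used_setReg]
      refine ⟨⟨by omega, ?_, fun r h7' h17 h16 => ?_, by omega⟩, by simp [hri]⟩
      · rw [hpow, mul_two, if_pos trivial]
      rw [if_neg h7', hx r h17 h16, hfr r h7' h17 h16]
  · rintro s' - ⟨⟨-, h7, hfr, hu'⟩, -⟩
    obtain ⟨a0, a1, a5, a6, a10, a11, a14, au⟩ := key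
    refine ⟨?_, ?_, ?_, ?_, h7, ?_, ?_, ?_, hu'.trans au⟩ <;>
      rw [hfr _ (by decide) (by decide) (by decide)] <;> assumption

/-- The program for the Light Bulb Problem. -/
def lightBulbProg : Prog :=
  .seq setupProg <| .seq searchProg <| block [.const 18 0, .add 0 8 18, .add 1 9 18]

/-- A bound for the number of steps of the program. -/
noncomputable def stepBound (ρ : ℝ) (n : ℕ) : ℕ :=
  scale ρ * 12 + n.size * 5 + coordBits ρ n * 5 + repBits ρ n * 6 + 85 +
    reps ρ n * (seedLen ρ n * 8 + n * (hashLen ρ n * 45 + coords ρ n * 16 + 60) + 16)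

theorem runs_lightBulbProg {e : Env} {n : ℕ} (h0 : e.corr ≠ 0) (he : |e.corr| ≤ 1)
    (mem : ℕ → ℕ) :
    Runs e (wordLen e.corr n) lightBulbProg (start n e.corr mem) (stepBound e.corr n) (fun s' =>
      ∀ r < reps e.corr n, ∀ i j,
        Hit e (coords e.corr n) (hashLen e.corr n) (thresh e.corr n) (weight e.corr)
          (decide (e.corr < 0)) n (repSeed e.coins (seedLen e.corr n) r) i j →
        ∃ a b, a < b ∧ b < n ∧ Passes e (coords e.corr n) (thresh e.corr n) (weight e.corr)
          (decide (e.corr < 0)) a b ∧ s'.reg 0 = a ∧ s'.reg 1 = b) := by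
  set ρ := e.corr with hρ
  have hB1 : 1 ≤ wordLen ρ n := by unfold wordLen; omega
  have hs : Bounded (wordLen ρ n) (start n ρ mem) := by
    intro r
    have h1 : n < 2 ^ wordLen ρ n :=
      lt_two_pow_mono (Nat.size_le.1 le_rfl) (by unfold wordLen; omega)
    have h2 : 1 < 2 ^ wordLen ρ n := Nat.one_lt_two_pow (by omega)
    simp only [start]
    split_ifs <;> omega
  unfold stepBound
  refine (Runs.seq (T := scale ρ * 12 + n.size * 5 + coordBits ρ n * 5 + repBits ρ n * 6 + 80)
    (T' := reps ρ n * (seedLen ρ n * 8 + n * (hashLen ρ n * 45 + coords ρ n * 16 + 60) + 16) + 5)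
    ?_).mono (by omega) (fun _ _ h => h)
  refine (runs_setupProg h0 he (s := start n ρ mem) (by simp [start]) hs).mono le_rfl ?_
  rintro s1 hs1 ⟨g0, g1, g5, g6, g7, g10, g11, g14, gu⟩ -
  rw [← hρ] at hs1 g5 g6 g7 g10 g11 g14
  have hf : s1.reg 1 = (decide (ρ < 0)).toNat := by
    rw [g1]
    by_cases h : ρ < 0 <;> simp [start, h]
  refine (Runs.seq (T := reps ρ n *
    (seedLen ρ n * 8 + n * (hashLen ρ n * 45 + coords ρ n * 16 + 60) + 16) + 1)
    (T' := 4) ?_).mono (by omega) (fun _ _ h => h)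
  have hw : scale ρ < 2 ^ scale ρ := Nat.lt_two_pow_self
  refine (runs_searchProg hB1 he hs1 hf (by rw [g6]; unfold wordLen; omega) ?_
    (by rw [g14]; unfold wordLen; omega) (by rw [gu]; rfl)).mono
    (by rw [g0, g5, g6, g7, g14]) ?_
  · rw [g5, g11]
    refine lt_two_pow_mono (x := (coordBits ρ n + 1) + (scale ρ + 3)) (mul_lt_two_pow ?_ ?_)
      (by unfold wordLen; omega)
    · exact Nat.pow_lt_pow_right (by norm_num) (by omega)
    · rw [weight, pow_add]; omega
  rintro s2 hs2 hfound -
  rw [g0, g5, g6, g7, g10, g11, g14] at hfound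
  have k8 := hs2 8
  have k9 := hs2 9
  refine Runs.block hB1 he _ hs2 ?_ ?_
  · simp [BlockSafe, Instr.Safe, Instr.run, k8, k9]
  · intro r hr i j hh
    obtain ⟨a, b, c⟩ := hfound r hr i j hh
    exact ⟨_, _, a, b, c, by simp [runBlock, Instr.run], by simp [runBlock, Instr.run]⟩

/-! ### Counting seeds -/

/-- The last `k` digits of `x` in base `M` satisfy `S`. -/
def AllDigits (S : ℕ → Prop) (M : ℕ) : ℕ → ℕ → Prop
  | 0, _ => True
  | k + 1, x => S (x % M) ∧ AllDigits S M k (x / M)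

theorem hashAcc_congr {b b' : ℕ → Bool} {M : ℕ} (k : ℕ) : ∀ {h x : ℕ},
    AllDigits (fun c => b c = b' c) M k x → hashAcc b M k h x = hashAcc b' M k h x := by
  induction k with
  | zero => intro h x _; rfl
  | succ k ih =>
    intro h x hx
    rw [hashAcc, hashAcc, show b (x % M) = b' (x % M) from hx.1]
    exact ih hx.2

/-- Appending a bit to an accumulator is injective, so equality of the results propagates back to
every digit. With `hashAcc_congr`, two strings collide exactly when they agree at all sampled
positions. -/
theorem allDigits_of_hashAcc_eq {b b' : ℕ → Bool} {M : ℕ} (k : ℕ) : ∀ {h h' x : ℕ},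
    hashAcc b M k h x = hashAcc b' M k h' x →
    h = h' ∧ AllDigits (fun c => b c = b' c) M k x := by
  induction k with
  | zero => intro h h' x hx; exact ⟨hx, trivial⟩
  | succ k ih =>
    intro h h' x hx
    obtain ⟨h1, h2⟩ := ih hx
    have := Bool.toNat_le (b (x % M))
    have := Bool.toNat_le (b' (x % M))
    refine ⟨by omega, ?_, h2⟩
    have h3 : (b (x % M)).toNat = (b' (x % M)).toNat := by omega
    show b (x % M) = b' (x % M)
    revert h3
    cases b (x % M) <;> cases b' (x % M) <;> simp

open Classical in
-- Numbers below `M ^ k` are `k`-tuples of digits, so this is independence in counting form. It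
-- serves twice: for the sampled positions in base `coords`, and for the seeds of all repetitions in
-- base `2 ^ seedLen`.
theorem card_allDigits (S : ℕ → Prop) {M : ℕ} (hM : 0 < M) (k : ℕ) :
    ((Finset.range (M ^ k)).filter (AllDigits S M k)).card =
      ((Finset.range M).filter S).card ^ k := by
  induction k with
  | zero => simp [AllDigits]
  | succ k ih =>
    rw [pow_succ' (Finset.card _), ← ih, ← Finset.card_product]
    refine Finset.card_nbij' (fun x => (x % M, x / M)) (fun p => p.1 + M * p.2) ?_ ?_ ?_ ?_
    · intro x hx
      simp only [Finset.coe_filter, Finset.mem_range, Set.mem_ofPred_eq] at hx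
      simp only [Finset.coe_product, Finset.coe_filter, Finset.mem_range, Set.mem_prod,
        Set.mem_ofPred_eq]
      refine ⟨⟨Nat.mod_lt _ hM, hx.2.1⟩, ?_, hx.2.2⟩
      rw [Nat.div_lt_iff_lt_mul hM, ← pow_succ]
      exact hx.1
    · rintro ⟨c, x⟩ hx
      simp only [Finset.coe_product, Finset.coe_filter, Finset.mem_range, Set.mem_prod,
        Set.mem_ofPred_eq] at hx
      simp only [Finset.coe_filter, Finset.mem_range, Set.mem_ofPred_eq]
      obtain ⟨⟨h1, h2⟩, h3, h4⟩ := hx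
      refine ⟨?_, show S _ ∧ AllDigits S M k _ from ?_⟩
      swap
      · rw [Nat.add_mul_mod_self_left, Nat.mod_eq_of_lt h1, Nat.add_mul_div_left _ _ hM,
          Nat.div_eq_of_lt h1, zero_add]
        exact ⟨h2, h4⟩
      calc c + M * x < M * (x + 1) := by rw [mul_add, mul_one, add_comm]; omega
        _ ≤ M * M ^ k := Nat.mul_le_mul_left _ h3
        _ = M ^ (k + 1) := (pow_succ' _ _).symm
    · intro x _
      exact Nat.mod_add_div x M
    · rintro ⟨c, x⟩ hx
      simp only [Finset.coe_product, Finset.coe_filter, Finset.mem_range, Set.mem_prod,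
        Set.mem_ofPred_eq] at hx
      simp only [Nat.add_mul_mod_self_left, Nat.mod_eq_of_lt hx.1.1, Nat.add_mul_div_left _ _ hM,
        Nat.div_eq_of_lt hx.1.1, zero_add]

theorem agree_comm (x y : ℕ → Bool) (f : Bool) (M : ℕ) : agree x y f M = agree y x f M := by
  unfold agree
  congr 1
  ext k
  simp only [Finset.mem_filter, and_congr_right_iff]
  intro _
  cases x k <;> cases f <;> cases y k <;> simp

/-- The proportion of disagreements that a correlated pair may have. -/
noncomputable def errFrac (ρ : ℝ) : ℝ := if |ρ| = 1 then 0 else relDist ρ + 1 / (64 * scale ρ)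

/-- Up to small errors, the first `coords` positions show the expected correlations. -/
def Typical (e : Env) (n a b : ℕ) : Prop :=
  (1 - errFrac e.corr) * coords e.corr n ≤
      agree (e.bits a) (e.bits b) (decide (e.corr < 0)) (coords e.corr n) ∧
    ∀ c d f, c < n → d < n → c ≠ d → ¬ (c = a ∧ d = b) → ¬ (c = b ∧ d = a) →
      (agree (e.bits c) (e.bits d) f (coords e.corr n) : ℝ) ≤
        (1 / 2 + 1 / (64 * scale e.corr)) * coords e.corr n

section Parameters

variable {ρ : ℝ}

theorem one_le_scale_mul (h0 : ρ ≠ 0) (h1 : |ρ| ≤ 1) : 1 ≤ |ρ| * scale ρ :=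
  (Nat.one_le_floor_iff _).1 (scale_spec h0 h1).2.1

/-- As |ρ| < 1, the floor of |ρ|t is below t; it is not t - 1 by the choice of t. So it is at most t
- 2, and |ρ|t < t - 1. -/
theorem one_le_scale_mul' (h0 : ρ ≠ 0) (h1 : |ρ| ≤ 1) (h : |ρ| ≠ 1) :
    1 ≤ (1 - |ρ|) * scale ρ := by
  obtain ⟨h2, h3, h4⟩ := scale_spec h0 h1
  have hlt : |ρ| < 1 := lt_of_le_of_ne h1 h
  have hs : (0 : ℝ) < scale ρ := by positivity
  have h5 : ⌊|ρ| * scale ρ⌋₊ < scale ρ := by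
    rw [Nat.floor_lt (by positivity)]; nlinarith
  have h6 : ⌊|ρ| * scale ρ⌋₊ + 2 ≤ scale ρ := by omega
  have h7 : |ρ| * scale ρ < ⌊|ρ| * scale ρ⌋₊ + 1 := Nat.lt_floor_add_one _
  have h8 : ((⌊|ρ| * scale ρ⌋₊ + 2 : ℕ) : ℝ) ≤ scale ρ := by exact_mod_cast h6
  push_cast at h8
  linarith

theorem two_le_scale (h0 : ρ ≠ 0) (h1 : |ρ| ≤ 1) : (2 : ℝ) ≤ scale ρ := by
  exact_mod_cast (scale_spec h0 h1).1

theorem inv_scale_le (h0 : ρ ≠ 0) (h1 : |ρ| ≤ 1) : 1 / (64 * scale ρ : ℝ) ≤ |ρ| / 64 := by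
  have := two_le_scale h0 h1
  have := one_le_scale_mul h0 h1
  rw [div_le_div_iff₀ (by positivity) (by norm_num)]
  linarith

theorem errFrac_nonneg (h1 : |ρ| ≤ 1) : 0 ≤ errFrac ρ := by
  unfold errFrac relDist
  split_ifs
  · exact le_rfl
  · have : 0 ≤ 1 - |ρ| := by linarith
    positivity

/-- The tolerance 1/(64t) is at most (1 - |ρ|)/64 and thus costs a factor only. If |ρ| = 1, the
right side is zero; this forces the definition of `errFrac` by cases. -/
theorem errFrac_le (h0 : ρ ≠ 0) (h1 : |ρ| ≤ 1) : 2 * errFrac ρ ≤ 9 / 8 * (1 - |ρ|) := by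
  unfold errFrac relDist
  split_ifs with h
  · linarith
  · have h2 := one_le_scale_mul' h0 h1 h
    have h3 := two_le_scale h0 h1
    have : 1 / (64 * scale ρ : ℝ) ≤ (1 - |ρ|) / 64 := by
      rw [div_le_div_iff₀ (by positivity) (by norm_num)]
      linarith
    linarith

/-- Apart from five copies of 1/(64t) ≤ |ρ|/64, the left side is 2δ = 1 - |ρ|. -/
theorem errFrac_add_le (h0 : ρ ≠ 0) (h1 : |ρ| ≤ 1) :
    2 * errFrac ρ + 3 * (1 / (64 * scale ρ)) ≤ 1 - 59 / 64 * |ρ| := by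
  have h2 := inv_scale_le h0 h1
  unfold errFrac relDist
  split_ifs with h
  · linarith
  · linarith

/-- The factor 8/7 compensates for the loss of 59/64 in `errFrac_add_le`. -/
theorem hashLen_ge (h0 : ρ ≠ 0) (h1 : |ρ| ≤ 1) (n : ℕ) :
    8 / 7 * (n.size + 1) ≤ hashLen ρ n * |ρ| := by
  have h2 := one_le_scale_mul h0 h1
  have h3 := two_le_scale h0 h1
  set a := ⌊|ρ| * ((64 * scale ρ : ℕ) : ℝ)⌋₊ with ha
  have hle : (a : ℝ) ≤ |ρ| * ((64 * scale ρ : ℕ) : ℝ) := Nat.floor_le (by positivity)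
  have hpos : 0 < a := by
    rw [ha, Nat.floor_pos]; push_cast; linarith
  have hlt : (1 + n.size) * (64 * scale ρ) * 8 < hashLen ρ n * (a * 7) := by
    rw [hashLen, ← ha]
    exact Nat.lt_mul_of_div_lt (Nat.lt_succ_self _) (by positivity)
  have hlt' : ((1 + n.size : ℝ)) * (64 * scale ρ) * 8 < hashLen ρ n * (a * 7) := by
    exact_mod_cast hlt
  push_cast at hle
  have hk : (0 : ℝ) ≤ hashLen ρ n := Nat.cast_nonneg _
  have h5 : ((1 + n.size : ℝ)) * (64 * scale ρ) * 8 < hashLen ρ n * (|ρ| * (64 * scale ρ) * 7) :=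
    hlt'.trans_le (by gcongr)
  have h6 : (0 : ℝ) < 64 * scale ρ := by linarith
  have h7 : (1 + n.size : ℝ) * 8 < hashLen ρ n * |ρ| * 7 := by
    refine lt_of_mul_lt_mul_right ?_ h6.le
    nlinarith
  linarith

theorem repBits_ge (h1 : |ρ| ≤ 1) (n : ℕ) : 9 / 8 * (1 - |ρ|) * hashLen ρ n ≤ repBits ρ n := by
  set k := hashLen ρ n with hk
  set b := ⌊|ρ| * ((k * 8 : ℕ) : ℝ)⌋₊ with hb
  have hle : (b : ℝ) ≤ |ρ| * ((k * 8 : ℕ) : ℝ) := Nat.floor_le (by positivity)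
  have hbk : b ≤ k * 8 := Nat.floor_le_of_le (mul_le_of_le_one_left (Nat.cast_nonneg _) h1)
  have hE : repBits ρ n = (k * 8 - b) * 9 / 64 + 1 := rfl
  have h2 : (k * 8 - b) * 9 ≤ 64 * repBits ρ n := by rw [hE]; omega
  have h3 : (k * 8) * 9 ≤ 64 * repBits ρ n + b * 9 := by omega
  have h4 : ((k : ℝ) * 8) * 9 ≤ 64 * repBits ρ n + b * 9 := by exact_mod_cast h3
  push_cast at hle
  linarith

end Parameters

/-- The weighted inequality of arithmetic and geometric means for the points 1 and 1/2 with weights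
1 - 2x and 2x. It bounds the collision probability of the planted pair from below. -/
theorem two_rpow_neg_le {x : ℝ} (h0 : 0 ≤ x) (h1 : x ≤ 1 / 2) : (2 : ℝ) ^ (-(2 * x)) ≤ 1 - x := by
  have h := Real.geom_mean_le_arith_mean2_weighted (w₁ := 1 - 2 * x) (w₂ := 2 * x) (p₁ := 1)
    (p₂ := 1 / 2) (by linarith) (by linarith) (by norm_num) (by norm_num) (by ring)
  rw [Real.one_rpow, one_mul, one_div, Real.inv_rpow (by norm_num), ← Real.rpow_neg (by norm_num)]
    at h
  linarith

/-- After doubling, this is 1 + 2x ≤ 1 + 3x ln 2 ≤ 2^(3x). -/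
theorem half_add_le {x : ℝ} (h0 : 0 ≤ x) : 1 / 2 + x ≤ (2 : ℝ) ^ (-1 + 3 * x) := by
  rw [Real.rpow_add (by norm_num), Real.rpow_neg_one, Real.rpow_def_of_pos (by norm_num)]
  have h1 := Real.add_one_le_exp (Real.log 2 * (3 * x))
  have h2 := Real.log_two_gt_d9
  nlinarith

open Classical in
-- A seed is a tuple of k positions. On a typical instance a proportion of at least 2^(-2xk) of the
-- seeds lets the pair collide, where x is `errFrac`, and at most 2^((-1+3η)k) of them let a given
-- other string collide with `b`, where η = 1/(64t). The hash length is such that all other strings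
-- together spoil at most half of the good seeds.
theorem card_hit_ge {e : Env} {n a b : ℕ} (h0 : e.corr ≠ 0) (h1 : |e.corr| ≤ 1)
    (hb : b < n) (ht : Typical e n a b) :
    (2 : ℝ) ^ seedLen e.corr n * (1 / 2 * (2 : ℝ) ^ (-(repBits e.corr n : ℝ))) ≤
      ((Finset.range (2 ^ seedLen e.corr n)).filter fun R =>
        key e (coords e.corr n) (hashLen e.corr n) R (decide (e.corr < 0)) a =
          key e (coords e.corr n) (hashLen e.corr n) R false b ∧
        ∀ l < n, l ≠ a → l ≠ b → key e (coords e.corr n) (hashLen e.corr n) R false l ≠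
          key e (coords e.corr n) (hashLen e.corr n) R false b).card := by
  set ρ := e.corr with hρ
  set M := coords ρ n with hM
  set k := hashLen ρ n with hk
  set f := decide (ρ < 0) with hf
  set x := errFrac ρ with hx
  set η : ℝ := 1 / (64 * scale ρ) with hη
  have hMpos : 0 < M := by rw [hM, coords]; positivity
  have hMR : (0 : ℝ) < M := by exact_mod_cast hMpos
  have hpow : 2 ^ seedLen ρ n = M ^ k := by
    rw [hM, coords, ← pow_mul, seedLen, mul_comm]
  have hpowR : (2 : ℝ) ^ seedLen ρ n = (M : ℝ) ^ k := by exact_mod_cast hpow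
  have hη0 : 0 ≤ η := by positivity
  have hx0 : 0 ≤ x := errFrac_nonneg h1
  have hadd := errFrac_add_le h0 h1
  rw [← hx, ← hη] at hadd
  have hx1 : x ≤ 1 / 2 := by have := abs_nonneg ρ; linarith
  have hkge := hashLen_ge h0 h1 n
  have hE := repBits_ge h1 n
  rw [← hk] at hkge hE
  have hxE : 2 * x * k ≤ repBits ρ n := by
    refine le_trans ?_ hE
    exact mul_le_mul_of_nonneg_right (errFrac_le h0 h1) (Nat.cast_nonneg _)
  -- the seeds with a collision of the pair, and those with another collision
  set G := (Finset.range (M ^ k)).filter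
    (AllDigits (fun c => xor (e.bits a c) f = e.bits b c) M k) with hG
  set H : ℕ → Finset ℕ := fun l => (Finset.range (M ^ k)).filter
    (AllDigits (fun c => xor (e.bits l c) false = e.bits b c) M k) with hH
  have hGcard : (G.card : ℝ) = (agree (e.bits a) (e.bits b) f M : ℝ) ^ k := by
    rw [hG, card_allDigits _ hMpos]; push_cast; unfold agree; congr!
  have hHcard : ∀ l, ((H l).card : ℝ) = (agree (e.bits l) (e.bits b) false M : ℝ) ^ k := by
    intro l
    simp only [hH]
    rw [card_allDigits _ hMpos]; push_cast; unfold agree; congr!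
  have hsub : G \ ((Finset.range n).filter (fun l => l ≠ a ∧ l ≠ b)).biUnion H ⊆
      (Finset.range (2 ^ seedLen ρ n)).filter fun R =>
        key e M k R f a = key e M k R false b ∧
        ∀ l < n, l ≠ a → l ≠ b → key e M k R false l ≠ key e M k R false b := by
    intro R hR
    simp only [Finset.mem_sdiff, Finset.mem_biUnion, Finset.mem_filter, Finset.mem_range, hG, hH,
      not_exists, not_and] at hR
    simp only [Finset.mem_filter, Finset.mem_range]
    obtain ⟨⟨hR1, hR2⟩, hR3⟩ := hR
    refine ⟨hpow ▸ hR1, ?_, fun l hl hla hlb heq => ?_⟩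
    · refine hashAcc_congr k ?_
      simpa using hR2
    · refine hR3 l ⟨hl, hla, hlb⟩ hR1 ?_
      have := (allDigits_of_hashAcc_eq k heq).2
      simpa using this
  have hHle : ∀ l ∈ (Finset.range n).filter (fun l => l ≠ a ∧ l ≠ b),
      ((H l).card : ℝ) ≤ ((2 : ℝ) ^ (-1 + 3 * η) * M) ^ k := by
    intro l hl
    simp only [Finset.mem_filter, Finset.mem_range] at hl
    rw [hHcard]
    refine pow_le_pow_left₀ (Nat.cast_nonneg _) ?_ k
    refine (ht.2 l b false hl.1 hb hl.2.2 (fun h => hl.2.1 h.1) (fun h => hl.2.2 h.1)).trans ?_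
    exact mul_le_mul_of_nonneg_right (half_add_le hη0) hMR.le
  have hcardn : ((((Finset.range n).filter (fun l => l ≠ a ∧ l ≠ b)).card : ℕ) : ℝ) ≤
      (2 : ℝ) ^ (n.size : ℝ) := by
    rw [Real.rpow_natCast]
    have h2 : n < 2 ^ n.size := Nat.size_le.1 le_rfl
    have h3 := Finset.card_filter_le (Finset.range n) (fun l => l ≠ a ∧ l ≠ b)
    rw [Finset.card_range] at h3
    exact_mod_cast h3.trans h2.le
  have hU : ((((Finset.range n).filter (fun l => l ≠ a ∧ l ≠ b)).biUnion H).card : ℝ) ≤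
      (2 : ℝ) ^ (n.size : ℝ) * ((2 : ℝ) ^ (-1 + 3 * η) * M) ^ k := by
    calc ((((Finset.range n).filter (fun l => l ≠ a ∧ l ≠ b)).biUnion H).card : ℝ)
        ≤ ((∑ l ∈ (Finset.range n).filter (fun l => l ≠ a ∧ l ≠ b), (H l).card : ℕ) : ℝ) := by
          exact_mod_cast Finset.card_biUnion_le
      _ = ∑ l ∈ (Finset.range n).filter (fun l => l ≠ a ∧ l ≠ b), ((H l).card : ℝ) := by
          push_cast; rfl
      _ ≤ _ := (Finset.sum_le_card_nsmul _ _ _ hHle)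
      _ ≤ _ := by
          rw [nsmul_eq_mul]
          exact mul_le_mul_of_nonneg_right hcardn (by positivity)
  have hGge : (M : ℝ) ^ k * (2 : ℝ) ^ (-(2 * x * k)) ≤ G.card := by
    rw [hGcard]
    have : (2 : ℝ) ^ (-(2 * x * k)) = ((2 : ℝ) ^ (-(2 * x))) ^ k := by
      rw [← Real.rpow_natCast, ← Real.rpow_mul (by norm_num)]; congr 1; ring
    rw [this, ← mul_pow]
    refine pow_le_pow_left₀ (by positivity) ?_ k
    refine le_trans ?_ ht.1
    rw [mul_comm]
    exact mul_le_mul_of_nonneg_right (two_rpow_neg_le hx0 hx1) hMR.le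
  have hUle : (2 : ℝ) ^ (n.size : ℝ) * ((2 : ℝ) ^ (-1 + 3 * η) * M) ^ k ≤
      1 / 2 * ((M : ℝ) ^ k * (2 : ℝ) ^ (-(2 * x * k))) := by
    rw [mul_pow, ← Real.rpow_natCast ((2 : ℝ) ^ (-1 + 3 * η)) k, ← Real.rpow_mul (by norm_num)]
    have h3 : (2 : ℝ) ^ (n.size : ℝ) * (2 : ℝ) ^ ((-1 + 3 * η) * k) ≤
        1 / 2 * (2 : ℝ) ^ (-(2 * x * k)) := by
      rw [one_div, ← Real.rpow_neg_one, ← Real.rpow_add (by norm_num),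
        ← Real.rpow_add (by norm_num)]
      refine Real.rpow_le_rpow_of_exponent_le (by norm_num) ?_
      -- By `hashLen_ge` and 59/64 · 8/7 > 1, the exponents differ by at least `n.size + 1`. The
      -- last 1 pays for the factor 1/2.
      have h4 : 59 / 64 * |ρ| * k ≤ (1 - 2 * x - 3 * η) * k :=
        mul_le_mul_of_nonneg_right (by linarith) (Nat.cast_nonneg _)
      have h5 : (0 : ℝ) ≤ n.size := Nat.cast_nonneg _
      linarith
    have hMk : (0 : ℝ) ≤ (M : ℝ) ^ k := by positivity
    calc (2 : ℝ) ^ (n.size : ℝ) * ((2 : ℝ) ^ ((-1 + 3 * η) * k) * (M : ℝ) ^ k)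
        = (2 : ℝ) ^ (n.size : ℝ) * (2 : ℝ) ^ ((-1 + 3 * η) * k) * (M : ℝ) ^ k := by ring
      _ ≤ 1 / 2 * (2 : ℝ) ^ (-(2 * x * k)) * (M : ℝ) ^ k := mul_le_mul_of_nonneg_right h3 hMk
      _ = _ := by ring
  have hdiff : (G.card : ℝ) - ((((Finset.range n).filter (fun l => l ≠ a ∧ l ≠ b)).biUnion H).card
      : ℝ) ≤ ((G \ ((Finset.range n).filter (fun l => l ≠ a ∧ l ≠ b)).biUnion H).card : ℝ) := by
    have := Finset.le_card_sdiff (((Finset.range n).filter (fun l => l ≠ a ∧ l ≠ b)).biUnion H) G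
    rw [sub_le_iff_le_add]
    exact_mod_cast Nat.sub_le_iff_le_add.1 this
  have hfin : (2 : ℝ) ^ (-(repBits ρ n : ℝ)) ≤ (2 : ℝ) ^ (-(2 * x * k)) :=
    Real.rpow_le_rpow_of_exponent_le (by norm_num) (by linarith)
  have hMk : (0 : ℝ) ≤ (M : ℝ) ^ k := by positivity
  calc (2 : ℝ) ^ seedLen ρ n * (1 / 2 * (2 : ℝ) ^ (-(repBits ρ n : ℝ)))
      ≤ 1 / 2 * ((M : ℝ) ^ k * (2 : ℝ) ^ (-(2 * x * k))) := by
        rw [hpowR]; nlinarith [mul_le_mul_of_nonneg_left hfin hMk]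
    _ ≤ (G.card : ℝ) - ((((Finset.range n).filter (fun l => l ≠ a ∧ l ≠ b)).biUnion H).card : ℝ) := by
        linarith
    _ ≤ _ := hdiff
    _ ≤ _ := by exact_mod_cast Finset.card_le_card hsub

/-- The threshold is the proportion 1/2 + 1/(4t). The planted pair is expected to reach 1/2 + |ρ|/2
≥ 1/2 + 1/(2t), and other pairs stay below 1/2 + 1/(64t) up to equality, so both deviations leave
room. -/
theorem Typical.passes {e : Env} {n a b : ℕ} (h0 : e.corr ≠ 0) (h1 : |e.corr| ≤ 1)
    (ht : Typical e n a b) : Passes e (coords e.corr n) (thresh e.corr n) (weight e.corr)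
      (decide (e.corr < 0)) a b := by
  have h2 := two_le_scale h0 h1
  have h3 := one_le_scale_mul h0 h1
  have h4 := ht.1
  have h5 : 1 / 2 + 1 / (4 * scale e.corr : ℝ) ≤ 1 - errFrac e.corr := by
    have e1 : 1 / (4 * scale e.corr : ℝ) = 16 * (1 / (64 * scale e.corr)) := by
      field_simp; norm_num
    have := inv_scale_le h0 h1
    have := abs_nonneg e.corr
    have h6 := errFrac_add_le h0 h1
    rw [e1]
    unfold errFrac relDist at h6 ⊢
    split_ifs at h6 ⊢ with h
    · linarith
    · linarith
  unfold Passes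
  set A := agree (e.bits a) (e.bits b) (decide (e.corr < 0)) (coords e.corr n)
  have h6 : (1 / 2 + 1 / (4 * scale e.corr : ℝ)) * coords e.corr n ≤ A :=
    (mul_le_mul_of_nonneg_right h5 (Nat.cast_nonneg _)).trans h4
  have h7 : ((thresh e.corr n : ℕ) : ℝ) ≤ ((A * weight e.corr : ℕ) : ℝ) := by
    unfold thresh weight
    push_cast
    have h8 : (0 : ℝ) ≤ 4 * scale e.corr := by linarith
    have h9 := mul_le_mul_of_nonneg_right h6 h8
    have h10 : (1 / 2 + 1 / (4 * scale e.corr : ℝ)) * coords e.corr n * (4 * scale e.corr) =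
        (scale e.corr + scale e.corr + 1) * coords e.corr n := by
      field_simp; ring
    linarith
  exact_mod_cast h7

theorem Typical.eq_of_passes {e : Env} {n a b c d : ℕ} (h0 : e.corr ≠ 0) (h1 : |e.corr| ≤ 1)
    (ht : Typical e n a b) (hab : a < b) (hcd : c < d) (hd : d < n)
    (hp : Passes e (coords e.corr n) (thresh e.corr n) (weight e.corr)
      (decide (e.corr < 0)) c d) : c = a ∧ d = b := by
  by_contra hne
  have h2 := two_le_scale h0 h1
  have h3 := ht.2 c d (decide (e.corr < 0)) (hcd.trans hd) hd hcd.ne hne (by omega)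
  have h4 : ((thresh e.corr n : ℕ) : ℝ) ≤
    ((agree (e.bits c) (e.bits d) (decide (e.corr < 0)) (coords e.corr n) * weight e.corr : ℕ) : ℝ)
    := by exact_mod_cast hp
  unfold thresh weight at h4
  push_cast at h4
  have hM : (0 : ℝ) < coords e.corr n := by unfold coords; positivity
  have h5 := mul_le_mul_of_nonneg_right h3 (show (0 : ℝ) ≤ 4 * scale e.corr by linarith)
  have h6 : (1 / 2 + 1 / (64 * scale e.corr : ℝ)) * coords e.corr n * (4 * scale e.corr) =
        (scale e.corr + scale e.corr + 1 / 16) * coords e.corr n := by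
      field_simp; ring
  nlinarith

/-! ### Coin flips -/

theorem bitLaw_true {p : ℝ} (h0 : 0 ≤ p) (h1 : p ≤ 1) : bitLaw p {true} = ENNReal.ofReal p := by
  unfold bitLaw
  rw [bernoulliMeasure_apply _ (measurableSet_singleton _)]
  simp [Set.projIcc_of_mem zero_le_one (show p ∈ Set.Icc (0 : ℝ) 1 from ⟨h0, h1⟩),
    unitInterval.toNNReal, ENNReal.ofReal, Real.toNNReal_of_nonneg h0]
  rfl

theorem bitLaw_false {p : ℝ} (h0 : 0 ≤ p) (h1 : p ≤ 1) :
    bitLaw p {false} = ENNReal.ofReal (1 - p) := by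
  unfold bitLaw
  rw [bernoulliMeasure_apply _ (measurableSet_singleton _)]
  simp [Set.projIcc_of_mem zero_le_one (show p ∈ Set.Icc (0 : ℝ) 1 from ⟨h0, h1⟩),
    unitInterval.toNNReal, ENNReal.ofReal, Real.toNNReal_of_nonneg (sub_nonneg.2 h1)]
  rfl

theorem bitLaw_half (b : Bool) : bitLaw (1 / 2) {b} = 2⁻¹ := by
  have h : ENNReal.ofReal (1 / 2) = 2⁻¹ := by
    rw [one_div, ENNReal.ofReal_inv_of_pos (by norm_num)]; simp
  cases b
  · rw [bitLaw_false (by norm_num) (by norm_num)]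
    norm_num at h ⊢; exact h
  · rw [bitLaw_true (by norm_num) (by norm_num), h]

theorem coinNum_inj {ω ω' : ℕ → Bool} (V : ℕ) : coinNum ω V = coinNum ω' V →
    ∀ q < V, ω q = ω' q := by
  induction V with
  | zero => intro _ q hq; omega
  | succ V ih =>
    intro h q hq
    rw [coinNum, coinNum] at h
    have h1 := Bool.toNat_le (ω V)
    have h2 := Bool.toNat_le (ω' V)
    rcases Nat.lt_succ_iff_lt_or_eq.1 hq with hq | rfl
    · exact ih (by omega) q hq
    · have h3 : (ω q).toNat = (ω' q).toNat := by omega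
      revert h3
      cases ω q <;> cases ω' q <;> simp

theorem coinLaw_coinNum_le (V x : ℕ) : coinLaw {ω | coinNum ω V = x} ≤ 2⁻¹ ^ V := by
  by_cases h : ∃ ω', coinNum ω' V = x
  · obtain ⟨ω', rfl⟩ := h
    calc coinLaw {ω | coinNum ω V = coinNum ω' V}
        ≤ coinLaw ((↑(Finset.range V) : Set ℕ).pi fun q => {ω' q}) := by
          refine measure_mono fun ω hω q hq => ?_
          exact coinNum_inj V hω q (Finset.mem_range.1 hq)
      _ = 2⁻¹ ^ V := by
          rw [coinLaw, Measure.infinitePi_pi _ (fun _ _ => measurableSet_singleton _)]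
          simp only [bitLaw_half, Finset.prod_const, Finset.card_range]
  · have : {ω | coinNum ω V = x} = ∅ := by
      ext ω
      simp only [Set.mem_ofPred_eq, Set.mem_empty_iff_false, iff_false]
      exact fun hω => h ⟨ω, hω⟩
    rw [this]; simp

theorem coinNum_add (ω : ℕ → Bool) (a b : ℕ) :
    coinNum ω (a + b) = coinNum (fun q => ω (a + q)) b + 2 ^ b * coinNum ω a := by
  induction b with
  | zero => simp [coinNum]
  | succ b ih =>
    rw [← add_assoc, coinNum, ih, coinNum, pow_succ]; ring

theorem allDigits_coinNum (S : ℕ → Prop) (ω : ℕ → Bool) (v L : ℕ) :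
    (∀ r < L, S (repSeed ω v r)) → AllDigits S (2 ^ v) L (coinNum ω (L * v)) := by
  induction L with
  | zero => intro _; trivial
  | succ L ih =>
    intro h
    have h2 : 0 < 2 ^ v := by positivity
    have h3 := coinNum_lt (fun q => ω (L * v + q)) v
    have h4 : coinNum ω ((L + 1) * v) = repSeed ω v L + 2 ^ v * coinNum ω (L * v) := by
      rw [Nat.succ_mul, coinNum_add]; rfl
    have h5 : repSeed ω v L < 2 ^ v := h3
    show S _ ∧ AllDigits S (2 ^ v) L _
    rw [h4, Nat.add_mul_mod_self_left, Nat.mod_eq_of_lt h5, Nat.add_mul_div_left _ _ h2,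
      Nat.div_eq_of_lt h5, zero_add]
    exact ⟨h L (Nat.lt_succ_self L), ih fun r hr => h r (by omega)⟩

open Classical in
-- The seeds of the `L` repetitions are the digits in base `2 ^ v` of the number formed by the first
-- `L * v` coins. Counting these numbers replaces an argument with independent random variables.
theorem coinLaw_forall_repSeed_le (S : ℕ → Prop) (v L : ℕ) :
    coinLaw {ω | ∀ r < L, S (repSeed ω v r)} ≤
      ((((Finset.range (2 ^ v)).filter S).card : ENNReal) * 2⁻¹ ^ v) ^ L := by
  have hsub : {ω | ∀ r < L, S (repSeed ω v r)} ⊆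
      ⋃ x ∈ (Finset.range ((2 ^ v) ^ L)).filter (AllDigits S (2 ^ v) L),
        {ω | coinNum ω (L * v) = x} := by
    intro ω hω
    simp only [Set.mem_iUnion, Finset.mem_filter, Finset.mem_range, Set.mem_ofPred_eq, exists_prop]
    refine ⟨_, ⟨?_, allDigits_coinNum S ω v L hω⟩, rfl⟩
    rw [← pow_mul, mul_comm v]
    exact coinNum_lt _ _
  calc coinLaw {ω | ∀ r < L, S (repSeed ω v r)}
      ≤ ∑ x ∈ (Finset.range ((2 ^ v) ^ L)).filter (AllDigits S (2 ^ v) L),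
          coinLaw {ω | coinNum ω (L * v) = x} :=
        (measure_mono hsub).trans (measure_biUnion_finset_le _ _)
    _ ≤ ∑ x ∈ (Finset.range ((2 ^ v) ^ L)).filter (AllDigits S (2 ^ v) L), 2⁻¹ ^ (L * v) :=
        Finset.sum_le_sum fun x _ => coinLaw_coinNum_le _ _
    _ = _ := by
        rw [Finset.sum_const, nsmul_eq_mul, card_allDigits S (by positivity), mul_pow, mul_comm L,
          pow_mul]
        push_cast
        rfl

/-! ### Tail bounds -/

theorem integral_bitLaw {p : ℝ} (h0 : 0 ≤ p) (h1 : p ≤ 1) :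
    ∫ b, (b.toNat : ℝ) ∂bitLaw p = p := by
  rw [integral_fintype (by simp)]
  simp [measureReal_def, bitLaw_true h0 h1, ENNReal.toReal_ofReal h0]

theorem card_fin_filter_lt {N M : ℕ} (hM : M ≤ N) :
    ((Finset.univ : Finset (Fin N)).filter fun k : Fin N => (k : ℕ) < M).card = M := by
  have := Fin.card_filter_val_lt (n := N) (m := M)
  rw [this, min_eq_right hM]

/-- Hoeffding's inequality for the first `M` bits: a centred bit is sub-Gaussian with variance proxy
1/4. -/
theorem bits_tail_le {N M : ℕ} (hM : M ≤ N) (hM0 : 0 < M) {p η : ℝ} (h0 : 0 ≤ p) (h1 : p ≤ 1)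
    (hη : 0 ≤ η) :
    (Measure.pi fun _ : Fin N => bitLaw p) {w | (p + η) * M ≤
      ((Finset.univ.filter fun k : Fin N => (k : ℕ) < M ∧ w k = true).card : ℝ)} ≤
      ENNReal.ofReal (Real.exp (-2 * η ^ 2 * M)) := by
  set μ := Measure.pi fun _ : Fin N => bitLaw p with hμ
  set S := (Finset.univ : Finset (Fin N)).filter fun k : Fin N => (k : ℕ) < M with hS
  have hScard : S.card = M := card_fin_filter_lt hM
  have hind : iIndepFun (fun (k : Fin N) (w : Fin N → Bool) => ((w k).toNat : ℝ) - p) μ :=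
    iIndepFun_pi (X := fun _ (b : Bool) => ((b.toNat : ℝ) - p)) (fun _ => by fun_prop)
  have hint : ∀ k : Fin N, ∫ w, (((w k).toNat : ℕ) : ℝ) ∂μ = p := by
    intro k
    have h2 := (measurePreserving_eval (fun _ : Fin N => bitLaw p) k).map_eq
    have h3 := integral_bitLaw h0 h1
    rw [← h2, integral_map (measurable_pi_apply k).aemeasurable (by fun_prop)] at h3
    exact h3
  have hsub : ∀ k ∈ S, HasSubgaussianMGF (fun w : Fin N → Bool => ((w k).toNat : ℝ) - p)
      ((‖(1 : ℝ) - 0‖₊ / 2) ^ 2) μ := by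
    intro k _
    have := hasSubgaussianMGF_of_mem_Icc (μ := μ) (X := fun w : Fin N → Bool => ((w k).toNat : ℝ))
      (a := 0) (b := 1) Measurable.of_discrete.aemeasurable (ae_of_all _ fun w => by
        cases w k <;> simp)
    rwa [hint k] at this
  have h := HasSubgaussianMGF.measure_sum_ge_le_of_iIndepFun hind hsub (ε := η * M) (by positivity)
  rw [← ENNReal.ofReal_toReal (measure_ne_top μ _)]
  refine ENNReal.ofReal_le_ofReal ?_
  refine le_trans (le_of_eq ?_) (h.trans (le_of_eq ?_))
  · rw [measureReal_def]
    congr 2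
    ext w
    simp only [Set.mem_ofPred_eq]
    rw [Finset.sum_sub_distrib, Finset.sum_const, hScard, nsmul_eq_mul]
    have : ∑ k ∈ S, ((w k).toNat : ℝ) =
        ((Finset.univ.filter fun k : Fin N => (k : ℕ) < M ∧ w k = true).card : ℝ) := by
      rw [← Finset.filter_filter, ← hS, Finset.card_filter]
      push_cast
      refine Finset.sum_congr rfl fun k _ => ?_
      cases w k <;> simp
    rw [this]
    constructor <;> intro h <;> linarith
  · congr 1
    rw [Finset.sum_const, hScard]
    have : (M : ℝ) ≠ 0 := by positivity
    simp
    field_simp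

/-- Every translation of the cube lifts to a measure preserving map, so the image law is translation
invariant, and therefore uniform. -/
theorem map_eq_pi_half {Ω : Type*} [MeasurableSpace Ω] {N : ℕ} (μ : Measure Ω)
    [IsProbabilityMeasure μ] {W : Ω → Fin N → Bool} (hW : Measurable W)
    (T : (Fin N → Bool) → Ω → Ω) (hT : ∀ c, MeasurePreserving (T c) μ μ)
    (hWT : ∀ c z, W (T c z) = fun k => xor (c k) (W z k)) :
    μ.map W = Measure.pi fun _ => bitLaw (1 / 2) := by
  have hprob : IsProbabilityMeasure (μ.map W) := Measure.isProbabilityMeasure_map hW.aemeasurable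
  have hinv : ∀ w, μ.map W {w} = μ.map W {fun _ => false} := by
    intro w
    rw [Measure.map_apply hW (measurableSet_singleton _),
      Measure.map_apply hW (measurableSet_singleton _),
      ← (hT w).measure_preimage (hW (measurableSet_singleton w)).nullMeasurableSet]
    congr 1
    ext z
    simp only [Set.mem_preimage, Set.mem_singleton_iff, hWT]
    constructor
    · intro h; funext k
      have := congrFun h k
      revert this
      cases w k <;> cases W z k <;> simp
    · intro h; funext k
      rw [h]; simp
  have hsum : ∑ w : Fin N → Bool, μ.map W {w} = 1 := by
    rw [sum_measure_singleton]; simp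
  simp only [hinv] at hsum
  rw [Finset.sum_const, Finset.card_univ, Fintype.card_fun, Fintype.card_bool, Fintype.card_fin,
    nsmul_eq_mul] at hsum
  have h0 : μ.map W {fun _ => false} = 2⁻¹ ^ N := by
    rw [← ENNReal.inv_pow]
    push_cast at hsum
    exact ENNReal.eq_inv_of_mul_eq_one_left (by rwa [mul_comm])
  refine Measure.ext_of_singleton fun w => ?_
  rw [hinv, h0, Measure.pi_singleton]
  simp only [bitLaw_half, Finset.prod_const, Finset.card_univ, Fintype.card_fin]

/-! ### Typical instances -/

theorem agree_inputEnv {n N M : ℕ} (hM : M ≤ N) (ρ : ℝ) (X : Fin n → Fin N → Bool) (ω : ℕ → Bool)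
    (c d : Fin n) (f : Bool) :
    agree ((inputEnv ρ X ω).bits c) ((inputEnv ρ X ω).bits d) f M =
      (Finset.univ.filter fun k : Fin N =>
        (k : ℕ) < M ∧ decide (xor (X c k) f = X d k) = true).card := by
  unfold agree
  symm
  refine Finset.card_bij (fun k _ => (k : ℕ)) ?_ ?_ ?_
  · intro k hk
    simp only [Finset.mem_filter, Finset.mem_univ, true_and, decide_eq_true_eq] at hk
    simp [inputEnv, hk.1, ← hk.2]
  · intro k _ k' _ h
    exact Fin.ext h
  · intro k hk
    simp only [Finset.mem_filter, Finset.mem_range] at hk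
    have hkN : k < N := hk.1.trans_le hM
    refine ⟨⟨k, hkN⟩, ?_, rfl⟩
    have h2 := hk.2
    simp only [inputEnv, Fin.is_lt, hkN, and_self, dite_true, Fin.eta] at h2
    simp [hk.1, h2]

theorem measurePreserving_xor {p : ℝ} (d : Bool) (h : d = true → p = 1 / 2) :
    MeasurePreserving (xor d) (bitLaw p) (bitLaw p) := by
  refine ⟨Measurable.of_discrete, Measure.ext_of_singleton fun b => ?_⟩
  rw [Measure.map_apply Measurable.of_discrete (measurableSet_singleton _)]
  cases d
  · congr 1; ext x; simp
  · rw [h rfl]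
    have : xor true ⁻¹' {b} = {!b} := by ext x; cases x <;> cases b <;> simp
    rw [this, bitLaw_half, bitLaw_half]

/-- Adding a vector to row `c` of the underlying independent bits translates the vector of
agreements. This preserves the law because row `c ≠ j` is uniform. String `d` must not change as
well, and string `j` depends on row `i`; hence the last hypothesis. -/
theorem map_agree_eq_pi_half {n N : ℕ} (ρ : ℝ) (i j : Fin n) {c d : Fin n} (f : Bool)
    (hcj : c ≠ j) (hcd : c ≠ d) (hci : d = j → c ≠ i) :
    (lightBulbLaw n N ρ i j).map (fun X k => decide (xor (X c k) f = X d k)) =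
      Measure.pi fun _ => bitLaw (1 / 2) := by
  unfold lightBulbLaw
  rw [Measure.map_map Measurable.of_discrete Measurable.of_discrete]
  refine map_eq_pi_half _ Measurable.of_discrete
    (fun w Z l k => xor (decide (l = c) && w k) (Z l k)) (fun w => ?_) (fun w Z => ?_)
  · refine measurePreserving_pi _ _ (f := fun l (row : Fin N → Bool) k => xor (decide (l = c) && w k) (row k))
      fun l => ?_
    refine measurePreserving_pi _ _ (f := fun k b => xor (decide (l = c) && w k) b) fun k => ?_
    refine measurePreserving_xor _ fun h => ?_
    simp only [Bool.and_eq_true, decide_eq_true_eq] at h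
    rw [if_neg (h.1 ▸ hcj)]
  · funext k
    by_cases hd : d = j
    · have hic : i ≠ c := fun h => hci hd h.symm
      have hjc : j ≠ c := fun h => hcj h.symm
      simp only [Function.comp, plant, hcj, hd, hic, hjc, if_false, if_true, decide_true,
        decide_false, Bool.true_and, Bool.false_and, Bool.false_xor]
      cases w k <;> cases Z c k <;> cases f <;> cases Z i k <;> cases Z j k <;> rfl
    · simp only [Function.comp, plant, hcj, hd, hcd.symm, if_false, decide_true,
        decide_false, Bool.true_and, Bool.false_and, Bool.false_xor]
      cases w k <;> cases Z c k <;> cases f <;> cases Z d k <;> rfl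

theorem agree_tail_of_ne {n N M : ℕ} (hM : M ≤ N) (hM0 : 0 < M) (ρ : ℝ) (i j : Fin n) {c d : Fin n}
    (f : Bool) (hcj : c ≠ j) (hcd : c ≠ d) (hci : d = j → c ≠ i) (ω : ℕ → Bool) {η : ℝ}
    (hη : 0 ≤ η) :
    lightBulbLaw n N ρ i j {X | (1 / 2 + η) * M <
      agree ((inputEnv ρ X ω).bits c) ((inputEnv ρ X ω).bits d) f M} ≤
      ENNReal.ofReal (Real.exp (-2 * η ^ 2 * M)) := by
  have h := bits_tail_le hM hM0 (p := 1 / 2) (by norm_num) (by norm_num) hη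
  rw [← map_agree_eq_pi_half (N := N) ρ i j f hcj hcd hci,
    Measure.map_apply Measurable.of_discrete (Set.toFinite _).measurableSet] at h
  refine le_trans (measure_mono fun X hX => ?_) h
  simp only [Set.mem_ofPred_eq, agree_inputEnv hM] at hX
  exact hX.le

/-- At most one of the two strings is string `j`, and agreement is symmetric, so the other one can
serve as the row that is translated. -/
theorem agree_tail {n N M : ℕ} (hM : M ≤ N) (hM0 : 0 < M) (ρ : ℝ) (i j : Fin n) {c d : Fin n}
    (f : Bool) (hcd : c ≠ d) (h1 : ¬ (c = i ∧ d = j)) (h2 : ¬ (c = j ∧ d = i))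
    (ω : ℕ → Bool) {η : ℝ} (hη : 0 ≤ η) :
    lightBulbLaw n N ρ i j {X | (1 / 2 + η) * M <
      agree ((inputEnv ρ X ω).bits c) ((inputEnv ρ X ω).bits d) f M} ≤
      ENNReal.ofReal (Real.exp (-2 * η ^ 2 * M)) := by
  by_cases hc : c = j
  · have := agree_tail_of_ne hM hM0 ρ i j f (c := d) (d := c) (fun h => hcd (hc.trans h.symm))
      hcd.symm (fun _ h => h2 ⟨hc, h⟩) ω hη
    simpa only [agree_comm] using this
  · exact agree_tail_of_ne hM hM0 ρ i j f hc hcd (fun h h' => h1 ⟨h', h⟩) ω hη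

theorem relDist_mem {ρ : ℝ} (h1 : |ρ| ≤ 1) : 0 ≤ relDist ρ ∧ relDist ρ ≤ 1 := by
  have := abs_nonneg ρ
  unfold relDist
  constructor <;> linarith

/-- The sum of strings `i` and `j` is row `j` of the underlying bits. Complementing it for ρ < 0
turns the probability (1 - ρ)/2 into (1 + ρ)/2 = (1 - |ρ|)/2. -/
theorem map_disagree_eq_pi {n N : ℕ} {ρ : ℝ} (h1 : |ρ| ≤ 1) {i j : Fin n} (hij : i ≠ j) :
    (lightBulbLaw n N ρ i j).map
      (fun X k => !decide (xor (X i k) (decide (ρ < 0)) = X j k)) =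
      Measure.pi fun _ => bitLaw (relDist ρ) := by
  unfold lightBulbLaw
  rw [Measure.map_map Measurable.of_discrete Measurable.of_discrete]
  have hfun : ((fun (X : Fin n → Fin N → Bool) k =>
      !decide (xor (X i k) (decide (ρ < 0)) = X j k)) ∘ plant i j) =
      (fun row : Fin N → Bool => fun k => xor (decide (ρ < 0)) (row k)) ∘ (Function.eval j) := by
    funext Z k
    simp only [Function.comp, plant, hij, if_false, if_true, Function.eval]
    generalize decide (ρ < 0) = f
    cases f <;> cases Z i k <;> cases Z j k <;> rfl
  rw [hfun, ← Measure.map_map Measurable.of_discrete Measurable.of_discrete,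
    (measurePreserving_eval (fun l : Fin n => Measure.pi fun _ : Fin N =>
      bitLaw (if l = j then (1 - ρ) / 2 else 1 / 2)) j).map_eq]
  simp only [if_true]
  refine (measurePreserving_pi (fun _ => bitLaw ((1 - ρ) / 2)) (fun _ => bitLaw (relDist ρ))
    (f := fun _ b => xor (decide (ρ < 0)) b) fun k => ⟨Measurable.of_discrete, ?_⟩).map_eq
  obtain ⟨ha, hb⟩ := abs_le.1 h1
  refine Measure.ext_of_singleton fun b => ?_
  rw [Measure.map_apply Measurable.of_discrete (measurableSet_singleton _)]
  by_cases hneg : ρ < 0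
  · have hpre : (fun b => xor (decide (ρ < 0)) b) ⁻¹' {b} = {!b} := by
      ext x; simp only [hneg]; cases x <;> cases b <;> simp
    rw [hpre, relDist, abs_of_neg hneg]
    cases b
    · rw [Bool.not_false, bitLaw_true (by linarith) (by linarith),
        bitLaw_false (by linarith) (by linarith)]
      congr 1; ring
    · rw [Bool.not_true, bitLaw_true (by linarith) (by linarith),
        bitLaw_false (by linarith) (by linarith)]
      congr 1; ring
  · have hpre : (fun b => xor (decide (ρ < 0)) b) ⁻¹' {b} = {b} := by
      ext x; simp [hneg]
    rw [hpre, relDist, abs_of_nonneg (not_lt.1 hneg)]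

theorem agree_add_disagree {N M : ℕ} (hM : M ≤ N) (w : Fin N → Bool) :
    (Finset.univ.filter fun k : Fin N => (k : ℕ) < M ∧ w k = true).card +
      (Finset.univ.filter fun k : Fin N => (k : ℕ) < M ∧ (!w k) = true).card = M := by
  conv_rhs => rw [← card_fin_filter_lt hM]
  rw [← Finset.filter_filter, ← Finset.filter_filter]
  simp only [Bool.not_eq_true', ← Bool.not_eq_true]
  exact Finset.card_filter_add_card_filter_not _

theorem agree_planted_tail {n N M : ℕ} (hM : M ≤ N) (hM0 : 0 < M) {ρ : ℝ} (h1 : |ρ| ≤ 1)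
    {i j : Fin n} (hij : i ≠ j) (ω : ℕ → Bool) :
    lightBulbLaw n N ρ i j {X |
      (agree ((inputEnv ρ X ω).bits i) ((inputEnv ρ X ω).bits j) (decide (ρ < 0)) M : ℝ) <
        (1 - errFrac ρ) * M} ≤
      ENNReal.ofReal (Real.exp (-2 * (1 / (64 * scale ρ)) ^ 2 * M)) := by
  obtain ⟨hd0, hd1⟩ := relDist_mem h1
  have key : ∀ X : Fin n → Fin N → Bool,
      (agree ((inputEnv ρ X ω).bits i) ((inputEnv ρ X ω).bits j) (decide (ρ < 0)) M : ℝ) =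
      M - ((Finset.univ.filter fun k : Fin N => (k : ℕ) < M ∧
        (!decide (xor (X i k) (decide (ρ < 0)) = X j k)) = true).card : ℝ) := by
    intro X
    rw [agree_inputEnv hM, eq_sub_iff_add_eq]
    exact_mod_cast agree_add_disagree hM (fun k => decide (xor (X i k) (decide (ρ < 0)) = X j k))
  simp only [key]
  -- If |ρ| = 1, no disagreement at all is tolerated, and almost surely there is none. Otherwise the
  -- tolerance is 1/(64t) and the tail bound applies.
  by_cases h : |ρ| = 1
  · have hzero : lightBulbLaw n N ρ i j ((fun X k =>
        !decide (xor (X i k) (decide (ρ < 0)) = X j k)) ⁻¹' {fun _ => false}ᶜ) = 0 := by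
      rw [← Measure.map_apply Measurable.of_discrete (Set.toFinite _).measurableSet,
        map_disagree_eq_pi h1 hij]
      have h0 : relDist ρ = 0 := by unfold relDist; rw [h]; norm_num
      rw [prob_compl_eq_zero_iff (measurableSet_singleton _), Measure.pi_singleton, h0]
      simp [bitLaw_false le_rfl zero_le_one]
    refine le_trans (le_of_eq (measure_mono_null (fun X hX => ?_) hzero)) zero_le
    simp only [Set.mem_preimage, Set.mem_compl_iff, Set.mem_singleton_iff]
    intro hX0
    have hX1 : ∀ k, (!decide (xor (X i k) (decide (ρ < 0)) = X j k)) = false := congrFun hX0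
    simp only [Set.mem_ofPred_eq, hX1] at hX
    simp [errFrac, h] at hX
  · have hb := bits_tail_le hM hM0 hd0 hd1 (η := 1 / (64 * scale ρ)) (by positivity)
    rw [← map_disagree_eq_pi (N := N) h1 hij,
      Measure.map_apply Measurable.of_discrete (Set.toFinite _).measurableSet] at hb
    refine le_trans (measure_mono fun X hX => ?_) hb
    simp only [Set.mem_ofPred_eq, errFrac, h, if_false] at hX
    simp only [Set.mem_preimage, Set.mem_ofPred_eq]
    linarith

/-- The constant 8192 in `coordBits` is 2 · 64²; it makes 2M/(64t)² at least four times `n.size`. -/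
theorem exp_coords_le {ρ : ℝ} (h0 : ρ ≠ 0) (h1 : |ρ| ≤ 1) (n : ℕ) :
    Real.exp (-2 * (1 / (64 * scale ρ)) ^ 2 * coords ρ n) ≤ Real.exp (-(4 * n.size)) := by
  have h2 := two_le_scale h0 h1
  have h3 : scale ρ * scale ρ * n.size * 8192 < coords ρ n := Nat.size_le.1 le_rfl
  have h4 : (scale ρ : ℝ) * scale ρ * n.size * 8192 ≤ coords ρ n := by exact_mod_cast h3.le
  refine Real.exp_le_exp.2 ?_
  have h5 : (4 * n.size : ℝ) = 2 * (1 / (64 * scale ρ : ℝ)) ^ 2 *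
      ((scale ρ : ℝ) * scale ρ * n.size * 8192) := by
    field_simp; ring
  have h6 : 2 * (1 / (64 * scale ρ : ℝ)) ^ 2 * ((scale ρ : ℝ) * scale ρ * n.size * 8192) ≤
    2 * (1 / (64 * scale ρ : ℝ)) ^ 2 * coords ρ n := by gcongr
  linarith

/-- With K = `n.size` ≥ 2 one has n < 2^K and 9 ≤ 3^K, and 3 · 2⁴ = 48 < e⁴. -/
theorem nat_pow_mul_exp_le {n : ℕ} (hn : 2 ≤ n) : 9 * (n : ℝ) ^ 4 * Real.exp (-(4 * n.size)) ≤ 1 := by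
  have h1 : n < 2 ^ n.size := Nat.size_le.1 le_rfl
  have h2 : 2 ≤ n.size := by
    by_contra h
    have : n.size ≤ 1 := by omega
    have := Nat.size_le.1 this
    omega
  have h3 : (48 : ℝ) ≤ Real.exp 4 := by
    have : Real.exp 4 = Real.exp 1 ^ 4 := by rw [← Real.exp_nat_mul]; norm_num
    rw [this]
    have := Real.exp_one_gt_d9
    calc (48 : ℝ) ≤ 2.7 ^ 4 := by norm_num
      _ ≤ Real.exp 1 ^ 4 := pow_le_pow_left₀ (by norm_num) (by linarith) 4
  have h4 : Real.exp (4 * n.size) = Real.exp 4 ^ n.size := by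
    rw [← Real.exp_nat_mul]; congr 1; ring
  rw [Real.exp_neg, ← div_eq_mul_inv, div_le_one (Real.exp_pos _), h4]
  have h5 : (n : ℝ) ≤ 2 ^ n.size := by exact_mod_cast h1.le
  calc 9 * (n : ℝ) ^ 4 ≤ 3 ^ n.size * (2 ^ n.size) ^ 4 := by
        gcongr
        calc (9 : ℝ) = 3 ^ 2 := by norm_num
          _ ≤ 3 ^ n.size := pow_le_pow_right₀ (by norm_num) h2
    _ = 48 ^ n.size := by
        rw [← pow_mul, mul_comm n.size 4, pow_mul, ← mul_pow]; norm_num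
    _ ≤ _ := pow_le_pow_left₀ (by norm_num) h3 _

/-- A union bound over 1 + 2n² events, one for the planted pair and one for each pair of strings
with or without complementation. -/
theorem not_typical_le {n N : ℕ} (hn : 2 ≤ n) {ρ : ℝ} (h0 : ρ ≠ 0) (h1 : |ρ| ≤ 1)
    (hM : coords ρ n ≤ N) {i j : Fin n} (hij : i ≠ j) (ω : ℕ → Bool) :
    lightBulbLaw n N ρ i j {X | ¬ Typical (inputEnv ρ X ω) n i j} ≤
      ENNReal.ofReal (1 / (2 * (n : ℝ) ^ 2)) := by
  set M := coords ρ n with hMdef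
  set η : ℝ := 1 / (64 * scale ρ) with hη
  set q := ENNReal.ofReal (Real.exp (-(4 * n.size))) with hq
  have hM0 : 0 < M := by rw [hMdef, coords]; positivity
  have hle : ENNReal.ofReal (Real.exp (-2 * η ^ 2 * M)) ≤ q :=
    ENNReal.ofReal_le_ofReal (exp_coords_le h0 h1 n)
  have hη0 : 0 ≤ η := by positivity
  set A := {X : Fin n → Fin N → Bool |
      (agree ((inputEnv ρ X ω).bits i) ((inputEnv ρ X ω).bits j) (decide (ρ < 0)) M : ℝ) <
        (1 - errFrac ρ) * M} with hA
  -- The conditions on the pair are part of the event, so that the excluded pairs contribute empty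
  -- events and the sum may run over everything.
  set D : (Fin n × Fin n) × Bool → Set (Fin n → Fin N → Bool) := fun x =>
    {X | (x.1.1 ≠ x.1.2 ∧ ¬ (x.1.1 = i ∧ x.1.2 = j) ∧ ¬ (x.1.1 = j ∧ x.1.2 = i)) ∧
      (1 / 2 + η) * M <
      agree ((inputEnv ρ X ω).bits x.1.1) ((inputEnv ρ X ω).bits x.1.2) x.2 M} with hD
  have hsub : {X | ¬ Typical (inputEnv ρ X ω) n i j} ⊆ A ∪ ⋃ x, D x := by
    intro X hX
    by_contra hcon
    simp only [Set.mem_union, Set.mem_iUnion, not_or, not_exists, hA, hD, Set.mem_ofPred_eq,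
      not_lt, not_and] at hcon
    refine hX ⟨hcon.1, fun c d f hc hd hcd h1 h2 => ?_⟩
    refine hcon.2 ((⟨c, hc⟩, ⟨d, hd⟩), f) ⟨fun h => hcd (Fin.ext_iff.1 h), fun h h' => h1 ?_,
      fun h h' => h2 ?_⟩
    · exact ⟨Fin.ext_iff.1 h, Fin.ext_iff.1 h'⟩
    · exact ⟨Fin.ext_iff.1 h, Fin.ext_iff.1 h'⟩
  have hDle : ∀ x, lightBulbLaw n N ρ i j (D x) ≤ q := by
    rintro ⟨⟨c, d⟩, f⟩
    by_cases hcond : c ≠ d ∧ ¬ (c = i ∧ d = j) ∧ ¬ (c = j ∧ d = i)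
    · refine le_trans (measure_mono fun X hX => ?_)
        ((agree_tail hM hM0 ρ i j f hcond.1 hcond.2.1 hcond.2.2 ω hη0).trans hle)
      exact hX.2
    · have : D ((c, d), f) = ∅ := by
        ext X
        simp only [hD, Set.mem_ofPred_eq, Set.mem_empty_iff_false, iff_false]
        exact fun h => hcond h.1
      rw [this]; simp
  calc lightBulbLaw n N ρ i j {X | ¬ Typical (inputEnv ρ X ω) n i j}
      ≤ lightBulbLaw n N ρ i j A + ∑ x, lightBulbLaw n N ρ i j (D x) :=
        (measure_mono hsub).trans ((measure_union_le _ _).trans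
          (add_le_add_right (measure_iUnion_fintype_le _ _) _))
    _ ≤ q + ∑ _x : (Fin n × Fin n) × Bool, q :=
        add_le_add ((agree_planted_tail hM hM0 h1 hij ω).trans hle)
          (Finset.sum_le_sum fun x _ => hDle x)
    _ = ENNReal.ofReal ((1 + n * n * 2) * Real.exp (-(4 * n.size))) := by
        rw [Finset.sum_const, Finset.card_univ, Fintype.card_prod, Fintype.card_prod,
          Fintype.card_fin, Fintype.card_bool, nsmul_eq_mul, ENNReal.ofReal_mul (by positivity),
          add_comm (1 : ℝ), ENNReal.ofReal_add (by positivity) (by norm_num)]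
        have : ENNReal.ofReal ((n : ℝ) * n * 2) = ((n * n * 2 : ℕ) : ENNReal) := by
          rw [← ENNReal.ofReal_natCast]; push_cast; rfl
        rw [this, ENNReal.ofReal_one, add_mul, one_mul, add_comm, hq]
    _ ≤ ENNReal.ofReal (1 / (2 * (n : ℝ) ^ 2)) := by
        refine ENNReal.ofReal_le_ofReal ?_
        have hn' : (2 : ℝ) ≤ n := by exact_mod_cast hn
        have hmain := nat_pow_mul_exp_le hn
        rw [le_div_iff₀ (by positivity)]
        have hexp := (Real.exp_pos (-(4 * n.size : ℝ))).le
        have hcoef : (1 + (n : ℝ) * n * 2) * (2 * n ^ 2) ≤ 9 * n ^ 4 := by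
          have hy : 1 ≤ (n : ℝ) ^ 2 := by nlinarith
          have : 9 * (n : ℝ) ^ 4 - (1 + (n : ℝ) * n * 2) * (2 * n ^ 2) =
            (n : ℝ) ^ 2 * (5 * n ^ 2 - 2) := by ring
          have : 0 ≤ (n : ℝ) ^ 2 * (5 * n ^ 2 - 2) := by
            refine mul_nonneg (by positivity) (by linarith)
          linarith
        calc (1 + (n : ℝ) * n * 2) * Real.exp (-(4 * n.size)) * (2 * n ^ 2)
            = ((1 + (n : ℝ) * n * 2) * (2 * n ^ 2)) * Real.exp (-(4 * n.size)) := by ring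
          _ ≤ 9 * n ^ 4 * Real.exp (-(4 * n.size)) := mul_le_mul_of_nonneg_right hcoef hexp
          _ ≤ 1 := hmain

/-! ### Correctness of the search program -/

theorem Typical.symm {e : Env} {n a b : ℕ} (h : Typical e n a b) : Typical e n b a :=
  ⟨by rw [agree_comm]; exact h.1, fun c d f hc hd hcd h1 h2 => h.2 c d f hc hd hcd h2 h1⟩

/-- The first factor is finite, so `S` is covered by finitely many rectangles. No measurability of
`S` is required. -/
theorem prod_le_of_forall_slice {α β : Type*} [Fintype α] [MeasurableSpace α]
    [MeasurableSingletonClass α] [MeasurableSpace β] (μ : Measure α) [IsProbabilityMeasure μ]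
    (ν : Measure β) [IsProbabilityMeasure ν] {S : Set (α × β)} {q : ENNReal}
    (h : ∀ x, ν {y | (x, y) ∈ S} ≤ q) : (μ.prod ν) S ≤ q := by
  have hsub : S ⊆ ⋃ x : α, {x} ×ˢ {y | (x, y) ∈ S} := by
    rintro ⟨x, y⟩ hxy
    simp only [Set.mem_iUnion, Set.mem_prod, Set.mem_singleton_iff, Set.mem_ofPred_eq]
    exact ⟨x, rfl, hxy⟩
  calc (μ.prod ν) S ≤ ∑ x : α, (μ.prod ν) ({x} ×ˢ {y | (x, y) ∈ S}) :=
        (measure_mono hsub).trans (measure_iUnion_fintype_le _ _)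
    _ ≤ ∑ x : α, μ {x} * q := by
        refine Finset.sum_le_sum fun x _ => ?_
        rw [Measure.prod_prod]
        exact mul_le_mul_right (h x) _
    _ = q := by rw [← Finset.sum_mul, sum_measure_singleton]; simp

open Classical in
-- A repetition fails with probability at most 1 - 2^(-E)/2, where E is `repBits`. Among 8K · 2^E
-- repetitions, K being `n.size`, all fail with probability at most e^(-4K).
theorem coinLaw_no_hit_le {n N : ℕ} (hn : 2 ≤ n) {ρ : ℝ} (h0 : ρ ≠ 0) (h1 : |ρ| ≤ 1)
    (X : Fin n → Fin N → Bool) {a b : ℕ} (hab : a < b) (hb : b < n)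
    (ht : ∀ ω, Typical (inputEnv ρ X ω) n a b) :
    coinLaw {ω | ∀ r < reps ρ n, ¬ Hit (inputEnv ρ X ω) (coords ρ n) (hashLen ρ n) (thresh ρ n)
      (weight ρ) (decide (ρ < 0)) n (repSeed ω (seedLen ρ n) r) a b} ≤
      ENNReal.ofReal (1 / (2 * (n : ℝ) ^ 2)) := by
  -- Hash values depend on the strings and the seed only, so the set of good seeds can be described
  -- with an arbitrary fixed coin sequence.
  set e₀ : Env := inputEnv ρ X fun _ => false with he₀
  set v := seedLen ρ n with hv
  set G : ℕ → Prop := fun R =>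
    key e₀ (coords ρ n) (hashLen ρ n) R (decide (ρ < 0)) a =
          key e₀ (coords ρ n) (hashLen ρ n) R false b ∧
        ∀ l < n, l ≠ a → l ≠ b → key e₀ (coords ρ n) (hashLen ρ n) R false l ≠
          key e₀ (coords ρ n) (hashLen ρ n) R false b with hG
  have hcard := card_hit_ge (e := e₀) h0 h1 hb (ht _)
  have hpass := Typical.passes (e := e₀) h0 h1 (ht _)
  have hsub : {ω | ∀ r < reps ρ n, ¬ Hit (inputEnv ρ X ω) (coords ρ n) (hashLen ρ n) (thresh ρ n)
      (weight ρ) (decide (ρ < 0)) n (repSeed ω v r) a b} ⊆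
      {ω | ∀ r < reps ρ n, ¬ G (repSeed ω v r)} := by
    intro ω hω r hr hg
    exact hω r hr ⟨hab, hb, hpass, hg.1, fun l hl hl' =>
      hg.2 l (hl'.trans hb) hl.ne' hl'.ne⟩
  refine (measure_mono hsub).trans ((coinLaw_forall_repSeed_le (fun R => ¬ G R) v _).trans ?_)
  have hcompl : (((Finset.range (2 ^ v)).filter fun R => ¬ G R).card : ℝ) ≤
      2 ^ v * (1 - 1 / 2 * (2 : ℝ) ^ (-(repBits ρ n : ℝ))) := by
    have h2 := Finset.card_filter_add_card_filter_not (s := Finset.range (2 ^ v)) G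
    rw [Finset.card_range] at h2
    have h3 : (((Finset.range (2 ^ v)).filter G).card : ℝ) +
        ((Finset.range (2 ^ v)).filter fun R => ¬ G R).card = 2 ^ v := by exact_mod_cast h2
    have h4 : (2 : ℝ) ^ v * (1 / 2 * (2 : ℝ) ^ (-(repBits ρ n : ℝ))) ≤
      ((Finset.range (2 ^ v)).filter G).card := hcard
    linarith
  set x : ℝ := 1 / 2 * (2 : ℝ) ^ (-(repBits ρ n : ℝ)) with hx
  have hEN : (((Finset.range (2 ^ v)).filter fun R => ¬ G R).card : ENNReal) * 2⁻¹ ^ v ≤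
      ENNReal.ofReal (Real.exp (-x)) := by
    have h5 : (((Finset.range (2 ^ v)).filter fun R => ¬ G R).card : ENNReal) * 2⁻¹ ^ v =
        ENNReal.ofReal ((((Finset.range (2 ^ v)).filter fun R => ¬ G R).card : ℝ) / 2 ^ v) := by
      rw [ENNReal.ofReal_div_of_pos (by positivity), ENNReal.ofReal_natCast, div_eq_mul_inv,
        ENNReal.ofReal_pow (by norm_num), ENNReal.inv_pow]
      simp
    rw [h5]
    refine ENNReal.ofReal_le_ofReal ?_
    rw [div_le_iff₀ (by positivity), mul_comm]
    refine hcompl.trans (mul_le_mul_of_nonneg_left ?_ (by positivity))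
    exact Real.one_sub_le_exp_neg x
  refine le_trans (le_of_eq ?_) ((pow_le_pow_left' hEN (reps ρ n)).trans ?_)
  · congr!
  rw [← ENNReal.ofReal_pow (Real.exp_pos _).le, ← Real.exp_nat_mul]
  refine ENNReal.ofReal_le_ofReal ?_
  have hexp : (reps ρ n : ℝ) * -x = -(4 * n.size) := by
    rw [hx, reps]
    push_cast
    rw [Real.rpow_neg (by norm_num), Real.rpow_natCast]
    field_simp; ring
  rw [hexp]
  have h6 := nat_pow_mul_exp_le hn
  have h7 : (2 : ℝ) ≤ n := by exact_mod_cast hn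
  rw [le_div_iff₀ (by positivity)]
  have h8 : 2 * (n : ℝ) ^ 2 ≤ 9 * n ^ 4 := by
    have hy : 1 ≤ (n : ℝ) ^ 2 := by nlinarith
    have : (n : ℝ) ^ 4 = n ^ 2 * n ^ 2 := by ring
    nlinarith
  have h9 := mul_le_mul_of_nonneg_right h8 (Real.exp_pos (-(4 * n.size : ℝ))).le
  linarith

/-- Success covers the complement of two bad sets, atypical instances and runs without a hit, each
of measure at most 1/(2n²). Only subadditivity is used, so the success event need not be shown
measurable. -/
theorem solves_lightBulbProg {n N : ℕ} (hn : 2 ≤ n) {ρ : ℝ} (h0 : ρ ≠ 0) (h1 : |ρ| ≤ 1)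
    (hM : coords ρ n ≤ N) (mem : ℕ → ℕ) {T : ℝ}
    (hT : ((stepBound ρ n * (2 * wordLen ρ n + 2) : ℕ) : ℝ) ≤ T) :
    Solves lightBulbProg n N ρ mem T := by
  refine ⟨fun X ω => ?_, fun i j hij => ?_⟩
  · obtain ⟨s, t, h2, h3, -⟩ := runs_lightBulbProg (e := inputEnv ρ X ω) (n := n) h0 h1 mem
    exact ⟨s, t, h2, le_trans (by exact_mod_cast h3) hT⟩
  have : IsProbabilityMeasure (lightBulbLaw n N ρ i j) := by
    unfold lightBulbLaw
    exact Measure.isProbabilityMeasure_map Measurable.of_discrete.aemeasurable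
  have : IsProbabilityMeasure coinLaw := by unfold coinLaw; infer_instance
  -- The search reports the smaller index first, while the planted pair comes in either order.
  obtain ⟨a, b, hab, hb, hset, htyp⟩ : ∃ a b : ℕ, a < b ∧ b < n ∧
      ({a, b} : Set ℕ) = {(i : ℕ), (j : ℕ)} ∧
      ∀ e, Typical e n i j → Typical e n a b := by
    rcases lt_or_gt_of_ne hij with h | h
    · exact ⟨i, j, h, j.2, rfl, fun _ h => h⟩
    · exact ⟨j, i, h, i.2, Set.pair_comm _ _, fun _ h => h.symm⟩
  set μ := (lightBulbLaw n N ρ i j).prod coinLaw with hμ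
  set S := {z : (Fin n → Fin N → Bool) × (ℕ → Bool) | ∃ (s : State) (t : ℕ),
    Exec (inputEnv ρ z.1 z.2) lightBulbProg (start n ρ mem) s t ∧
        ({s.reg 0, s.reg 1} : Set ℕ) = {(i : ℕ), (j : ℕ)}} with hS
  set A := {X : Fin n → Fin N → Bool | ¬ Typical (inputEnv ρ X fun _ => false) n i j} with hA
  set D := {z : (Fin n → Fin N → Bool) × (ℕ → Bool) |
    Typical (inputEnv ρ z.1 fun _ => false) n i j ∧
    ∀ r < reps ρ n, ¬ Hit (inputEnv ρ z.1 z.2) (coords ρ n) (hashLen ρ n) (thresh ρ n)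
      (weight ρ) (decide (ρ < 0)) n (repSeed z.2 (seedLen ρ n) r) a b} with hD
  have hcover : Set.univ ⊆ S ∪ (A ×ˢ Set.univ ∪ D) := by
    rintro ⟨X, ω⟩ -
    by_cases hX : Typical (inputEnv ρ X fun _ => false) n i j
    · by_cases hh : ∀ r < reps ρ n, ¬ Hit (inputEnv ρ X ω) (coords ρ n) (hashLen ρ n)
        (thresh ρ n) (weight ρ) (decide (ρ < 0)) n (repSeed ω (seedLen ρ n) r) a b
      · exact Or.inr (Or.inr ⟨hX, hh⟩)
      · push Not at hh
        obtain ⟨r, hr, hhit⟩ := hh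
        left
        obtain ⟨s, t, h2, -, -, h3⟩ :=
          runs_lightBulbProg (e := inputEnv ρ X ω) (n := n) h0 h1 mem
        obtain ⟨a', b', hab', hb', hp, hs0, hs1⟩ := h3 r hr a b hhit
        obtain ⟨rfl, rfl⟩ := Typical.eq_of_passes (e := inputEnv ρ X ω) h0 h1 (htyp _ hX) hab
          hab' hb' hp
        exact ⟨s, t, h2, by rw [hs0, hs1, hset]⟩
    · exact Or.inr (Or.inl ⟨hX, trivial⟩)
  have hAle : μ (A ×ˢ Set.univ) ≤ ENNReal.ofReal (1 / (2 * (n : ℝ) ^ 2)) := by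
    rw [hμ, Measure.prod_prod, measure_univ, mul_one]
    exact not_typical_le hn h0 h1 hM hij _
  have hDle : μ D ≤ ENNReal.ofReal (1 / (2 * (n : ℝ) ^ 2)) := by
    refine prod_le_of_forall_slice _ _ fun X => ?_
    by_cases hX : Typical (inputEnv ρ X fun _ => false) n i j
    · refine le_trans (measure_mono fun ω hω => ?_)
        (coinLaw_no_hit_le hn h0 h1 X hab hb fun ω => htyp _ hX)
      exact hω.2
    · have : {ω | (X, ω) ∈ D} = ∅ := by
        ext ω
        simp only [hD, Set.mem_ofPred_eq, Set.mem_empty_iff_false, iff_false]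
        exact fun h => hX h.1
      rw [this]; simp
  have hone : (1 : ENNReal) ≤ μ S + ENNReal.ofReal (1 / (n : ℝ) ^ 2) := by
    calc (1 : ENNReal) = μ Set.univ := measure_univ.symm
      _ ≤ μ S + (μ (A ×ˢ Set.univ) + μ D) :=
        (measure_mono hcover).trans ((measure_union_le _ _).trans
          (add_le_add_right (measure_union_le _ _) _))
      _ ≤ μ S + (ENNReal.ofReal (1 / (2 * (n : ℝ) ^ 2)) + ENNReal.ofReal (1 / (2 * (n : ℝ) ^ 2))) :=
        add_le_add_right (add_le_add hAle hDle) _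
      _ = μ S + ENNReal.ofReal (1 / (n : ℝ) ^ 2) := by
        rw [← ENNReal.ofReal_add (by positivity) (by positivity)]
        congr 2
        have : (n : ℝ) ≠ 0 := by positivity
        field_simp; norm_num
  rw [ENNReal.ofReal_sub _ (by positivity), ENNReal.ofReal_one]
  exact tsub_le_iff_right.2 hone

/-! ### The exponent -/

/-- The entropy is concave and lies above its chord from 0 to 1/2. Equivalently δ ≤ H₂(δ) - δ, which
is the form needed for the exponent. -/
theorem two_mul_le_H2 {δ : ℝ} (h0 : 0 ≤ δ) (h1 : δ ≤ 1 / 2) : 2 * δ ≤ H2 δ := by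
  have hlog : 0 < Real.log 2 := Real.log_pos (by norm_num)
  have hc := Real.strictConcave_binEntropy.concaveOn.2 (show (0 : ℝ) ∈ Set.Icc 0 1 by simp)
    (show (2⁻¹ : ℝ) ∈ Set.Icc 0 1 by constructor <;> norm_num)
    (show 0 ≤ 1 - 2 * δ by linarith) (show 0 ≤ 2 * δ by linarith) (by ring)
  simp only [smul_eq_mul, mul_zero, zero_add, Real.binEntropy_zero, Real.binEntropy_two_inv] at hc
  rw [show 2 * δ * 2⁻¹ = δ by ring] at hc
  rw [H2, le_div_iff₀ hlog]
  exact hc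

theorem H2_le_one (δ : ℝ) : H2 δ ≤ 1 := by
  rw [H2, div_le_one (Real.log_pos (by norm_num))]
  exact Real.binEntropy_le_log_two

theorem H2inv_nonneg {y : ℝ} (h0 : 0 ≤ y) (h1 : y ≤ 1) : 0 ≤ H2inv y := by
  have hlog : 0 < Real.log 2 := Real.log_pos (by norm_num)
  have hcont : ContinuousOn H2 (Set.Icc 0 (1 / 2)) := by
    unfold H2
    exact (Real.binEntropy_continuous.div_const _).continuousOn
  have himg := intermediate_value_Icc (show (0 : ℝ) ≤ 1 / 2 by norm_num) hcont
  have hz : H2 0 = 0 := by simp [H2]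
  have ho : H2 (1 / 2) = 1 := by
    rw [H2, one_div, Real.binEntropy_two_inv, div_self hlog.ne']
  rw [hz, ho] at himg
  have hmem : y ∈ H2 '' Set.Icc 0 (1 / 2) := himg ⟨h0, h1⟩
  exact (Function.invFunOn_mem hmem).1

/-- Each member of the family is at most its rate r < 1 - H₂(δ), because the subtracted term is
nonnegative. The bound itself is nonnegative, which takes care of an empty range of rates. -/
theorem kappaZ_le {δ : ℝ} (h0 : 0 ≤ δ) (h1 : δ ≤ 1 / 2) : kappaZ δ ≤ 1 - H2 δ := by
  have hH := H2_le_one δ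
  have hH0 := two_mul_le_H2 h0 h1
  refine Real.sSup_le ?_ (by linarith)
  rintro _ ⟨r, ⟨hr0, hr1⟩, rfl⟩
  have h2 : 0 ≤ δ / H2inv (1 - r) := div_nonneg h0 (H2inv_nonneg (by linarith) (by linarith))
  have h3 : r * (1 - δ / H2inv (1 - r)) ≤ r * 1 := mul_le_mul_of_nonneg_left (by linarith) hr0.le
  simp only
  linarith

theorem relDist_le_half (ρ : ℝ) : relDist ρ ≤ 1 / 2 := by
  have := abs_nonneg ρ
  unfold relDist; linarith

/-! ### The running time of the search program -/

theorem one_le_logb {n : ℕ} (hn : 2 ≤ n) : 1 ≤ Real.logb 2 n := by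
  rw [Real.le_logb_iff_rpow_le (by norm_num) (by positivity)]
  simpa using (by exact_mod_cast hn : (2 : ℝ) ≤ n)

theorem size_le_logb {n : ℕ} (hn : 2 ≤ n) : (n.size : ℝ) ≤ Real.logb 2 n + 1 := by
  have h1 : 0 < n.size := Nat.size_pos.2 (by omega)
  have h2 : 2 ^ (n.size - 1) ≤ n := Nat.lt_size.1 (by omega)
  have h3 : ((n.size - 1 : ℕ) : ℝ) ≤ Real.logb 2 n := by
    rw [Real.le_logb_iff_rpow_le (by norm_num) (by positivity), Real.rpow_natCast]
    exact_mod_cast h2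
  rw [Nat.cast_sub h1] at h3
  push_cast at h3
  linarith

/-- Since t|ρ| ≥ 1, rounding 64t|ρ| down leaves at least 63t|ρ|; the constant is 8/7 · 64/63 =
512/441. -/
theorem hashLen_le {ρ : ℝ} (h0 : ρ ≠ 0) (h1 : |ρ| ≤ 1) (n : ℕ) :
    (hashLen ρ n : ℝ) ≤ 512 / 441 * (n.size + 1) / |ρ| + 1 := by
  have h2 := one_le_scale_mul h0 h1
  have h3 := two_le_scale h0 h1
  have hpos : 0 < |ρ| := abs_pos.2 h0
  set a := ⌊|ρ| * ((64 * scale ρ : ℕ) : ℝ)⌋₊ with ha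
  have hlt : |ρ| * ((64 * scale ρ : ℕ) : ℝ) < a + 1 := Nat.lt_floor_add_one _
  push_cast at hlt
  have hge : 63 * (scale ρ * |ρ|) ≤ a := by nlinarith
  have hapos : (0 : ℝ) < a := by nlinarith
  have hdef : hashLen ρ n = (1 + n.size) * (64 * scale ρ) * 8 / (a * 7) + 1 := rfl
  rw [hdef]
  push_cast
  have h4 : (((1 + n.size) * (64 * scale ρ) * 8 / (a * 7) : ℕ) : ℝ) ≤
      ((1 + n.size) * (64 * scale ρ) * 8 : ℝ) / (a * 7) := by
    have := Nat.cast_div_le (α := ℝ) (m := (1 + n.size) * (64 * scale ρ) * 8) (n := a * 7)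
    push_cast at this
    exact this
  have h5 : ((1 + n.size) * (64 * scale ρ) * 8 : ℝ) / (a * 7) ≤
      512 / 441 * (n.size + 1) / |ρ| := by
    rw [div_le_div_iff₀ (by positivity) hpos]
    have hK : (0 : ℝ) ≤ n.size + 1 := by positivity
    have := mul_le_mul_of_nonneg_left hge hK
    nlinarith
  linarith

theorem repBits_le {ρ : ℝ} (h1 : |ρ| ≤ 1) (n : ℕ) :
    (repBits ρ n : ℝ) ≤ 9 / 8 * (1 - |ρ|) * hashLen ρ n + 2 := by
  set k := hashLen ρ n with hk
  set b := ⌊|ρ| * ((k * 8 : ℕ) : ℝ)⌋₊ with hb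
  have hlt : |ρ| * ((k * 8 : ℕ) : ℝ) < b + 1 := Nat.lt_floor_add_one _
  have hE : repBits ρ n = (k * 8 - b) * 9 / 64 + 1 := rfl
  have hbk : b ≤ k * 8 :=
    Nat.floor_le_of_le (mul_le_of_le_one_left (Nat.cast_nonneg _) h1)
  have h2 : 64 * repBits ρ n + b * 9 ≤ k * 8 * 9 + 64 := by rw [hE]; omega
  have h3 : (64 : ℝ) * repBits ρ n + b * 9 ≤ k * 8 * 9 + 64 := by exact_mod_cast h2
  push_cast at hlt
  linarith

/-- The numerical heart of the time bound: 9/4 · 512/441 ≈ 2.61 is less than 4 ln 2 ≈ 2.77, 1/|ρ| ≤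
1/ρ², and δ ≤ H₂(δ) - δ. What remains is bounded and becomes a constant factor. -/
theorem exists_repBits_le {ρ : ℝ} (h0 : ρ ≠ 0) (h1 : |ρ| ≤ 1) :
    ∃ C : ℝ, ∀ n : ℕ, 2 ≤ n →
      (repBits ρ n : ℝ) ≤ (H2 (relDist ρ) - relDist ρ) * sampleDim ρ n + C := by
  have hpos : 0 < |ρ| := abs_pos.2 h0
  obtain ⟨hd0, -⟩ := relDist_mem h1
  refine ⟨9 / 4 * relDist ρ * (512 / 441 * 2 / |ρ| + 1) + 2, fun n hn => ?_⟩
  have hl := one_le_logb hn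
  set l := Real.logb 2 n with hldef
  have hk : (hashLen ρ n : ℝ) ≤ 512 / 441 * (l + 2) / |ρ| + 1 := by
    refine (hashLen_le h0 h1 n).trans ?_
    have h2 : (n.size : ℝ) + 1 ≤ l + 2 := by have := size_le_logb hn; linarith
    gcongr
  have hE := repBits_le h1 n
  have hd : 1 - |ρ| = 2 * relDist ρ := by unfold relDist; ring
  rw [hd] at hE
  have h3 : 9 / 8 * (2 * relDist ρ) * hashLen ρ n ≤
      9 / 8 * (2 * relDist ρ) * (512 / 441 * (l + 2) / |ρ| + 1) :=
    mul_le_mul_of_nonneg_left hk (by positivity)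
  have h4 : relDist ρ * sampleDim ρ n ≤ (H2 (relDist ρ) - relDist ρ) * sampleDim ρ n := by
    refine mul_le_mul_of_nonneg_right ?_ ?_
    · have := two_mul_le_H2 hd0 (relDist_le_half ρ); linarith
    · have := Real.log_pos (show (1 : ℝ) < 2 by norm_num)
      unfold sampleDim; positivity
  have h5 : 9 / 4 * (512 / 441) * (l / |ρ|) ≤ sampleDim ρ n := by
    unfold sampleDim
    rw [← hldef, ← sq_abs ρ]
    have h6 : l / |ρ| ≤ l / |ρ| ^ 2 := by
      refine div_le_div_of_nonneg_left (by linarith) (by positivity) ?_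
      nlinarith
    have h7 := Real.log_two_gt_d9
    have h8 : 0 ≤ l / |ρ| ^ 2 := by positivity
    calc 9 / 4 * (512 / 441) * (l / |ρ|) ≤ 9 / 4 * (512 / 441) * (l / |ρ| ^ 2) := by gcongr
      _ ≤ 4 * Real.log 2 * (l / |ρ| ^ 2) := by
        refine mul_le_mul_of_nonneg_right ?_ h8
        norm_num; linarith
      _ = 4 * Real.log 2 * l / |ρ| ^ 2 := by ring
  have h9 := mul_le_mul_of_nonneg_left h5 hd0
  have h10 : 9 / 8 * (2 * relDist ρ) * (512 / 441 * (l + 2) / |ρ| + 1) =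
      relDist ρ * (9 / 4 * (512 / 441) * (l / |ρ|)) +
        9 / 4 * relDist ρ * (512 / 441 * 2 / |ρ| + 1) := by ring
  linarith

theorem coords_le {ρ : ℝ} (n : ℕ) : coords ρ n ≤ 2 * (scale ρ * scale ρ * n.size * 8192) + 1 := by
  set x := scale ρ * scale ρ * n.size * 8192 with hx
  have hdef : coords ρ n = 2 ^ x.size := rfl
  rw [hdef]
  rcases Nat.eq_zero_or_pos x with h | h
  · rw [h]; simp
  · have h1 : 0 < x.size := Nat.size_pos.2 h
    have h2 : 2 ^ (x.size - 1) ≤ x := Nat.lt_size.1 (by omega)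
    have h3 : 2 ^ x.size = 2 * 2 ^ (x.size - 1) := by rw [← pow_succ']; congr 1; omega
    omega

theorem exists_param_le {ρ : ℝ} (h0 : ρ ≠ 0) (h1 : |ρ| ≤ 1) :
    ∃ c : ℝ, 1 ≤ c ∧ ∀ n : ℕ, 2 ≤ n →
      (scale ρ : ℝ) ≤ c * Real.logb 2 n ∧ (n.size : ℝ) ≤ c * Real.logb 2 n ∧
      (coords ρ n : ℝ) ≤ c * Real.logb 2 n ∧ (coordBits ρ n : ℝ) ≤ c * Real.logb 2 n ∧
      (hashLen ρ n : ℝ) ≤ c * Real.logb 2 n ∧ (repBits ρ n : ℝ) ≤ c * Real.logb 2 n := by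
  have hpos : 0 < |ρ| := abs_pos.2 h0
  set t : ℝ := ((scale ρ : ℕ) : ℝ) with ht
  set c₁ : ℝ := 512 / 441 * 3 / |ρ| + 1 with hc₁
  have hc₁0 : 0 ≤ c₁ := by positivity
  have ht0 : 0 ≤ t := Nat.cast_nonneg _
  refine ⟨t + 2 + (32768 * (t * t) + 1) + (2 * c₁ + 2), by nlinarith, fun n hn => ?_⟩
  have hl := one_le_logb hn
  have hK := size_le_logb hn
  set l := Real.logb 2 n with hldef
  have hK2 : (n.size : ℝ) ≤ 2 * l := by linarith
  have hk : (hashLen ρ n : ℝ) ≤ c₁ * l := by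
    refine (hashLen_le h0 h1 n).trans ?_
    have h2 : 512 / 441 * (n.size + 1 : ℝ) / |ρ| ≤ 512 / 441 * (3 * l) / |ρ| := by
      gcongr; linarith
    have h3 : 512 / 441 * (3 * l) / |ρ| = 512 / 441 * 3 / |ρ| * l := by ring
    rw [hc₁]; linarith
  have hE : (repBits ρ n : ℝ) ≤ (2 * c₁ + 2) * l := by
    have h2 := repBits_le h1 n
    have h3 : 9 / 8 * (1 - |ρ|) * hashLen ρ n ≤ 2 * hashLen ρ n :=
      mul_le_mul_of_nonneg_right (by linarith) (Nat.cast_nonneg _)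
    linarith
  have hM : (coords ρ n : ℝ) ≤ (32768 * (t * t) + 1) * l := by
    have h2 : (coords ρ n : ℝ) ≤ 2 * (t * t * n.size * 8192) + 1 := by
      rw [ht]; exact_mod_cast coords_le (ρ := ρ) n
    have h3 : t * t * n.size ≤ t * t * (2 * l) := by gcongr
    linarith
  have hu : (coordBits ρ n : ℝ) ≤ coords ρ n := by
    exact_mod_cast (Nat.lt_two_pow_self (n := coordBits ρ n)).le
  have hl0 : 0 ≤ l := by linarith
  have a1 : 0 ≤ t * l := by positivity
  have a2 : 0 ≤ t * t * l := by positivity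
  have a3 : 0 ≤ c₁ * l := by positivity
  have a4 : t * 1 ≤ t * l := by gcongr
  refine ⟨?_, ?_, ?_, ?_, ?_, ?_⟩ <;> linarith

/-- Fifth power of the logarithm: one factor comes from the number of repetitions, two from the
bound for the work per string, and two from the word length, where the seed of O(log² n) bits
dominates. -/
theorem exists_time_le {ρ : ℝ} (h0 : ρ ≠ 0) (h1 : |ρ| ≤ 1) :
    ∃ C : ℝ, 0 ≤ C ∧ ∀ n : ℕ, 2 ≤ n →
      ((stepBound ρ n * (2 * wordLen ρ n + 2) : ℕ) : ℝ) ≤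
        C * (n * Real.logb 2 n ^ 5) *
          (2 : ℝ) ^ ((H2 (relDist ρ) - relDist ρ) * sampleDim ρ n) := by
  obtain ⟨c, hc, hpar⟩ := exists_param_le h0 h1
  obtain ⟨C₀, hC₀⟩ := exists_repBits_le h0 h1
  refine ⟨1300 * 150 * c ^ 5 * 2 ^ C₀, by positivity, fun n hn => ?_⟩
  obtain ⟨h2, h3, h4, h5, h6, h7⟩ := hpar n hn
  have hl := one_le_logb hn
  have hn1 : (1 : ℝ) ≤ n := by exact_mod_cast (by omega : 1 ≤ n)
  set y := c * Real.logb 2 n with hy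
  have hy1 : 1 ≤ y := by rw [hy]; nlinarith
  have hyy : y ≤ y ^ 2 := by nlinarith
  have hy2 : 1 ≤ y ^ 2 := by nlinarith
  set P : ℝ := 2 ^ repBits ρ n with hP
  have hP1 : 1 ≤ P := one_le_pow₀ (by norm_num)
  have hv : (seedLen ρ n : ℝ) ≤ y ^ 2 := by
    unfold seedLen; push_cast; rw [sq]; gcongr
  have hw : (2 * wordLen ρ n + 2 : ℝ) ≤ 150 * y ^ 2 := by
    unfold wordLen; push_cast; linarith
  have hreps : (reps ρ n : ℝ) ≤ 8 * y * P := by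
    unfold reps; push_cast; gcongr
  have hinner : (seedLen ρ n * 8 + n * (hashLen ρ n * 45 + coords ρ n * 16 + 60) + 16 : ℝ) ≤
      n * (145 * y ^ 2) := by
    have e1 : (hashLen ρ n * 45 + coords ρ n * 16 + 60 : ℝ) ≤ 121 * y ^ 2 := by linarith
    have e2 := mul_le_mul_of_nonneg_left e1 (by linarith : (0 : ℝ) ≤ n)
    have e3 : y ^ 2 ≤ n * y ^ 2 := by nlinarith
    linarith
  have hstep : (stepBound ρ n : ℝ) ≤ 1300 * y ^ 3 * n * P := by
    unfold stepBound
    push_cast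
    have e1 : (reps ρ n : ℝ) *
        (seedLen ρ n * 8 + n * (hashLen ρ n * 45 + coords ρ n * 16 + 60) + 16) ≤
        8 * y * P * (n * (145 * y ^ 2)) := by gcongr
    have e2 : y ≤ y ^ 3 * n * P := by
      have : y ≤ y ^ 3 := by nlinarith
      calc y ≤ y ^ 3 := this
        _ = y ^ 3 * 1 * 1 := by ring
        _ ≤ y ^ 3 * n * P := by gcongr
    have e3 : 8 * y * P * (n * (145 * y ^ 2)) = 1160 * (y ^ 3 * n * P) := by ring
    have e4 : 1300 * y ^ 3 * n * P = 1300 * (y ^ 3 * n * P) := by ring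
    rw [e4]
    linarith
  have hPle : P ≤ 2 ^ C₀ * (2 : ℝ) ^ ((H2 (relDist ρ) - relDist ρ) * sampleDim ρ n) := by
    rw [← Real.rpow_add (by norm_num), hP, ← Real.rpow_natCast]
    refine Real.rpow_le_rpow_of_exponent_le (by norm_num) ?_
    have := hC₀ n hn
    linarith
  push_cast
  calc (stepBound ρ n : ℝ) * (2 * wordLen ρ n + 2)
      ≤ (1300 * y ^ 3 * n * P) * (150 * y ^ 2) := by gcongr
    _ = 1300 * 150 * y ^ 5 * n * P := by ring
    _ ≤ 1300 * 150 * y ^ 5 * n *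
        (2 ^ C₀ * (2 : ℝ) ^ ((H2 (relDist ρ) - relDist ρ) * sampleDim ρ n)) := by gcongr
    _ = _ := by rw [hy]; ring

/-- The memory is arbitrary, so the statement serves with and without preprocessing. The strings
only have to be longer than `coords`, which is O(log n). -/
theorem exists_solves {ρ : ℝ} (h0 : ρ ≠ 0) (h1 : |ρ| ≤ 1) :
    ∃ C c : ℝ, 0 ≤ C ∧ ∀ n : ℕ, 2 ≤ n → ∀ N : ℕ, c * Real.logb 2 n ^ 2 ≤ N → ∀ mem : ℕ → ℕ,
      Solves lightBulbProg n N ρ mem (C * (n * Real.logb 2 n ^ 5) *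
          (2 : ℝ) ^ ((H2 (relDist ρ) - relDist ρ) * sampleDim ρ n)) := by
  obtain ⟨C, hC, htime⟩ := exists_time_le h0 h1
  obtain ⟨c, hc, hpar⟩ := exists_param_le h0 h1
  refine ⟨C, c, hC, fun n hn N hN mem => solves_lightBulbProg hn h0 h1 ?_ mem (htime n hn)⟩
  have h2 := (hpar n hn).2.2.1
  have h3 := one_le_logb hn
  have h4 : Real.logb 2 n ≤ Real.logb 2 n ^ 2 := by nlinarith
  have h5 : c * Real.logb 2 n ≤ c * Real.logb 2 n ^ 2 := by gcongr
  exact_mod_cast (h2.trans h5).trans hN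

theorem Solves.mono {Q : Prog} {n N : ℕ} {ρ : ℝ} {mem : ℕ → ℕ} {T T' : ℝ}
    (h : Solves Q n N ρ mem T) (hT : T ≤ T') : Solves Q n N ρ mem T' :=
  ⟨fun X ω => let ⟨s, t, h1, h2⟩ := h.1 X ω; ⟨s, t, h1, h2.trans hT⟩, h.2⟩

/-! ### Gilbert codes -/

/-- The greedy algorithm may pick the elements of `C` in any order: separation keeps the next one
available, and covering leaves nothing at the end. -/
theorem isGilbertCode_of_dist {m d : ℕ} {C : Set (Fin m → Bool)}
    (hsep : ∀ x ∈ C, ∀ y ∈ C, x ≠ y → d < hammingDist x y)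
    (hcov : ∀ y, ∃ x ∈ C, hammingDist x y ≤ d) : IsGilbertCode m d C := by
  classical
  have key : ∀ F : Finset (Fin m → Bool), (F : Set (Fin m → Bool)) ⊆ C →
      GreedyRun m d {y | ∀ x ∈ F, d < hammingDist x y} F := by
    intro F
    induction F using Finset.induction_on with
    | empty =>
      intro _
      simpa using GreedyRun.init
    | insert a F ha ih =>
      intro hF
      rw [Finset.coe_insert, Set.insert_subset_iff] at hF
      have h := GreedyRun.pick a (ih hF.2)
        (fun x hx => hsep x (hF.2 hx) a hF.1 (fun h => ha (h ▸ hx)))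
      rw [Finset.coe_insert]
      convert h using 1
      ext y
      simp only [Set.mem_ofPred_eq, Finset.forall_mem_insert, Set.mem_sdiff, not_le]
      exact and_comm
  have h := key C.toFinite.toFinset (by simp)
  have he : {y | ∀ x ∈ C.toFinite.toFinset, d < hammingDist x y} = ∅ := by
    ext y
    obtain ⟨x, hx, hxy⟩ := hcov y
    simp only [Set.Finite.mem_toFinset, Set.mem_ofPred_eq, Set.mem_empty_iff_false, iff_false]
    intro h
    have := h x hx
    omega
  rw [he, Set.Finite.coe_toFinset] at h
  exact h

/-! ### Vectors as binary numbers -/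

/-- The first `m` binary digits of `x`. -/
def bitVec (m x : ℕ) : Fin m → Bool := fun i => x.testBit i

/-- The Hamming distance of the first `m` binary digits. -/
def natDist (m x y : ℕ) : ℕ := hammingDist (bitVec m x) (bitVec m y)

theorem bitVec_ofBits {m : ℕ} (v : Fin m → Bool) : bitVec m (Nat.ofBits v) = v := by
  funext i
  simp [bitVec, Nat.testBit_ofBits_lt]

theorem ofBits_bitVec {m x : ℕ} (hx : x < 2 ^ m) : Nat.ofBits (bitVec m x) = x := by
  refine Nat.eq_of_testBit_eq fun i => ?_
  by_cases hi : i < m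
  · rw [Nat.testBit_ofBits_lt _ _ hi]; rfl
  · rw [Nat.testBit_ofBits_ge _ _ (by omega), Nat.testBit_lt_two_pow]
    exact hx.trans_le (Nat.pow_le_pow_right (by norm_num) (by omega))

theorem natDist_self (m x : ℕ) : natDist m x x = 0 := hammingDist_self _

theorem natDist_comm (m x y : ℕ) : natDist m x y = natDist m y x := hammingDist_comm _ _

theorem natDist_triangle (m x y z : ℕ) : natDist m x z ≤ natDist m x y + natDist m y z :=
  hammingDist_triangle _ _ _

theorem natDist_le (m x y : ℕ) : natDist m x y ≤ m := by
  have := hammingDist_le_card_fintype (x := bitVec m x) (y := bitVec m y)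
  rwa [Fintype.card_fin] at this

theorem natDist_xor_right (m x y z : ℕ) : natDist m (x ^^^ z) (y ^^^ z) = natDist m x y := by
  unfold natDist hammingDist bitVec
  congr 1
  ext i
  simp

theorem natDist_xor_comm (m x y z : ℕ) : natDist m (x ^^^ z) y = natDist m x (y ^^^ z) := by
  have h := natDist_xor_right m (x ^^^ z) y z
  rw [Nat.xor_assoc, Nat.xor_self, Nat.xor_zero] at h
  exact h.symm

theorem natDist_flip_le (m b x : ℕ) : natDist m x (x ^^^ 2 ^ b) ≤ 1 := by
  unfold natDist hammingDist bitVec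
  rw [Finset.card_le_one]
  intro i hi j hj
  simp only [ne_eq, Nat.testBit_xor, Nat.testBit_two_pow, Finset.mem_filter, Finset.mem_univ,
    true_and] at hi hj
  have h1 : b = i := by by_contra h; simp [h] at hi
  have h2 : b = j := by by_contra h; simp [h] at hj
  exact Fin.ext (h1.symm.trans h2)

theorem testBit_eq_of_div_eq {x y b : ℕ} (h : x / 2 ^ b = y / 2 ^ b) {i : ℕ} (hi : b ≤ i) :
    x.testBit i = y.testBit i := by
  obtain ⟨j, rfl⟩ := Nat.exists_eq_add_of_le hi
  rw [add_comm, ← Nat.testBit_div_two_pow, ← Nat.testBit_div_two_pow, h]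

/-- As `c` agrees with the flipped vector at bit `b`, it differs from `x` there; the flip removes
this disagreement and creates none. -/
theorem natDist_flip_lt {m b x c : ℕ} (hb : b < m) (h : c / 2 ^ b = (x ^^^ 2 ^ b) / 2 ^ b) :
    natDist m (x ^^^ 2 ^ b) c + 1 ≤ natDist m x c := by
  unfold natDist hammingDist
  refine Finset.card_lt_card (Finset.ssubset_iff_of_subset ?_ |>.2 ⟨⟨b, hb⟩, ?_, ?_⟩)
  · intro i hi
    simp only [ne_eq, Finset.mem_filter, Finset.mem_univ, true_and] at hi ⊢
    change ¬ (x ^^^ 2 ^ b).testBit i = c.testBit i at hi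
    change ¬ x.testBit i = c.testBit i
    rcases le_or_gt b i with hbi | hbi
    · exact absurd (testBit_eq_of_div_eq h.symm hbi) hi
    · rw [Nat.testBit_xor, Nat.testBit_two_pow_of_ne (by omega), Bool.xor_false] at hi
      exact hi
  · have := testBit_eq_of_div_eq h le_rfl
    simp only [ne_eq, Finset.mem_filter, Finset.mem_univ, true_and]
    change ¬ x.testBit b = c.testBit b
    rw [this]
    simp
  · have := testBit_eq_of_div_eq h le_rfl
    simp only [ne_eq, Finset.mem_filter, Finset.mem_univ, true_and, not_not]
    exact this.symm

theorem div_eq_or_div_flip_eq {x c b : ℕ} (h : c / 2 ^ (b + 1) = x / 2 ^ (b + 1)) :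
    c / 2 ^ b = x / 2 ^ b ∨ c / 2 ^ b = (x ^^^ 2 ^ b) / 2 ^ b := by
  by_cases hb : c.testBit b = x.testBit b
  · left
    refine Nat.eq_of_testBit_eq fun i => ?_
    rw [Nat.testBit_div_two_pow, Nat.testBit_div_two_pow]
    rcases Nat.eq_zero_or_pos i with rfl | hi
    · simpa using hb
    · exact testBit_eq_of_div_eq h (by omega)
  · right
    refine Nat.eq_of_testBit_eq fun i => ?_
    rw [Nat.testBit_div_two_pow, Nat.testBit_div_two_pow, Nat.testBit_xor]
    rcases Nat.eq_zero_or_pos i with rfl | hi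
    · simp only [zero_add, Nat.testBit_two_pow_self, Bool.xor_true]
      cases h1 : c.testBit b <;> cases h2 : x.testBit b <;> simp_all
    · rw [Nat.testBit_two_pow_of_ne (by omega), Bool.xor_false]
      exact testBit_eq_of_div_eq h (by omega)

/-! ### Linear codes, dimension by dimension -/

/-- `C` is closed under sums modulo two, consists of numbers below `2 ^ k` with weight more than `d`
(except `0`), and comes within distance `d` of all numbers below `2 ^ k`. -/
structure IsPartialCode (m d k : ℕ) (C : Set ℕ) : Prop where
  zero_mem : 0 ∈ C
  xor_mem : ∀ x ∈ C, ∀ y ∈ C, x ^^^ y ∈ C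
  lt : ∀ x ∈ C, x < 2 ^ k
  weight : ∀ x ∈ C, x ≠ 0 → d < natDist m x 0
  cover : ∀ y < 2 ^ k, ∃ x ∈ C, natDist m y x ≤ d

theorem isPartialCode_zero (m d : ℕ) : IsPartialCode m d 0 {0} where
  zero_mem := rfl
  xor_mem := by rintro x rfl y rfl; rfl
  lt := by rintro x rfl; simp
  weight := by rintro x rfl h; exact absurd rfl h
  cover := by
    intro y hy
    refine ⟨0, rfl, ?_⟩
    rw [pow_zero, Nat.lt_one_iff] at hy
    rw [hy, natDist_self]
    exact Nat.zero_le _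

theorem IsPartialCode.succ_of_cover {m d k : ℕ} {C : Set ℕ} (h : IsPartialCode m d k C)
    (hc : ∀ y < 2 ^ k, ∃ x ∈ C, natDist m (2 ^ k + y) x ≤ d) : IsPartialCode m d (k + 1) C where
  zero_mem := h.zero_mem
  xor_mem := h.xor_mem
  lt := fun x hx => (h.lt x hx).trans (Nat.pow_lt_pow_right (by norm_num) (by omega))
  weight := h.weight
  cover := by
    intro y hy
    rcases lt_or_ge y (2 ^ k) with h1 | h1
    · exact h.cover y h1
    · obtain ⟨z, rfl⟩ := Nat.exists_eq_add_of_le h1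
      exact hc z (by rw [pow_succ] at hy; omega)

theorem xor_lt_two_pow_of_ge {k x y : ℕ} (hx : 2 ^ k ≤ x) (hx' : x < 2 ^ (k + 1))
    (hy : 2 ^ k ≤ y) (hy' : y < 2 ^ (k + 1)) : x ^^^ y < 2 ^ k := by
  have e1 : x / 2 ^ k = 1 := Nat.div_eq_of_lt_le (by omega) (by rw [pow_succ] at hx'; omega)
  have e2 : y / 2 ^ k = 1 := Nat.div_eq_of_lt_le (by omega) (by rw [pow_succ] at hy'; omega)
  have e3 : (x ^^^ y) / 2 ^ k = 0 := by
    rw [Nat.xor_div_two_pow, e1, e2]; rfl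
  exact (Nat.div_eq_zero_iff_lt (by positivity)).1 e3

theorem le_xor_of_ge {k x y : ℕ} (hx : x < 2 ^ k) (hy : 2 ^ k ≤ y) : 2 ^ k ≤ x ^^^ y := by
  have e3 : (x ^^^ y) / 2 ^ k = y / 2 ^ k := by
    rw [Nat.xor_div_two_pow, Nat.div_eq_of_lt hx, Nat.zero_xor]
  have e2 : 1 ≤ y / 2 ^ k := (Nat.one_le_div_iff (by positivity)).2 hy
  rw [← e3] at e2
  exact (Nat.one_le_div_iff (by positivity)).1 e2

/-- Translation by `v` carries the upper half of the numbers below `2 ^ (k + 1)` into the lower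
half, which `C` covers, so one generator settles the whole dimension. The weights in the new coset
are the distances of `v` from `C`. -/
theorem IsPartialCode.succ_of_far {m d k v : ℕ} {C : Set ℕ} (h : IsPartialCode m d k C)
    (hv : 2 ^ k ≤ v) (hv' : v < 2 ^ (k + 1)) (hfar : ∀ x ∈ C, d < natDist m v x) :
    IsPartialCode m d (k + 1) {x | x ∈ C ∨ x ^^^ v ∈ C} where
  zero_mem := Or.inl h.zero_mem
  xor_mem := by
    rintro x (hx | hx) y (hy | hy)
    · exact Or.inl (h.xor_mem x hx y hy)
    · right
      rw [Nat.xor_assoc]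
      exact h.xor_mem x hx _ hy
    · right
      rw [Nat.xor_assoc, Nat.xor_comm y v, ← Nat.xor_assoc]
      exact h.xor_mem _ hx _ hy
    · left
      have := h.xor_mem _ hx _ hy
      rwa [Nat.xor_comm y v, ← Nat.xor_assoc, Nat.xor_assoc x v v, Nat.xor_self, Nat.xor_zero]
        at this
  lt := by
    rintro x (hx | hx)
    · exact (h.lt x hx).trans (Nat.pow_lt_pow_right (by norm_num) (by omega))
    · have h1 := (h.lt _ hx).trans (Nat.pow_lt_pow_right (by norm_num) (Nat.lt_succ_self k))
      have h2 := Nat.xor_lt_two_pow h1 hv'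
      rwa [Nat.xor_assoc, Nat.xor_self, Nat.xor_zero] at h2
  weight := by
    rintro x (hx | hx) h0
    · exact h.weight x hx h0
    · have := hfar _ hx
      rwa [natDist_comm, natDist_xor_comm, Nat.xor_self] at this
  cover := by
    intro y hy
    rcases lt_or_ge y (2 ^ k) with h1 | h1
    · obtain ⟨x, hx, hxy⟩ := h.cover y h1
      exact ⟨x, Or.inl hx, hxy⟩
    · obtain ⟨x, hx, hxy⟩ := h.cover (y ^^^ v) (xor_lt_two_pow_of_ge h1 hy hv hv')
      refine ⟨x ^^^ v, Or.inr ?_, ?_⟩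
      · rwa [Nat.xor_assoc, Nat.xor_self, Nat.xor_zero]
      · rwa [← natDist_xor_comm]

theorem IsPartialCode.isGilbertCode {m d : ℕ} {C : Set ℕ} (h : IsPartialCode m d m C) :
    IsGilbertCode m d {v | Nat.ofBits v ∈ C} := by
  refine isGilbertCode_of_dist ?_ ?_
  · intro x hx y hy hne
    have h1 := h.weight _ (h.xor_mem _ hx _ hy) (fun h0 => hne ?_)
    · rwa [natDist_xor_comm, Nat.zero_xor, natDist, bitVec_ofBits, bitVec_ofBits] at h1
    · rw [Nat.xor_eq_zero_iff] at h0
      rw [← bitVec_ofBits x, h0, bitVec_ofBits]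
  · intro y
    obtain ⟨x, hx, hxy⟩ := h.cover (Nat.ofBits y) (Nat.ofBits_lt_two_pow _)
    refine ⟨bitVec m x, ?_, ?_⟩
    · rw [Set.mem_ofPred_eq, ofBits_bitVec (h.lt x hx)]; exact hx
    · rwa [natDist, bitVec_ofBits, hammingDist_comm] at hxy

/-- A table of nearest codewords, cut off at half the minimum distance, is a decoding table. -/
theorem IsPartialCode.holdsDecodingTable {m d : ℕ} {C : Set ℕ} (h : IsPartialCode m d m C)
    {mem : ℕ → ℕ}
    (hnear : ∀ x < 2 ^ m, mem (mem 0 + x) = 0 →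
      ∀ w ∈ C, ¬ 2 * natDist m x w + 1 ≤ d)
    (hfound : ∀ x < 2 ^ m, ∀ w, mem (mem 0 + x) = w + 1 →
      w ∈ C ∧ 2 * natDist m x w + 1 ≤ d) :
    HoldsDecodingTable m d {v | Nat.ofBits v ∈ C} mem := by
  intro x
  have hx := Nat.ofBits_lt_two_pow x
  have hdist : ∀ w : Fin m → Bool,
      natDist m (Nat.ofBits x) (Nat.ofBits w) = hammingDist x w := fun w => by
    rw [natDist, bitVec_ofBits, bitVec_ofBits]
  constructor
  · intro w hw hd
    rw [← hdist] at hd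
    rcases hmem : mem (mem 0 + Nat.ofBits x) with _ | w'
    · exact absurd hd (hnear _ hx hmem _ hw)
    · obtain ⟨h1, h2⟩ := hfound _ hx _ hmem
      by_contra hne
      -- Two codewords this close to `x` would be at distance less than `d`, whereas distinct
      -- codewords are more than `d` apart.
      have h3 := h.weight _ (h.xor_mem _ h1 _ hw) (fun h0 => hne ?_)
      · rw [natDist_xor_comm, Nat.zero_xor] at h3
        have h4 := natDist_triangle m w' (Nat.ofBits x) (Nat.ofBits w)
        rw [natDist_comm m w' (Nat.ofBits x)] at h4
        omega
      · rw [Nat.xor_eq_zero_iff] at h0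
        rw [h0]
  · intro hno
    rcases hmem : mem (mem 0 + Nat.ofBits x) with _ | w'
    · rfl
    · obtain ⟨h1, h2⟩ := hfound _ hx _ hmem
      refine absurd ?_ (hno (bitVec m w') ?_)
      · rwa [← hdist, ofBits_bitVec (h.lt _ h1)]
      · rw [Set.mem_ofPred_eq, ofBits_bitVec (h.lt _ h1)]; exact h1

/-! ### Subroutines of the preprocessing -/

/-- The recursion by which the machine, having no bitwise operations, adds modulo two. -/
theorem xor_eq_two_mul_add (a b : ℕ) :
    a ^^^ b = 2 * (a / 2 ^^^ b / 2) +
      ((b - 2 * (b / 2)) - (a - 2 * (a / 2)) + ((a - 2 * (a / 2)) - (b - 2 * (b / 2)))) := by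
  have h1 : (a ^^^ b) / 2 = a / 2 ^^^ b / 2 := by
    simpa using Nat.xor_div_two_pow (a := a) (b := b) (n := 1)
  have h2 : (a ^^^ b) % 2 = (a + b) % 2 := Nat.xor_mod_two_eq
  rw [← h1]
  omega

/-- Put the bitwise sum modulo two of `reg 30` and `reg 31`, numbers of at most `reg 2` bits,
into `reg 32`. -/
def xorProg : Prog :=
  .seq (block [.const 32 0, .const 35 1, .const 36 2, .const 39 0, .add 33 2 39]) <|
  forDown 33 34 <| block
    [.div 37 30 36, .add 38 37 37, .sub 38 30 38, .add 30 37 39,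
     .div 40 31 36, .add 41 40 40, .sub 41 31 41, .add 31 40 39,
     .sub 42 41 38, .sub 43 38 41, .add 42 42 43, .mul 42 42 35, .add 32 32 42, .add 35 35 35]

theorem runs_xorProg {e : Env} {B : ℕ} (he : |e.corr| ≤ 1) {s : State}
    (hs : Bounded B s) {m : ℕ} (hm : s.reg 2 = m) (hmB : m + 2 ≤ B) (ha : s.reg 30 < 2 ^ m)
    (hb : s.reg 31 < 2 ^ m) :
    Runs e B xorProg s (m * 19 + 7) (fun s' =>
      s'.reg 32 = s.reg 30 ^^^ s.reg 31 ∧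
      (∀ r < 30, s'.reg r = s.reg r) ∧ s'.mem = s.mem ∧ s'.used = s.used) := by
  have hB : 1 ≤ B := by omega
  have h2 := hs 2
  have hp : 4 * 2 ^ m ≤ 2 ^ B := by
    rw [show 4 * 2 ^ m = 2 ^ (m + 2) by ring]
    exact Nat.pow_le_pow_right (by norm_num) hmB
  have hm1 : 1 ≤ 2 ^ m := Nat.one_le_two_pow
  have hab : s.reg 30 ^^^ s.reg 31 < 2 ^ m := Nat.xor_lt_two_pow ha hb
  refine (Runs.seq (T := 6) (T' := m * 19 + 1) (Runs.block hB he _ hs ?_ ?_)).mono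
    (by omega) (fun _ _ h => h)
  · simp [BlockSafe, Instr.Safe, Instr.run]; omega
  intro hs1
  refine (Runs.forDown hB he (by decide) (T := 15) (fun i s' =>
      (∀ r < 30, s'.reg r = s.reg r) ∧ s'.mem = s.mem ∧ s'.used = s.used ∧ s'.reg 36 = 2 ∧
      s'.reg 39 = 0 ∧ i ≤ m ∧ s'.reg 35 = 2 ^ (m - i) ∧ s'.reg 30 < 2 ^ i ∧ s'.reg 31 < 2 ^ i ∧
      s'.reg 32 + 2 ^ (m - i) * (s'.reg 30 ^^^ s'.reg 31) = s.reg 30 ^^^ s.reg 31)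
      m ?_ hs1 ?_ ?_).mono le_rfl ?_
  · rintro i hi s' hs' hri - ⟨s₀, ⟨hfr, hmem, hu, h36, h39, -, h35, h30, h31, hx32⟩, hm', hu', hx⟩
    have hfr' : ∀ r < 30, s'.reg r = s.reg r := fun r hr => by
      rw [hx r (by omega) (by omega), hfr r hr]
    rw [← hx 36 (by decide) (by decide)] at h36
    rw [← hx 39 (by decide) (by decide)] at h39
    rw [← hx 35 (by decide) (by decide)] at h35
    rw [← hx 30 (by decide) (by decide)] at h30 hx32
    rw [← hx 31 (by decide) (by decide)] at h31 hx32
    rw [← hx 32 (by decide) (by decide)] at hx32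
    have hxe := xor_eq_two_mul_add (s'.reg 30) (s'.reg 31)
    have hpow : 2 ^ (m - i) = 2 * 2 ^ (m - (i + 1)) := by
      rw [← pow_succ']; congr 1; omega
    have hple : 2 ^ (m - i) ≤ 2 ^ m := Nat.pow_le_pow_right (by norm_num) (by omega)
    have h2i : 2 ^ (i + 1) = 2 * 2 ^ i := by ring
    have k30 := hs' 30
    have k31 := hs' 31
    set a := s'.reg 30 with hadef
    set b := s'.reg 31 with hbdef
    set t := (b - 2 * (b / 2)) - (a - 2 * (a / 2)) + ((a - 2 * (a / 2)) - (b - 2 * (b / 2)))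
      with ht
    have ht1 : t ≤ 1 := by omega
    set P := 2 ^ (m - (i + 1)) with hP
    have htP : t * P ≤ P := by nlinarith
    have hnew : s'.reg 32 + t * P + 2 ^ (m - i) * (a / 2 ^^^ b / 2) =
        s.reg 30 ^^^ s.reg 31 := by
      rw [← hx32, hxe, hpow]; ring
    clear_value t P
    refine Runs.block hB he _ hs' ?_ ?_
    · simp [BlockSafe, Instr.Safe, Instr.run, h36, h39, h35, ← hadef, ← hbdef, ← two_mul, ← ht]
      omega
    · simp only [runBlock, Instr.run, State.reg_setReg, State.mem_setReg, State.used_setReg]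
      simp [h36, h39, h35, ← hadef, ← hbdef, ← two_mul, ← ht, hri]
      refine ⟨fun r hr => ?_, by rw [hm', hmem], by rw [hu', hu], by omega, by omega, by omega,
        by omega, ?_⟩
      · simp [hfr' r hr, show r ≠ 30 by omega, show r ≠ 31 by omega, show r ≠ 32 by omega,
          show r ≠ 35 by omega, show r ≠ 37 by omega, show r ≠ 38 by omega, show r ≠ 40 by omega,
          show r ≠ 41 by omega, show r ≠ 42 by omega, show r ≠ 43 by omega]
      · exact hnew
  · simp [runBlock, Instr.run, hm]
  · simp [runBlock, Instr.run]
    refine ⟨fun r hr => ?_, ha, hb⟩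
    simp [show r ≠ 32 by omega,
          show r ≠ 35 by omega, show r ≠ 36 by omega, show r ≠ 39 by omega, show r ≠ 33 by omega]
  · rintro s' hs' ⟨⟨hfr, hmem, hu, h36, h39, -, h35, h30, h31, hx32⟩, -⟩
    refine ⟨?_, hfr, hmem, hu⟩
    rw [pow_zero, Nat.lt_one_iff] at h30 h31
    rw [← hx32, h30, h31]
    simp

/-! ### The distance transform -/

/-- Cells `3 * W + x` with `x < W` hold the indicator function of `C`. -/
def HoldsCode (W : ℕ) (C : Set ℕ) (mem : ℕ → ℕ) : Prop :=
  ∀ x < W, (x ∈ C → mem (3 * W + x) = 1) ∧ (x ∉ C → mem (3 * W + x) = 0)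

/-- Cells `W + x` and `2 * W + x` hold a codeword (increased by one) and an upper bound for its
distance from `x`, unless this bound is `m + 1`. -/
def NearAt (m W : ℕ) (C : Set ℕ) (mem : ℕ → ℕ) (x : ℕ) : Prop :=
  mem (2 * W + x) ≤ m + 1 ∧ mem (W + x) ≤ W ∧
    (mem (2 * W + x) ≤ m → ∃ w ∈ C, mem (W + x) = w + 1 ∧ natDist m x w ≤ mem (2 * W + x))

/-- Write the codewords into their own cells, with distance `0`; the other cells receive the
distance `m + 1`. -/
def initProg : Prog :=
  .seq (block [.const 29 0, .add 20 3 29]) <| forDown 20 21 <| block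
    [.add 22 3 20, .add 23 22 3, .add 24 23 3, .load 25 24,
     .add 26 20 21, .mul 26 26 25, .store 22 26, .sub 27 21 25, .add 28 2 21, .mul 28 28 27,
     .store 23 28]

theorem runs_initProg {e : Env} {B : ℕ} (he : |e.corr| ≤ 1) {s : State}
    (hs : Bounded B s) {m W : ℕ} (hW : 2 ^ m = W) (h2 : s.reg 2 = m) (h3 : s.reg 3 = W)
    (hmB : m + 2 ≤ B) {C : Set ℕ} (hC : HoldsCode W C s.mem) :
    Runs e B initProg s (W * 16 + 4) (fun s' =>
      (∀ r < 20, s'.reg r = s.reg r) ∧ HoldsCode W C s'.mem ∧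
      ∀ x < W, NearAt m W C s'.mem x ∧ (x ∈ C → s'.mem (2 * W + x) = 0)) := by
  have hB : 1 ≤ B := by omega
  have hp : 4 * W ≤ 2 ^ B := by
    rw [← hW, show 4 * 2 ^ m = 2 ^ (m + 2) by ring]
    exact Nat.pow_le_pow_right (by norm_num) hmB
  have hmW : m < W := hW ▸ Nat.lt_two_pow_self
  refine (Runs.seq (T := 3) (T' := W * 16 + 1) (Runs.block hB he _ hs ?_ ?_)).mono
    (by omega) (fun _ _ h => h)
  · simp [BlockSafe, Instr.Safe, Instr.run]; omega
  intro hs1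
  refine (Runs.forDown hB he (by decide) (T := 12) (fun i s' =>
      (∀ r < 20, s'.reg r = s.reg r) ∧ HoldsCode W C s'.mem ∧
      ∀ x < W, i ≤ x → NearAt m W C s'.mem x ∧ (x ∈ C → s'.mem (2 * W + x) = 0))
      W ?_ hs1 ?_ ?_).mono le_rfl ?_
  · rintro i hi s' hs' hri h21 ⟨s₀, ⟨hfr, hcode, hnear⟩, hm', -, hx⟩
    have hfr' : ∀ r < 20, s'.reg r = s.reg r := fun r hr => by
      rw [hx r (by omega) (by omega), hfr r hr]
    rw [← hm'] at hcode hnear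
    have e2 : s'.reg 2 = m := by rw [hfr' 2 (by omega), h2]
    have e3 : s'.reg 3 = W := by rw [hfr' 3 (by omega), h3]
    -- Multiplication by the membership bit `c` and by `1 - c` selects the entries `(i + 1, 0)` or
    -- `(0, m + 1)` without branching.
    obtain ⟨c, hc, hcC, hcN⟩ : ∃ c ≤ 1, (i ∈ C → c = 1) ∧ (i ∉ C → c = 0) ∧
        s'.mem (3 * W + i) = c := by
      by_cases h : i ∈ C
      · exact ⟨1, le_rfl, fun _ => rfl, fun g => absurd h g, (hcode i hi).1 h⟩
      · exact ⟨0, by omega, fun g => absurd g h, fun _ => rfl, (hcode i hi).2 h⟩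
    obtain ⟨hcN, hcm⟩ := hcN
    have a1 : W + i + W = 2 * W + i := by ring
    have a2 : 2 * W + i + W = 3 * W + i := by ring
    have b1 : (i + 1) * c ≤ i + 1 := by nlinarith
    have b2 : (m + 1) * (1 - c) ≤ m + 1 := by
      have : 1 - c ≤ 1 := by omega
      nlinarith
    refine Runs.block hB he _ hs' ?_ ?_
    · simp [BlockSafe, Instr.Safe, Instr.run, hri, h21, e2, e3, a1, a2, hcm]
      omega
    · generalize hd : runBlock e _ s' = s2
      have hfr2 : ∀ r < 20, s2.reg r = s.reg r := fun r hr => by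
        simp [← hd, runBlock, Instr.run, hfr' r hr, show r ≠ 22 by omega, show r ≠ 23 by omega,
          show r ≠ 24 by omega, show r ≠ 25 by omega, show r ≠ 26 by omega, show r ≠ 27 by omega,
          show r ≠ 28 by omega]
      have hreg : s2.reg 20 = i := by simp [← hd, runBlock, Instr.run, hri]
      have hmem2 : s2.mem = Function.update (Function.update s'.mem (W + i) ((i + 1) * c))
          (2 * W + i) ((m + 1) * (1 - c)) := by
        simp [← hd, runBlock, Instr.run, hri, h21, e2, e3, a1, a2, hcm]
      clear hd
      have hoff : ∀ a, a ≠ W + i → a ≠ 2 * W + i → s2.mem a = s'.mem a := fun a g g' => by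
        rw [hmem2, Function.update_of_ne g', Function.update_of_ne g]
      have hT : s2.mem (W + i) = (i + 1) * c := by
        rw [hmem2, Function.update_of_ne (by omega), Function.update_self]
      have hU : s2.mem (2 * W + i) = (m + 1) * (1 - c) := by
        rw [hmem2, Function.update_self]
      refine ⟨⟨hfr2, fun x hx => ?_, fun x hxW hix => ?_⟩, hreg⟩
      · rw [hoff _ (by omega) (by omega)]; exact hcode x hx
      · rcases eq_or_lt_of_le hix with rfl | hlt
        · by_cases h : i ∈ C
          · have := hcC h
            subst this
            refine ⟨⟨by omega, by omega, fun _ => ⟨i, h, by omega, ?_⟩⟩, fun _ => by omega⟩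
            rw [natDist_self]; exact Nat.zero_le _
          · have := hcN h
            subst this
            exact ⟨⟨by omega, by omega, fun _ => by omega⟩, fun g => absurd g h⟩
        · obtain ⟨g1, g2⟩ := hnear x hxW hlt
          unfold NearAt at g1 ⊢
          rw [hoff _ (by omega) (by omega), hoff _ (by omega) (by omega)]
          exact ⟨g1, g2⟩
  · simp [runBlock, Instr.run, h3]
  · refine ⟨fun r hr => ?_, ?_, fun x h h' => absurd h (by omega)⟩
    · simp [runBlock, Instr.run, show r ≠ 29 by omega, show r ≠ 20 by omega]
    · simpa [runBlock, Instr.run] using hC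
  · rintro s' hs' ⟨⟨hfr, hcode, hnear⟩, -⟩
    exact ⟨hfr, hcode, fun x hx => hnear x hx (Nat.zero_le _)⟩

/-- Improve the entry for `reg 20` by the entry for the neighbour which differs in the bit given by
`reg 19`. -/
def relaxProg : Prog :=
  .seq (block [.const 29 0, .add 30 20 29, .add 31 19 29]) <|
  .seq xorProg <|
  .seq (block [.const 29 1, .add 22 3 20, .add 23 22 3, .add 24 3 32, .add 25 24 3,
    .load 26 25, .add 26 26 29, .load 27 23, .sub 28 27 26]) <|
  .ite 28 (block [.load 27 24, .store 22 27, .store 23 26]) .skip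

/-- Neighbours in the cube are at distance one, so the neighbour's codeword with its bound increased
by one is also valid for `x`. -/
theorem runs_relaxProg {e : Env} {B : ℕ} (he : |e.corr| ≤ 1) {s : State}
    (hs : Bounded B s) {m W b x : ℕ} (hW : 2 ^ m = W) (h2 : s.reg 2 = m) (h3 : s.reg 3 = W)
    (hmB : m + 3 ≤ B) (h19 : s.reg 19 = 2 ^ b) (hb : b < m) (h20 : s.reg 20 = x) (hx : x < W)
    {C : Set ℕ} (hN : ∀ y < W, NearAt m W C s.mem y) :
    Runs e B relaxProg s (m * 19 + 26) (fun s' =>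
      (∀ r < 22, s'.reg r = s.reg r) ∧
      (∀ a, a ≠ W + x → a ≠ 2 * W + x → s'.mem a = s.mem a) ∧ NearAt m W C s'.mem x ∧
      s'.mem (2 * W + x) ≤ s.mem (2 * W + x) ∧
      s'.mem (2 * W + x) ≤ s.mem (2 * W + (x ^^^ 2 ^ b)) + 1) := by
  have hB : 1 ≤ B := by omega
  have hp : 8 * W ≤ 2 ^ B := by
    rw [← hW, show 8 * 2 ^ m = 2 ^ (m + 3) by ring]
    exact Nat.pow_le_pow_right (by norm_num) hmB
  have hmW : m < W := hW ▸ Nat.lt_two_pow_self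
  have hbW : 2 ^ b < W := hW ▸ Nat.pow_lt_pow_right (by norm_num) hb
  have hyW : x ^^^ 2 ^ b < W := by
    rw [← hW] at hx hbW ⊢
    exact Nat.xor_lt_two_pow hx hbW
  set y := x ^^^ 2 ^ b with hy
  obtain ⟨nx1, nx2, nx3⟩ := hN x hx
  obtain ⟨ny1, ny2, ny3⟩ := hN y hyW
  have hself : NearAt m W C s.mem x := hN x hx
  refine (Runs.seq (T := 4) (T' := m * 19 + 22) (Runs.block hB he _ hs ?_ ?_)).mono
    (by omega) (fun _ _ h => h)
  · simp [BlockSafe, Instr.Safe, Instr.run, h19, h20]; omega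
  intro hs1
  generalize hd : runBlock e _ s = s1 at hs1 ⊢
  have f1 : ∀ r < 22, s1.reg r = s.reg r := fun r hr => by
    simp [← hd, runBlock, Instr.run, show r ≠ 29 by omega, show r ≠ 30 by omega,
      show r ≠ 31 by omega]
  have m1 : s1.mem = s.mem := by simp [← hd, runBlock, Instr.run]
  have g30 : s1.reg 30 = x := by simp [← hd, runBlock, Instr.run, h20]
  have g31 : s1.reg 31 = 2 ^ b := by simp [← hd, runBlock, Instr.run, h19]
  clear hd
  refine (Runs.seq (T := m * 19 + 7) (T' := 15) ?_).mono (by omega) (fun _ _ h => h)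
  refine (runs_xorProg he hs1 (m := m) (by rw [f1 2 (by omega), h2]) (by omega)
    (by rw [g30, hW]; exact hx) (by rw [g31, hW]; exact hbW)).mono le_rfl ?_
  rintro s2 - ⟨g32, f2, m2, -⟩ hs2
  rw [g30, g31, ← hy] at g32
  rw [m1] at m2
  have f2' : ∀ r < 22, s2.reg r = s.reg r := fun r hr => by rw [f2 r (by omega), f1 r hr]
  have e3 : s2.reg 3 = W := by rw [f2' 3 (by omega), h3]
  have e20 : s2.reg 20 = x := by rw [f2' 20 (by omega), h20]
  have a1 : W + x + W = 2 * W + x := by ring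
  have a2 : W + y + W = 2 * W + y := by ring
  refine (Runs.seq (T := 10) (T' := 5) (Runs.block hB he _ hs2 ?_ ?_)).mono
    (by omega) (fun _ _ h => h)
  · simp [BlockSafe, Instr.Safe, Instr.run, e3, e20, g32, a1, a2, m2]; omega
  intro hs3
  generalize hd : runBlock e _ s2 = s3 at hs3 ⊢
  have f3 : ∀ r < 22, s3.reg r = s.reg r := fun r hr => by
    simp [← hd, runBlock, Instr.run, f2' r hr, show r ≠ 29 by omega, show r ≠ 22 by omega,
      show r ≠ 23 by omega, show r ≠ 24 by omega, show r ≠ 25 by omega, show r ≠ 26 by omega,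
      show r ≠ 27 by omega, show r ≠ 28 by omega]
  have m3 : s3.mem = s.mem := by simp [← hd, runBlock, Instr.run, m2]
  have g22 : s3.reg 22 = W + x := by simp [← hd, runBlock, Instr.run, e3, e20]
  have g23 : s3.reg 23 = 2 * W + x := by simp [← hd, runBlock, Instr.run, e3, e20, a1]
  have g24 : s3.reg 24 = W + y := by simp [← hd, runBlock, Instr.run, e3, g32]
  have g26 : s3.reg 26 = s.mem (2 * W + y) + 1 := by
    simp [← hd, runBlock, Instr.run, e3, g32, a2, m2]
  have g28 : s3.reg 28 = s.mem (2 * W + x) - (s.mem (2 * W + y) + 1) := by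
    simp [← hd, runBlock, Instr.run, e3, e20, g32, a1, a2, m2]
  clear hd
  refine Runs.ite hs3 (T := 4) ?_ ?_
  · rw [g28]
    intro hlt
    refine Runs.block hB he _ hs3 ?_ ?_
    · simp [BlockSafe, Instr.Safe, Instr.run, g24, m3]; omega
    generalize hd : runBlock e _ s3 = s4
    have f4 : ∀ r < 22, s4.reg r = s.reg r := fun r hr => by
      simp [← hd, runBlock, Instr.run, f3 r hr, show r ≠ 27 by omega]
    have m4 : s4.mem = Function.update (Function.update s.mem (W + x) (s.mem (W + y)))
        (2 * W + x) (s.mem (2 * W + y) + 1) := by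
      simp [← hd, runBlock, Instr.run, g22, g23, g24, g26, m3]
    clear hd
    have hT : s4.mem (W + x) = s.mem (W + y) := by
      rw [m4, Function.update_of_ne (by omega), Function.update_self]
    have hU : s4.mem (2 * W + x) = s.mem (2 * W + y) + 1 := by rw [m4, Function.update_self]
    refine ⟨f4, fun a g g' => by rw [m4, Function.update_of_ne g', Function.update_of_ne g],
      ⟨by omega, by omega, fun _ => ?_⟩, by omega, by omega⟩
    -- The replaced entry was at most `m + 1`, so the smaller entry of the neighbour is at most `m`
    -- and names an actual codeword.
    obtain ⟨w, hw, hw1, hw2⟩ := ny3 (by omega)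
    refine ⟨w, hw, by rw [hT, hw1], ?_⟩
    have t1 := natDist_triangle m x y w
    have t2 := natDist_flip_le m b x
    rw [← hy] at t2
    omega
  · rw [g28]
    intro hle
    refine (Runs.skip hs3 ?_).mono (by omega) (fun _ _ h => h)
    rw [m3]
    exact ⟨f3, fun _ _ _ => rfl, hself, le_rfl, by omega⟩

/-- For each `x < W`, write the codeword nearest to `x`, increased by one, into cell `W + x` and its
distance from `x` into cell `2 * W + x`. Here `W = 2 ^ reg 2` is in `reg 3`. -/
def fillProg : Prog :=
  .seq initProg <|
  .seq (block [.const 29 0, .const 19 1, .add 18 2 29]) <|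
  forDown 18 21 <|
    .seq (block [.const 29 0, .add 20 3 29]) <|
    .seq (forDown 20 21 relaxProg) <|
    block [.add 19 19 19]

/-- Once the bits below `b` are treated, the entry of `x` is at most its distance from every
codeword that agrees with `x` in the bits from `b` on. After `m` sweeps this condition is void, and
the entries are exact as far as needed. Updating in place is harmless, since entries only decrease
and remain upper bounds. The cost is `m * W` relaxations, rather than a comparison of every vector
with every codeword. -/
theorem runs_fillProg {e : Env} {B : ℕ} (he : |e.corr| ≤ 1) {s : State}
    (hs : Bounded B s) {m W : ℕ} (hW : 2 ^ m = W) (h2 : s.reg 2 = m) (h3 : s.reg 3 = W)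
    (hmB : m + 3 ≤ B) {C : Set ℕ} (hCW : ∀ c ∈ C, c < W) (hC : HoldsCode W C s.mem) :
    Runs e B fillProg s (W * 16 + m * (W * (m * 19 + 30) + 10) + 9) (fun s' =>
      (∀ r < 18, s'.reg r = s.reg r) ∧ HoldsCode W C s'.mem ∧
      ∀ x < W, NearAt m W C s'.mem x ∧ ∀ c ∈ C, s'.mem (2 * W + x) ≤ natDist m x c) := by
  have hB : 1 ≤ B := by omega
  have hp : 8 * W ≤ 2 ^ B := by
    rw [← hW, show 8 * 2 ^ m = 2 ^ (m + 3) by ring]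
    exact Nat.pow_le_pow_right (by norm_num) hmB
  have hmW : m < W := hW ▸ Nat.lt_two_pow_self
  refine (Runs.seq (T := W * 16 + 4) (T' := m * (W * (m * 19 + 30) + 10) + 5) ?_).mono
    (by omega) (fun _ _ h => h)
  refine (runs_initProg he hs hW h2 h3 (by omega) hC).mono le_rfl ?_
  rintro s1 - ⟨f1, hC1, hN1⟩ hs1
  have k2 : s1.reg 2 = m := by rw [f1 2 (by omega), h2]
  refine (Runs.seq (T := 4) (T' := m * (W * (m * 19 + 30) + 10) + 1)
    (Runs.block hB he _ hs1 ?_ ?_)).mono (by omega) (fun _ _ h => h)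
  · simp [BlockSafe, Instr.Safe, Instr.run, k2]; omega
  intro hs2
  generalize hd : runBlock e _ s1 = s2 at hs2 ⊢
  have f2 : ∀ r < 18, s2.reg r = s.reg r := fun r hr => by
    simp [← hd, runBlock, Instr.run, f1 r (by omega), show r ≠ 29 by omega, show r ≠ 19 by omega,
      show r ≠ 18 by omega]
  have m2 : s2.mem = s1.mem := by simp [← hd, runBlock, Instr.run]
  have g19 : s2.reg 19 = 1 := by simp [← hd, runBlock, Instr.run]
  have g18 : s2.reg 18 = m := by simp [← hd, runBlock, Instr.run, k2]
  clear hd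
  refine (Runs.forDown hB he (by decide) (T := W * (m * 19 + 30) + 6) (fun i s' => i ≤ m ∧
      (∀ r < 18, s'.reg r = s.reg r) ∧ HoldsCode W C s'.mem ∧ s'.reg 19 = 2 ^ (m - i) ∧
      (∀ x < W, NearAt m W C s'.mem x) ∧
      ∀ x < W, ∀ c ∈ C, c / 2 ^ (m - i) = x / 2 ^ (m - i) → s'.mem (2 * W + x) ≤ natDist m x c)
      m ?_ hs2 g18 ?_).mono le_rfl ?_
  · rintro i hi s' hs' hri - ⟨s₀, ⟨-, hfr, hcode, h19, hnear, hbd⟩, hm', -, hx⟩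
    have hfr' : ∀ r < 18, s'.reg r = s.reg r := fun r hr => by
      rw [hx r (by omega) (by omega), hfr r hr]
    rw [← hm'] at hcode hnear hbd
    rw [← hx 19 (by decide) (by decide)] at h19
    obtain ⟨b, hb⟩ : ∃ b, m - (i + 1) = b := ⟨_, rfl⟩
    rw [hb] at h19 hbd
    rw [show m - i = b + 1 by omega]
    have hbm : b < m := by omega
    have e3 : s'.reg 3 = W := by rw [hfr' 3 (by omega), h3]
    refine (Runs.seq (T := 3) (T' := W * (m * 19 + 30) + 3)
      (Runs.block hB he _ hs' ?_ ?_)).mono (by omega) (fun _ _ h => h)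
    · simp [BlockSafe, Instr.Safe, Instr.run, e3]; omega
    intro hs4
    generalize hd : runBlock e _ s' = s4 at hs4 ⊢
    have f4 : ∀ r < 20, s4.reg r = s'.reg r := fun r hr => by
      simp [← hd, runBlock, Instr.run, show r ≠ 29 by omega, show r ≠ 20 by omega]
    have m4 : s4.mem = s'.mem := by simp [← hd, runBlock, Instr.run]
    have g20 : s4.reg 20 = W := by simp [← hd, runBlock, Instr.run, e3]
    clear hd
    refine (Runs.seq (T := W * (m * 19 + 30) + 1) (T' := 2) ?_).mono (by omega) (fun _ _ h => h)
    refine (Runs.forDown hB he (by decide) (T := m * 19 + 26) (fun j s' =>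
      (∀ r < 20, s'.reg r = s4.reg r) ∧ HoldsCode W C s'.mem ∧
      (∀ x < W, NearAt m W C s'.mem x) ∧
      (∀ x < W, ∀ c ∈ C, c / 2 ^ b = x / 2 ^ b → s'.mem (2 * W + x) ≤ natDist m x c) ∧
      ∀ x < W, j ≤ x → ∀ c ∈ C, c / 2 ^ (b + 1) = x / 2 ^ (b + 1) →
        s'.mem (2 * W + x) ≤ natDist m x c)
      W ?_ hs4 g20 ?_).mono le_rfl ?_
    · rintro j hj t ht hrj - ⟨s₁, ⟨ffr, fcode, fnear, fbd, fnew⟩, ft', -, fx⟩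
      have ffr' : ∀ r < 20, t.reg r = s4.reg r := fun r hr => by
        rw [fx r (by omega) (by omega), ffr r hr]
      rw [← ft'] at fcode fnear fbd fnew
      refine (runs_relaxProg he ht hW (by rw [ffr' 2 (by omega), f4 2 (by omega),
        hfr' 2 (by omega), h2]) (by rw [ffr' 3 (by omega), f4 3 (by omega), e3]) hmB
        (by rw [ffr' 19 (by omega), f4 19 (by omega), h19]) hbm hrj hj fnear).mono le_rfl ?_
      rintro t' - ⟨q1, q2, q3, q4, q5⟩
      have hle : ∀ x < W, t'.mem (2 * W + x) ≤ t.mem (2 * W + x) := fun x hx => by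
        rcases eq_or_ne x j with rfl | hne
        · exact q4
        · rw [q2 _ (by omega) (by omega)]
      refine ⟨⟨fun r hr => by rw [q1 r (by omega), ffr' r hr], fun x hx => ?_, fun x hx => ?_,
        fun x hx c hc h => (hle x hx).trans (fbd x hx c hc h), fun x hx hjx c hc h => ?_⟩,
        by rw [q1 20 (by omega), hrj]⟩
      · rw [q2 _ (by omega) (by omega)]; exact fcode x hx
      · rcases eq_or_ne x j with rfl | hne
        · exact q3
        · have := fnear x hx
          unfold NearAt at this ⊢
          rwa [q2 _ (by omega) (by omega), q2 _ (by omega) (by omega)]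
      · rcases eq_or_lt_of_le hjx with rfl | hlt
        -- If `c` does not agree with `j` at bit `b`, it agrees with the neighbour of `j`, whose
        -- distance from `c` is smaller by one.
        · rcases div_eq_or_div_flip_eq h with h' | h'
          · exact (hle j hx).trans (fbd j hx c hc h')
          · have hy : j ^^^ 2 ^ b < W := by
              rw [← hW] at hx ⊢
              exact Nat.xor_lt_two_pow hx (Nat.pow_lt_pow_right (by norm_num) hbm)
            have w1 := fbd _ hy c hc h'
            have w2 := natDist_flip_lt hbm h'
            omega
        · exact (hle x hx).trans (fnew x hx hlt c hc h)
    · refine ⟨fun r hr => rfl, ?_, ?_, ?_, fun x h h' => absurd h (by omega)⟩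
      · rw [m4]; exact hcode
      · rw [m4]; exact hnear
      · rw [m4]; exact hbd
    · rintro s5 - ⟨⟨f5, hC5, hN5, -, hB5⟩, -⟩ hs5
      have g19 : s5.reg 19 = 2 ^ b := by rw [f5 19 (by omega), f4 19 (by omega), h19]
      have hp2 : 2 ^ b < W := hW ▸ Nat.pow_lt_pow_right (by norm_num) hbm
      refine Runs.block hB he _ hs5 ?_ ?_
      · simp [BlockSafe, Instr.Safe, Instr.run, g19]; omega
      · refine ⟨⟨by omega, fun r hr => ?_, ?_, ?_, ?_, ?_⟩, ?_⟩
        · simp [runBlock, Instr.run, show r ≠ 19 by omega, f5 r (by omega), f4 r (by omega),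
            hfr' r hr]
        · simpa [runBlock, Instr.run] using hC5
        · simp [runBlock, Instr.run, g19]; ring
        · simpa [runBlock, Instr.run] using hN5
        · simpa [runBlock, Instr.run] using fun x hx => hB5 x hx (Nat.zero_le _)
        · simp [runBlock, Instr.run, f5 18 (by omega), f4 18 (by omega), hri]
  · rw [m2]
    refine ⟨le_rfl, f2, hC1, by simp [g19], fun x hx => (hN1 x hx).1, fun x hx c hc h => ?_⟩
    simp only [Nat.sub_self, pow_zero, Nat.div_one] at h
    subst h
    rw [(hN1 c hx).2 hc]
    exact Nat.zero_le _
  · rintro s' - ⟨⟨-, q1, q2, -, q3, q4⟩, -⟩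
    refine ⟨q1, q2, fun x hx => ⟨q3 x hx, fun c hc => q4 x hx c hc ?_⟩⟩
    rw [Nat.sub_zero, hW, Nat.div_eq_of_lt hx, Nat.div_eq_of_lt (hCW c hc)]

/-! ### Extending the code by one dimension -/

/-- Search the numbers from `q` to `2 * q - 1`, where `q` is in `reg 16`, for one with distance more
than `reg 4` from the code. -/
def farProg : Prog :=
  .seq (block [.const 17 0, .add 20 16 17]) <| forDown 20 21 <|
    .seq (block [.add 22 16 20, .add 23 22 3, .add 23 23 3, .load 24 23, .sub 24 24 4]) <|
    .ite 24 (block [.const 25 0, .add 17 22 25]) .skip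

/-- Zero can signal that no vector is far, because all candidates are at least `q > 0`. -/
theorem runs_farProg {e : Env} {B : ℕ} (he : |e.corr| ≤ 1) {s : State}
    (hs : Bounded B s) {m W q d : ℕ} (hW : 2 ^ m = W) (h3 : s.reg 3 = W) (h4 : s.reg 4 = d)
    (h16 : s.reg 16 = q) (hq : 2 * q ≤ W) (hq0 : 0 < q)
    (hmB : m + 3 ≤ B) (hU : ∀ x < W, s.mem (2 * W + x) ≤ m + 1) :
    Runs e B farProg s (q * 14 + 4) (fun s' =>
      (∀ r < 17, s'.reg r = s.reg r) ∧ s'.mem = s.mem ∧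
      ((s'.reg 17 = 0 ∧ ∀ y < q, s.mem (2 * W + (q + y)) ≤ d) ∨
        (q ≤ s'.reg 17 ∧ s'.reg 17 < 2 * q ∧ d < s.mem (2 * W + s'.reg 17)))) := by
  have hB : 1 ≤ B := by omega
  have hp : 8 * W ≤ 2 ^ B := by
    rw [← hW, show 8 * 2 ^ m = 2 ^ (m + 3) by ring]
    exact Nat.pow_le_pow_right (by norm_num) hmB
  have hmW : m < W := hW ▸ Nat.lt_two_pow_self
  refine (Runs.seq (T := 3) (T' := q * 14 + 1) (Runs.block hB he _ hs ?_ ?_)).mono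
    (by omega) (fun _ _ h => h)
  · simp [BlockSafe, Instr.Safe, Instr.run]; omega
  intro hs1
  refine (Runs.forDown hB he (by decide) (T := 10) (fun i s' =>
      (∀ r < 17, s'.reg r = s.reg r) ∧ s'.mem = s.mem ∧
      ((s'.reg 17 = 0 ∧ ∀ y < q, i ≤ y → s.mem (2 * W + (q + y)) ≤ d) ∨
        (q ≤ s'.reg 17 ∧ s'.reg 17 < 2 * q ∧ d < s.mem (2 * W + s'.reg 17))))
      q ?_ hs1 ?_ ?_).mono le_rfl ?_
  · rintro i hi s' hs' hri - ⟨s₀, ⟨hfr, hmem, hor⟩, hm', -, hx⟩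
    have hfr' : ∀ r < 17, s'.reg r = s.reg r := fun r hr => by
      rw [hx r (by omega) (by omega), hfr r hr]
    rw [← hm'] at hmem
    rw [← hx 17 (by decide) (by decide)] at hor
    have e3 : s'.reg 3 = W := by rw [hfr' 3 (by omega), h3]
    have e4 : s'.reg 4 = d := by rw [hfr' 4 (by omega), h4]
    have e16 : s'.reg 16 = q := by rw [hfr' 16 (by omega), h16]
    have a1 : q + i + W + W = 2 * W + (q + i) := by ring
    have hUi := hU (q + i) (by omega)
    refine (Runs.seq (T := 6) (T' := 4) (Runs.block hB he _ hs' ?_ ?_)).mono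
      (by omega) (fun _ _ h => h)
    · simp [BlockSafe, Instr.Safe, Instr.run, e3, e4, e16, hri, a1, hmem]; omega
    intro hs2
    generalize hd : runBlock e _ s' = s2 at hs2 ⊢
    have f2 : ∀ r < 22, s2.reg r = s'.reg r := fun r hr => by
      simp [← hd, runBlock, Instr.run, show r ≠ 22 by omega, show r ≠ 23 by omega,
        show r ≠ 24 by omega]
    have m2 : s2.mem = s.mem := by simp [← hd, runBlock, Instr.run, hmem]
    have g22 : s2.reg 22 = q + i := by simp [← hd, runBlock, Instr.run, e16, hri]
    have g24 : s2.reg 24 = s.mem (2 * W + (q + i)) - d := by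
      simp [← hd, runBlock, Instr.run, e3, e4, e16, hri, a1, hmem]
    clear hd
    refine Runs.ite hs2 (T := 3) ?_ ?_
    · rw [g24]
      intro hlt
      refine Runs.block hB he _ hs2 ?_ ?_
      · simp [BlockSafe, Instr.Safe, Instr.run, g22]; omega
      · refine ⟨⟨fun r hr => ?_, ?_, Or.inr ?_⟩, ?_⟩
        · simp [runBlock, Instr.run, show r ≠ 25 by omega, show r ≠ 17 by omega,
            f2 r (by omega), hfr' r hr]
        · simp [runBlock, Instr.run, m2]
        · simp [runBlock, Instr.run, g22]
          omega
        · simp [runBlock, Instr.run, f2 20 (by omega), hri]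
    · rw [g24]
      intro hle
      refine (Runs.skip hs2 ?_).mono (by omega) (fun _ _ h => h)
      rw [f2 17 (by omega), f2 20 (by omega)]
      refine ⟨⟨fun r hr => by rw [f2 r (by omega), hfr' r hr], m2, ?_⟩, hri⟩
      refine hor.imp (fun h => ⟨h.1, fun y hy hiy => ?_⟩) id
      rcases eq_or_lt_of_le hiy with rfl | hlt
      · omega
      · exact h.2 y hy hlt
  · simp [runBlock, Instr.run, h16]
  · refine ⟨fun r hr => ?_, ?_, Or.inl ⟨?_, fun y h h' => absurd h (by omega)⟩⟩
    · simp [runBlock, Instr.run, show r ≠ 17 by omega, show r ≠ 20 by omega]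
    · simp [runBlock, Instr.run]
    · simp [runBlock, Instr.run]
  · rintro s' - ⟨⟨f, hm, hor⟩, -⟩
    exact ⟨f, hm, hor.imp (fun h => ⟨h.1, fun y hy => h.2 y hy (Nat.zero_le _)⟩) id⟩

/-- Add the sums of `reg 17` and the codewords to the code. -/
def doubleProg : Prog :=
  .seq (block [.const 29 0, .add 20 16 29]) <| forDown 20 21 <|
    .seq (block [.const 29 0, .add 30 20 29, .add 31 17 29]) <|
    .seq xorProg <|
    block [.add 22 3 3, .add 22 22 3, .add 23 22 20, .load 24 23, .add 25 22 32, .store 25 24]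

/-- Codewords lie below `2 ^ k` and their translates by `v` do not, so the cells written are never
among those still to be read. -/
theorem runs_doubleProg {e : Env} {B : ℕ} (he : |e.corr| ≤ 1) {s : State}
    (hs : Bounded B s) {m W k v : ℕ} (hW : 2 ^ m = W) (h2 : s.reg 2 = m) (h3 : s.reg 3 = W)
    (h16 : s.reg 16 = 2 ^ k) (hk : k < m) (h17 : s.reg 17 = v) (hv : 2 ^ k ≤ v)
    (hv' : v < 2 ^ (k + 1)) (hmB : m + 3 ≤ B) {C : Set ℕ} (hCk : ∀ c ∈ C, c < 2 ^ k)
    (hC : HoldsCode W C s.mem) :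
    Runs e B doubleProg s (2 ^ k * (m * 19 + 22) + 4) (fun s' =>
      (∀ r < 18, s'.reg r = s.reg r) ∧ HoldsCode W {x | x ∈ C ∨ x ^^^ v ∈ C} s'.mem) := by
  have hB : 1 ≤ B := by omega
  have hp : 8 * W ≤ 2 ^ B := by
    rw [← hW, show 8 * 2 ^ m = 2 ^ (m + 3) by ring]
    exact Nat.pow_le_pow_right (by norm_num) hmB
  have hmW : m < W := hW ▸ Nat.lt_two_pow_self
  have hkW : 2 ^ (k + 1) ≤ W := hW ▸ Nat.pow_le_pow_right (by norm_num) hk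
  have hk2 : 2 ^ (k + 1) = 2 * 2 ^ k := by ring
  have hxx : ∀ a, a ^^^ v ^^^ v = a := fun a => by rw [Nat.xor_assoc, Nat.xor_self, Nat.xor_zero]
  refine (Runs.seq (T := 3) (T' := 2 ^ k * (m * 19 + 22) + 1) (Runs.block hB he _ hs ?_ ?_)).mono
    (by omega) (fun _ _ h => h)
  · simp [BlockSafe, Instr.Safe, Instr.run]; omega
  intro hs1
  refine (Runs.forDown hB he (by decide) (T := m * 19 + 18) (fun i s' =>
      (∀ r < 18, s'.reg r = s.reg r) ∧
      HoldsCode W {x | x ∈ C ∨ x ^^^ v ∈ C ∧ i ≤ x ^^^ v} s'.mem)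
      (2 ^ k) ?_ hs1 ?_ ?_).mono le_rfl ?_
  · rintro i hi s' hs' hri - ⟨s₀, ⟨hfr, hcode⟩, hm', -, hx⟩
    have hfr' : ∀ r < 18, s'.reg r = s.reg r := fun r hr => by
      rw [hx r (by omega) (by omega), hfr r hr]
    rw [← hm'] at hcode
    have e17 : s'.reg 17 = v := by rw [hfr' 17 (by omega), h17]
    refine (Runs.seq (T := 4) (T' := m * 19 + 14) (Runs.block hB he _ hs' ?_ ?_)).mono
      (by omega) (fun _ _ h => h)
    · simp [BlockSafe, Instr.Safe, Instr.run, e17, hri]; omega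
    intro hs2
    generalize hd : runBlock e _ s' = s2 at hs2 ⊢
    have f2 : ∀ r < 22, s2.reg r = s'.reg r := fun r hr => by
      simp [← hd, runBlock, Instr.run, show r ≠ 29 by omega, show r ≠ 30 by omega,
        show r ≠ 31 by omega]
    have m2 : s2.mem = s'.mem := by simp [← hd, runBlock, Instr.run]
    have g30 : s2.reg 30 = i := by simp [← hd, runBlock, Instr.run, hri]
    have g31 : s2.reg 31 = v := by simp [← hd, runBlock, Instr.run, e17]
    clear hd
    refine (Runs.seq (T := m * 19 + 7) (T' := 7) ?_).mono (by omega) (fun _ _ h => h)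
    refine (runs_xorProg he hs2 (m := m) (by rw [f2 2 (by omega), hfr' 2 (by omega), h2])
      (by omega) (by rw [g30, hW]; omega) (by rw [g31, hW]; omega)).mono le_rfl ?_
    rintro s3 - ⟨g32, f3, m3, -⟩ hs3
    rw [g30, g31] at g32
    rw [m2] at m3
    have hiv : 2 ^ k ≤ i ^^^ v := le_xor_of_ge hi hv
    have hiv' : i ^^^ v < W := by
      rw [← hW]; exact Nat.xor_lt_two_pow (by omega) (by omega)
    have f3' : ∀ r < 22, s3.reg r = s'.reg r := fun r hr => by rw [f3 r (by omega), f2 r hr]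
    have e3 : s3.reg 3 = W := by rw [f3' 3 (by omega), hfr' 3 (by omega), h3]
    have e20 : s3.reg 20 = i := by rw [f3' 20 (by omega), hri]
    have a1 : W + W + W = 3 * W := by ring
    set y := i ^^^ v with hy
    obtain ⟨c, hc, hcC, hcN, hcm⟩ : ∃ c ≤ 1, (i ∈ C → c = 1) ∧ (i ∉ C → c = 0) ∧
        s'.mem (3 * W + i) = c := by
      by_cases h : i ∈ C
      · exact ⟨1, le_rfl, fun _ => rfl, fun g => absurd h g, (hcode i (by omega)).1 (Or.inl h)⟩
      · refine ⟨0, by omega, fun g => absurd g h, fun _ => rfl, (hcode i (by omega)).2 ?_⟩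
        rintro (g | ⟨g, -⟩)
        · exact h g
        · have := hCk _ g; omega
    refine Runs.block hB he _ hs3 ?_ ?_
    · simp [BlockSafe, Instr.Safe, Instr.run, e3, e20, g32, a1, m3, hcm]; omega
    generalize hd : runBlock e _ s3 = s4
    have f4 : ∀ r < 22, s4.reg r = s'.reg r := fun r hr => by
      simp [← hd, runBlock, Instr.run, f3' r hr, show r ≠ 22 by omega, show r ≠ 23 by omega,
        show r ≠ 24 by omega, show r ≠ 25 by omega]
    have m4 : s4.mem = Function.update s'.mem (3 * W + y) c := by
      simp [← hd, runBlock, Instr.run, e3, e20, g32, a1, m3, hcm]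
    clear hd
    refine ⟨⟨fun r hr => by rw [f4 r (by omega), hfr' r hr], fun x hx => ?_⟩,
      by rw [f4 20 (by omega), hri]⟩
    simp only [Set.mem_ofPred_eq]
    rcases eq_or_ne x y with rfl | hne
    · rw [m4, Function.update_self, hy, hxx]
      constructor
      · rintro (g | g)
        · have := hCk _ g; omega
        · exact hcC g.1
      · intro g
        exact hcN (fun g' => g (Or.inr ⟨g', le_rfl⟩))
    · rw [m4, Function.update_of_ne (by omega)]
      have hne' : x ^^^ v ≠ i := fun h => hne (by rw [hy, ← h, hxx])
      have := hcode x hx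
      simp only [Set.mem_ofPred_eq] at this
      have hiff : i ≤ x ^^^ v ↔ i + 1 ≤ x ^^^ v := by omega
      rwa [hiff]
  · simp [runBlock, Instr.run, h16]
  · refine ⟨fun r hr => ?_, ?_⟩
    · simp [runBlock, Instr.run, show r ≠ 29 by omega, show r ≠ 20 by omega]
    · have : {x | x ∈ C ∨ x ^^^ v ∈ C ∧ 2 ^ k ≤ x ^^^ v} = C := by
        ext x
        simp only [Set.mem_ofPred_eq]
        refine ⟨?_, Or.inl⟩
        rintro (h | ⟨h, h'⟩)
        · exact h
        · have := hCk _ h; omega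
      rw [this]
      simpa [runBlock, Instr.run] using hC
  · rintro s' - ⟨⟨f, hcode⟩, -⟩
    simp only [Nat.zero_le, and_true] at hcode
    exact ⟨f, hcode⟩

/-- Extend the code from dimension `k` to dimension `k + 1`, where `2 ^ k` is in `reg 16`. -/
def roundProg : Prog :=
  .seq fillProg <| .seq farProg <| .seq (.ite 17 doubleProg .skip) <| block [.add 16 16 16]

theorem runs_roundProg {e : Env} {B : ℕ} (he : |e.corr| ≤ 1) {s : State}
    (hs : Bounded B s) {m W k d : ℕ} (hW : 2 ^ m = W) (h2 : s.reg 2 = m) (h3 : s.reg 3 = W)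
    (h4 : s.reg 4 = d) (h16 : s.reg 16 = 2 ^ k) (hk : k < m) (hmB : m + 3 ≤ B) {C : Set ℕ}
    (hPC : IsPartialCode m d k C) (hC : HoldsCode W C s.mem) :
    Runs e B roundProg s ((m + 1) * (W * (m * 19 + 60) + 20)) (fun s' =>
      (∀ r < 16, s'.reg r = s.reg r) ∧ s'.reg 16 = 2 ^ (k + 1) ∧
      ∃ C', IsPartialCode m d (k + 1) C' ∧ HoldsCode W C' s'.mem) := by
  have hB : 1 ≤ B := by omega
  have hp : 8 * W ≤ 2 ^ B := by
    rw [← hW, show 8 * 2 ^ m = 2 ^ (m + 3) by ring]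
    exact Nat.pow_le_pow_right (by norm_num) hmB
  have hkW : 2 ^ (k + 1) ≤ W := hW ▸ Nat.pow_le_pow_right (by norm_num) hk
  have hk2 : 2 ^ (k + 1) = 2 * 2 ^ k := by ring
  have hk0 : 0 < 2 ^ k := by positivity
  have hcost : W * 16 + m * (W * (m * 19 + 30) + 10) + 9 +
      (2 ^ k * 14 + 4 + ((2 ^ k * (m * 19 + 22) + 4 + 1) + 2)) ≤
      (m + 1) * (W * (m * 19 + 60) + 20) := by
    have : 2 ^ k * (m * 19 + 22) ≤ W * (m * 19 + 22) := Nat.mul_le_mul_right _ (by omega)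
    nlinarith
  refine (Runs.seq (T := W * 16 + m * (W * (m * 19 + 30) + 10) + 9)
    (T' := 2 ^ k * 14 + 4 + ((2 ^ k * (m * 19 + 22) + 4 + 1) + 2)) ?_).mono hcost
    (fun _ _ h => h)
  refine (runs_fillProg he hs hW h2 h3 hmB (fun c hc => (hPC.lt c hc).trans (by omega)) hC).mono
    le_rfl ?_
  rintro s1 - ⟨f1, hC1, hN1⟩ hs1
  refine Runs.seq ?_
  refine (runs_farProg he hs1 hW (by rw [f1 3 (by omega), h3]) (by rw [f1 4 (by omega), h4])
    (by rw [f1 16 (by omega), h16]) (by omega) hk0 hmB (fun x hx => (hN1 x hx).1.1)).mono le_rfl ?_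
  rintro s2 - ⟨f2, m2, hor⟩ hs2
  have f2' : ∀ r < 17, s2.reg r = s.reg r := fun r hr => by rw [f2 r hr, f1 r (by omega)]
  rw [← m2] at hC1
  refine Runs.seq ?_
  have key : Runs e B (.ite 17 doubleProg .skip) s2 (2 ^ k * (m * 19 + 22) + 4 + 1) (fun s' =>
      (∀ r < 17, s'.reg r = s.reg r) ∧
      ∃ C', IsPartialCode m d (k + 1) C' ∧ HoldsCode W C' s'.mem) := by
    refine Runs.ite hs2 (fun hne => ?_) (fun h0 => ?_)
    · obtain ⟨g, -⟩ | ⟨g1, g2, g3⟩ := hor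
      · exact absurd g hne
      refine (runs_doubleProg he hs2 hW (by rw [f2' 2 (by omega), h2])
        (by rw [f2' 3 (by omega), h3]) (by rw [f2' 16 (by omega), h16]) hk rfl g1 (by omega) hmB
        hPC.lt hC1).mono le_rfl ?_
      rintro s3 - ⟨f3, hC3⟩
      refine ⟨fun r hr => by rw [f3 r (by omega), f2' r hr], _, ?_, hC3⟩
      exact hPC.succ_of_far g1 (by omega)
        (fun x hx => g3.trans_le ((hN1 _ (by omega)).2 x hx))
    · obtain ⟨-, g⟩ | ⟨g1, g2, g3⟩ := hor
      · refine (Runs.skip hs2 ⟨f2', C, hPC.succ_of_cover fun y hy => ?_, hC1⟩).mono (by omega)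
          (fun _ _ h => h)
        obtain ⟨⟨-, -, n3⟩, n4⟩ := hN1 (2 ^ k + y) (by omega)
        -- Zero is a codeword, so the entry is at most `m` and names a codeword within this
        -- distance.
        obtain ⟨w, hw, -, hw2⟩ := n3 ((n4 0 hPC.zero_mem).trans (natDist_le _ _ _))
        exact ⟨w, hw, hw2.trans (g y hy)⟩
      · omega
  refine key.mono le_rfl ?_
  rintro s3 - ⟨f3, C', hC', hH⟩ hs3
  have e16 : s3.reg 16 = 2 ^ k := by rw [f3 16 (by omega), h16]
  refine Runs.block hB he _ hs3 ?_ ?_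
  · simp [BlockSafe, Instr.Safe, Instr.run, e16]; omega
  · refine ⟨fun r hr => ?_, ?_, C', hC', ?_⟩
    · simp [runBlock, Instr.run, show r ≠ 16 by omega, f3 r (by omega)]
    · simp [runBlock, Instr.run, e16]; ring
    · simpa [runBlock, Instr.run] using hH

/-! ### The preprocessing program -/

/-- Erase the entries for numbers at distance at least half of `reg 4` from the code. -/
def cutProg : Prog :=
  .seq (block [.const 29 0, .add 20 3 29]) <| forDown 20 21 <|
    .seq (block [.add 22 3 20, .add 23 22 3, .load 24 23, .add 24 24 24, .add 24 24 21,
      .sub 24 24 4, .const 25 0]) <|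
    .ite 24 (block [.store 22 25]) .skip

theorem runs_cutProg {e : Env} {B : ℕ} (he : |e.corr| ≤ 1) {s : State}
    (hs : Bounded B s) {m W d : ℕ} (hW : 2 ^ m = W) (h3 : s.reg 3 = W) (h4 : s.reg 4 = d)
    (hmB : m + 3 ≤ B) (hU : ∀ x < W, s.mem (2 * W + x) ≤ m + 1) :
    Runs e B cutProg s (W * 15 + 4) (fun s' =>
      (∀ r < 18, s'.reg r = s.reg r) ∧
      ∀ x < W, s'.mem (W + x) = if 2 * s.mem (2 * W + x) + 1 ≤ d then s.mem (W + x) else 0) := by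
  have hB : 1 ≤ B := by omega
  have hp : 8 * W ≤ 2 ^ B := by
    rw [← hW, show 8 * 2 ^ m = 2 ^ (m + 3) by ring]
    exact Nat.pow_le_pow_right (by norm_num) hmB
  have hmW : m < W := hW ▸ Nat.lt_two_pow_self
  refine (Runs.seq (T := 3) (T' := W * 15 + 1) (Runs.block hB he _ hs ?_ ?_)).mono
    (by omega) (fun _ _ h => h)
  · simp [BlockSafe, Instr.Safe, Instr.run]; omega
  intro hs1
  refine (Runs.forDown hB he (by decide) (T := 11) (fun i s' =>
      (∀ r < 18, s'.reg r = s.reg r) ∧ (∀ x < W, s'.mem (2 * W + x) = s.mem (2 * W + x)) ∧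
      (∀ x < i, s'.mem (W + x) = s.mem (W + x)) ∧
      ∀ x < W, i ≤ x →
        s'.mem (W + x) = if 2 * s.mem (2 * W + x) + 1 ≤ d then s.mem (W + x) else 0)
      W ?_ hs1 ?_ ?_).mono le_rfl ?_
  · rintro i hi s' hs' hri h21 ⟨s₀, ⟨hfr, hU', hold, hnew⟩, hm', -, hx⟩
    have hfr' : ∀ r < 18, s'.reg r = s.reg r := fun r hr => by
      rw [hx r (by omega) (by omega), hfr r hr]
    rw [← hm'] at hU' hold hnew
    have e3 : s'.reg 3 = W := by rw [hfr' 3 (by omega), h3]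
    have e4 : s'.reg 4 = d := by rw [hfr' 4 (by omega), h4]
    have a1 : W + i + W = 2 * W + i := by ring
    have hUi := hU i hi
    have hU'i := hU' i hi
    refine (Runs.seq (T := 8) (T' := 3) (Runs.block hB he _ hs' ?_ ?_)).mono
      (by omega) (fun _ _ h => h)
    · simp [BlockSafe, Instr.Safe, Instr.run, e3, e4, hri, h21, a1, hU'i]; omega
    intro hs2
    generalize hd : runBlock e _ s' = s2 at hs2 ⊢
    have f2 : ∀ r < 22, s2.reg r = s'.reg r := fun r hr => by
      simp [← hd, runBlock, Instr.run, show r ≠ 22 by omega, show r ≠ 23 by omega,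
        show r ≠ 24 by omega, show r ≠ 25 by omega]
    have m2 : s2.mem = s'.mem := by simp [← hd, runBlock, Instr.run]
    have g22 : s2.reg 22 = W + i := by simp [← hd, runBlock, Instr.run, e3, hri]
    have g25 : s2.reg 25 = 0 := by simp [← hd, runBlock, Instr.run]
    have g24 : s2.reg 24 = 2 * s.mem (2 * W + i) + 1 - d := by
      simp [← hd, runBlock, Instr.run, e3, e4, hri, h21, a1, hU'i, ← two_mul]
    clear hd
    refine Runs.ite hs2 (T := 2) ?_ ?_
    · rw [g24]
      intro hlt
      refine Runs.block hB he _ hs2 (by simp [BlockSafe, Instr.Safe]) ?_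
      generalize hd : runBlock e _ s2 = s3
      have f3 : ∀ r < 22, s3.reg r = s'.reg r := fun r hr => by
        simp [← hd, runBlock, Instr.run, f2 r hr]
      have m3 : s3.mem = Function.update s'.mem (W + i) 0 := by
        simp [← hd, runBlock, Instr.run, g22, g25, m2]
      clear hd
      refine ⟨⟨fun r hr => by rw [f3 r (by omega), hfr' r hr], fun x hx => ?_, fun x hx => ?_,
        fun x hx hix => ?_⟩, by rw [f3 20 (by omega), hri]⟩
      · rw [m3, Function.update_of_ne (by omega), hU' x hx]
      · rw [m3, Function.update_of_ne (by omega), hold x (by omega)]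
      · rcases eq_or_lt_of_le hix with rfl | hlt'
        · rw [m3, Function.update_self, if_neg (by omega)]
        · rw [m3, Function.update_of_ne (by omega), hnew x hx hlt']
    · rw [g24]
      intro hle
      refine (Runs.skip hs2 ?_).mono (by omega) (fun _ _ h => h)
      rw [m2]
      refine ⟨⟨fun r hr => by rw [f2 r (by omega), hfr' r hr], hU', fun x hx => hold x (by omega),
        fun x hx hix => ?_⟩, by rw [f2 20 (by omega), hri]⟩
      rcases eq_or_lt_of_le hix with rfl | hlt'
      · rw [if_pos (by omega), hold i (by omega)]
      · exact hnew x hx hlt'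
  · simp [runBlock, Instr.run, h3]
  · refine ⟨fun r hr => ?_, ?_, ?_, fun x h h' => absurd h (by omega)⟩
    · simp [runBlock, Instr.run, show r ≠ 29 by omega, show r ≠ 20 by omega]
    · simp [runBlock, Instr.run]
    · simp [runBlock, Instr.run]
  · rintro s' - ⟨⟨f, -, -, h⟩, -⟩
    exact ⟨f, fun x hx => h x hx (Nat.zero_le _)⟩

/-- Construct a Gilbert code of length `reg 2` with distance parameter `reg 4`, where `reg 3` holds
`2 ^ reg 2`, and its decoding table. -/
def tableProg : Prog :=
  .seq (block [.add 22 3 3, .add 22 22 3, .const 23 1, .store 22 23, .const 16 1, .const 17 0,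
    .add 10 2 17]) <|
  .seq (forDown 10 11 roundProg) <|
  .seq fillProg <|
  .seq cutProg <|
  block [.const 29 0, .store 29 3]

/-- Each of the `m` rounds takes O(m² W) steps, so the total is `W = 2 ^ m` up to a polynomial in
`m`. The last round may enlarge the code after its sweep; hence one more sweep before the table is
cut off. -/
theorem runs_tableProg {e : Env} {B : ℕ} (he : |e.corr| ≤ 1) {s : State}
    (hs : Bounded B s) {m W d : ℕ} (hW : 2 ^ m = W) (h2 : s.reg 2 = m) (h3 : s.reg 3 = W)
    (h4 : s.reg 4 = d) (hmB : m + 3 ≤ B) (hmem : ∀ x < W, s.mem (3 * W + x) = 0) :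
    Runs e B tableProg s ((m + 1) ^ 2 * (W * (m * 19 + 60) + 100)) (fun s' =>
      ∃ K, IsGilbertCode m d K ∧ HoldsDecodingTable m d K s'.mem) := by
  have hB : 1 ≤ B := by omega
  have hp : 8 * W ≤ 2 ^ B := by
    rw [← hW, show 8 * 2 ^ m = 2 ^ (m + 3) by ring]
    exact Nat.pow_le_pow_right (by norm_num) hmB
  have hmW : m < W := hW ▸ Nat.lt_two_pow_self
  have hcost : 8 + ((m * ((m + 1) * (W * (m * 19 + 60) + 20) + 4) + 1) +
      ((W * 16 + m * (W * (m * 19 + 30) + 10) + 9) + ((W * 15 + 4) + 3))) ≤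
      (m + 1) ^ 2 * (W * (m * 19 + 60) + 100) := by
    nlinarith [Nat.zero_le (m * W), Nat.zero_le (m * m * W), Nat.zero_le (m * m)]
  refine (Runs.seq (Runs.block hB he _ hs ?_ ?_)).mono hcost (fun _ _ h => h)
  · simp [BlockSafe, Instr.Safe, Instr.run, h2, h3]; omega
  intro hs1
  generalize hd : runBlock e _ s = s1 at hs1 ⊢
  have e2 : s1.reg 2 = m := by simp [← hd, runBlock, Instr.run, h2]
  have e3 : s1.reg 3 = W := by simp [← hd, runBlock, Instr.run, h3]
  have e4 : s1.reg 4 = d := by simp [← hd, runBlock, Instr.run, h4]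
  have e10 : s1.reg 10 = m := by simp [← hd, runBlock, Instr.run, h2]
  have e16 : s1.reg 16 = 1 := by simp [← hd, runBlock, Instr.run]
  have a1 : W + W + W = 3 * W := by ring
  have m1 : s1.mem = Function.update s.mem (3 * W) 1 := by
    simp [← hd, runBlock, Instr.run, h3, a1]
  clear hd
  have hC1 : HoldsCode W {0} s1.mem := by
    intro x hx
    constructor
    · rintro rfl
      rw [m1, add_zero, Function.update_self]
    · intro hne
      have hne' : x ≠ 0 := hne
      rw [m1, Function.update_of_ne (by omega), hmem x hx]
  refine Runs.seq ?_
  refine (Runs.forDown hB he (by decide) (T := (m + 1) * (W * (m * 19 + 60) + 20)) (fun i s' =>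
      i ≤ m ∧ s'.reg 2 = m ∧ s'.reg 3 = W ∧ s'.reg 4 = d ∧ s'.reg 16 = 2 ^ (m - i) ∧
      ∃ C, IsPartialCode m d (m - i) C ∧ HoldsCode W C s'.mem) m ?_ hs1 e10 ?_).mono le_rfl ?_
  · rintro i hi s' hs' hri - ⟨s₀, ⟨-, g2, g3, g4, g16, C, hPC, hC⟩, hm', -, hx⟩
    rw [← hx 2 (by decide) (by decide)] at g2
    rw [← hx 3 (by decide) (by decide)] at g3
    rw [← hx 4 (by decide) (by decide)] at g4
    rw [← hx 16 (by decide) (by decide)] at g16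
    rw [← hm'] at hC
    have hk : m - i = (m - (i + 1)) + 1 := by omega
    refine (runs_roundProg he hs' hW g2 g3 g4 g16 (by omega) hmB hPC hC).mono le_rfl ?_
    rintro s2 - ⟨f2, k16, hex⟩
    rw [hk]
    exact ⟨⟨by omega, by rw [f2 2 (by omega), g2], by rw [f2 3 (by omega), g3],
      by rw [f2 4 (by omega), g4], k16, hex⟩, by rw [f2 10 (by omega), hri]⟩
  · rw [Nat.sub_self]
    exact ⟨le_rfl, e2, e3, e4, by rw [e16, pow_zero], {0}, isPartialCode_zero m d, hC1⟩
  rintro s2 - ⟨⟨-, g2, g3, g4, -, C, hPC, hC⟩, -⟩ hs2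
  rw [Nat.sub_zero] at hPC
  refine Runs.seq ?_
  refine (runs_fillProg he hs2 hW g2 g3 hmB (fun c hc => hW ▸ hPC.lt c hc) hC).mono le_rfl ?_
  rintro s3 - ⟨f3, -, hN⟩ hs3
  have k3 : s3.reg 3 = W := by rw [f3 3 (by omega), g3]
  refine Runs.seq ?_
  refine (runs_cutProg he hs3 hW k3 (by rw [f3 4 (by omega), g4]) hmB
    (fun x hx => (hN x hx).1.1)).mono le_rfl ?_
  rintro s4 - ⟨f4, hT⟩ hs4
  refine Runs.block hB he _ hs4 (by simp [BlockSafe, Instr.Safe, Instr.run]) ?_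
  generalize hd : runBlock e _ s4 = s5
  have m5 : s5.mem = Function.update s4.mem 0 W := by
    simp [← hd, runBlock, Instr.run, f4 3 (by omega), k3]
  clear hd
  -- Cell `0` holds the base address of the table; it is not a table cell because `W ≥ 1`.
  have hm0 : s5.mem 0 = W := by rw [m5, Function.update_self]
  have hmx : ∀ x < W, s5.mem (W + x) =
      if 2 * s3.mem (2 * W + x) + 1 ≤ d then s3.mem (W + x) else 0 := fun x hx => by
    rw [m5, Function.update_of_ne (by omega), hT x hx]
  have hfind : ∀ x < W, ∃ w ∈ C, s3.mem (W + x) = w + 1 ∧ natDist m x w ≤ s3.mem (2 * W + x) :=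
    fun x hx => by
      obtain ⟨⟨-, -, n3⟩, n4⟩ := hN x hx
      exact n3 ((n4 0 hPC.zero_mem).trans (natDist_le _ _ _))
  refine ⟨_, hPC.isGilbertCode, hPC.holdsDecodingTable ?_ ?_⟩
  · intro x hx
    rw [hW] at hx
    rw [hm0, hmx x hx]
    obtain ⟨w, hw, hw1, hw2⟩ := hfind x hx
    intro h0 c hc hcd
    have := (hN x hx).2 c hc
    rw [if_pos (by omega)] at h0
    omega
  · intro x hx w'
    rw [hW] at hx
    rw [hm0, hmx x hx]
    obtain ⟨w, hw, hw1, hw2⟩ := hfind x hx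
    intro h0
    split_ifs at h0
    have : w' = w := by omega
    subst this
    exact ⟨hw, by omega⟩

/-- The sum of `⌊n / j⌋` over `1 ≤ j ≤ n`. -/
def divisorSum (n : ℕ) : ℕ := ∑ i ∈ Finset.range n, n / (i + 1)

/-- The block length. -/
noncomputable def codeDim (ρ : ℝ) (n : ℕ) : ℕ :=
  4 * (divisorSum n * n) / (⌊|ρ| * (n : ℝ)⌋₊ * ⌊|ρ| * (n : ℝ)⌋₊)

/-- The distance parameter for block length `m`. -/
noncomputable def codeDist (ρ : ℝ) (m : ℕ) : ℕ := (m - ⌊|ρ| * (m : ℝ)⌋₊ + 1) / 2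

/-- A bound for the word length of the preprocessing program. -/
noncomputable def preWordLen (ρ : ℝ) (n : ℕ) : ℕ := codeDim ρ n + 3 * n.size + 10

theorem divisorSum_le (n : ℕ) : divisorSum n ≤ n * n := by
  unfold divisorSum
  calc ∑ i ∈ Finset.range n, n / (i + 1) ≤ ∑ _i ∈ Finset.range n, n :=
        Finset.sum_le_sum fun i _ => Nat.div_le_self _ _
    _ = n * n := by simp

/-- Compute the block length `m` (in `reg 2`), `2 ^ m` (in `reg 3`) and the distance parameter
(in `reg 4`). -/
def dimProg : Prog :=
  .seq (block [.const 29 0, .const 5 0, .add 20 0 29]) <|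
  .seq (forDown 20 21 <| block [.add 22 20 21, .div 23 0 22, .add 5 5 23]) <|
  .seq (block [.corr 6 0, .mul 6 6 6, .mul 7 5 0, .add 7 7 7, .add 7 7 7, .div 2 7 6,
    .const 3 1, .const 29 0, .add 20 2 29]) <|
  .seq (forDown 20 21 <| block [.add 3 3 3]) <|
  block [.corr 8 2, .sub 8 2 8, .const 9 1, .add 8 8 9, .const 9 2, .div 4 8 9]

theorem runs_dimProg {e : Env} {n : ℕ} (he : |e.corr| ≤ 1) {s : State}
    (hs : Bounded (preWordLen e.corr n) s) (h0 : s.reg 0 = n) :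
    Runs e (preWordLen e.corr n) dimProg s (n * 8 + codeDim e.corr n * 6 + 23) (fun s' =>
      s'.reg 2 = codeDim e.corr n ∧ s'.reg 3 = 2 ^ codeDim e.corr n ∧
      s'.reg 4 = codeDist e.corr (codeDim e.corr n) ∧ s'.mem = s.mem) := by
  set ρ := e.corr with hρ
  set B := preWordLen ρ n with hBdef
  have hB : 1 ≤ B := by rw [hBdef, preWordLen]; omega
  have hn2 : n < 2 ^ n.size := Nat.size_le.1 le_rfl
  have hD := divisorSum_le n
  have hcube : 8 * (n * n * n) < 2 ^ B := by
    have h1 : n * n * n < 2 ^ (n.size + n.size + n.size) :=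
      mul_lt_two_pow (mul_lt_two_pow hn2 hn2) hn2
    have h2 : 2 ^ (n.size + n.size + n.size + 3) ≤ 2 ^ B :=
      Nat.pow_le_pow_right (by norm_num) (by rw [hBdef, preWordLen]; omega)
    rw [pow_add _ _ 3] at h2
    omega
  have hm2 : 8 * 2 ^ codeDim ρ n ≤ 2 ^ B := by
    rw [show 8 * 2 ^ codeDim ρ n = 2 ^ (codeDim ρ n + 3) by ring]
    exact Nat.pow_le_pow_right (by norm_num) (by rw [hBdef, preWordLen]; omega)
  have hmlt : codeDim ρ n < 2 ^ codeDim ρ n := Nat.lt_two_pow_self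
  have hnn : n ≤ n * n := Nat.le_mul_self n
  have hnnn : n * n ≤ n * n * n := by
    rcases Nat.eq_zero_or_pos n with h | h
    · simp [h]
    · exact Nat.le_mul_of_pos_right _ h
  have hDn : divisorSum n * n ≤ n * n * n := Nat.mul_le_mul_right _ hD
  set a := ⌊|ρ| * (n : ℝ)⌋₊ with ha
  have han : a ≤ n := Nat.floor_le_of_le (mul_le_of_le_one_left (Nat.cast_nonneg _) he)
  have haa : a * a ≤ n * n := Nat.mul_le_mul han han
  have hmdef : 4 * (divisorSum n * n) / (a * a) = codeDim ρ n := rfl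
  set m := codeDim ρ n with hm
  clear_value B a
  refine (Runs.seq (T := 4) (T' := (n * 8 + 1) + (10 + ((m * 6 + 1) + 7))) (Runs.block hB he _ hs
    ?_ ?_)).mono (by omega) (fun _ _ h => h)
  · simp [BlockSafe, Instr.Safe, Instr.run, h0]; omega
  intro hs1
  refine Runs.seq ?_
  refine (Runs.forDown hB he (by decide) (T := 4) (fun i s' =>
      s'.reg 0 = n ∧ s'.mem = s.mem ∧
      s'.reg 5 + ∑ j ∈ Finset.range i, n / (j + 1) = divisorSum n) n ?_ hs1 ?_ ?_).mono le_rfl ?_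
  · rintro i hi s' hs' hri h21 ⟨s₀, ⟨g0, hmem, hsum⟩, hm', -, hx⟩
    rw [← hx 0 (by decide) (by decide)] at g0
    rw [← hx 5 (by decide) (by decide), Finset.sum_range_succ] at hsum
    rw [← hm'] at hmem
    refine Runs.block hB he _ hs' ?_ ?_
    · simp [BlockSafe, Instr.Safe, Instr.run, g0, hri, h21]; omega
    · simp [runBlock, Instr.run, g0, hri, h21, hmem]; omega
  · simp [runBlock, Instr.run, h0]
  · simp [runBlock, Instr.run, h0, divisorSum]
  rintro s2 - ⟨⟨g0, hmem2, hsum⟩, -⟩ hs2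
  have g5 : s2.reg 5 = divisorSum n := by simpa using hsum
  have hcorr : ⌊|e.corr| * (n : ℝ)⌋₊ = a := ha.symm
  refine Runs.seq ?_
  have hfour : divisorSum n * n + divisorSum n * n + (divisorSum n * n + divisorSum n * n) =
      4 * (divisorSum n * n) := by ring
  refine Runs.block hB he _ hs2 ?_ ?_
  · simp [BlockSafe, Instr.Safe, Instr.run, g0, g5, hcorr, hfour, hmdef]; omega
  intro hs3
  generalize hd : runBlock e _ s2 = s3 at hs3 ⊢
  have k2 : s3.reg 2 = m := by
    simp [← hd, runBlock, Instr.run, g0, g5, hcorr, hfour, hmdef]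
  have k20 : s3.reg 20 = m := by
    simp [← hd, runBlock, Instr.run, g0, g5, hcorr, hfour, hmdef]
  have k3 : s3.reg 3 = 1 := by simp [← hd, runBlock, Instr.run]
  have m3 : s3.mem = s.mem := by simp [← hd, runBlock, Instr.run, hmem2]
  clear hd
  refine Runs.seq ?_
  refine (Runs.forDown hB he (by decide) (T := 2) (fun i s' => i ≤ m ∧
      s'.reg 2 = m ∧ s'.mem = s.mem ∧ s'.reg 3 = 2 ^ (m - i)) m ?_ hs3 k20 ?_).mono le_rfl ?_
  · rintro i hi s' hs' hri h21 ⟨s₀, ⟨-, g2, hmem, g3⟩, hm', -, hx⟩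
    rw [← hx 2 (by decide) (by decide)] at g2
    rw [← hx 3 (by decide) (by decide)] at g3
    rw [← hm'] at hmem
    have hple : 2 ^ (m - (i + 1)) ≤ 2 ^ m := Nat.pow_le_pow_right (by norm_num) (by omega)
    have hpow : 2 ^ (m - i) = 2 * 2 ^ (m - (i + 1)) := by
      rw [← pow_succ']; congr 1; omega
    refine Runs.block hB he _ hs' ?_ ?_
    · simp [BlockSafe, Instr.Safe, Instr.run, g3]; omega
    · simp [runBlock, Instr.run, g2, g3, hri, hmem]; omega
  · exact ⟨le_rfl, k2, m3, by rw [k3, Nat.sub_self, pow_zero]⟩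
  rintro s4 - ⟨⟨-, l2, hmem4, l3⟩, -⟩ hs4
  rw [Nat.sub_zero] at l3
  refine Runs.block hB he _ hs4 ?_ ?_
  · simp [BlockSafe, Instr.Safe, Instr.run, l2]; omega
  · simp [runBlock, Instr.run, l2, l3, hmem4, codeDist, hρ]

/-- The preprocessing program. -/
def preProg : Prog := .seq dimProg tableProg

/-- A bound for the number of steps of the preprocessing program. -/
noncomputable def preStepBound (ρ : ℝ) (n : ℕ) : ℕ :=
  n * 8 + codeDim ρ n * 6 + 23 +
    (codeDim ρ n + 1) ^ 2 * (2 ^ codeDim ρ n * (codeDim ρ n * 19 + 60) + 100)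

theorem runs_preProg {ρ : ℝ} (hρ : |ρ| ≤ 1) (n : ℕ) (ω : ℕ → Bool) :
    Runs (preEnv ρ ω) (preWordLen ρ n) preProg (start n ρ fun _ => 0) (preStepBound ρ n)
      (fun s' => ∃ K, IsGilbertCode (codeDim ρ n) (codeDist ρ (codeDim ρ n)) K ∧
        HoldsDecodingTable (codeDim ρ n) (codeDist ρ (codeDim ρ n)) K s'.mem) := by
  have hs : Bounded (preWordLen ρ n) (start n ρ fun _ => 0) := by
    intro r
    have h1 : n < 2 ^ preWordLen ρ n :=
      lt_two_pow_mono (Nat.size_le.1 le_rfl) (by unfold preWordLen; omega)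
    have h2 : 1 < 2 ^ preWordLen ρ n := Nat.one_lt_two_pow (by unfold preWordLen; omega)
    simp only [start]
    split_ifs <;> omega
  refine Runs.seq ?_
  refine (runs_dimProg (e := preEnv ρ ω) hρ hs (by simp [start])).mono le_rfl ?_
  rintro s1 - ⟨h2, h3, h4, hm⟩ hs1
  exact runs_tableProg hρ hs1 rfl h2 h3 h4 (by unfold preWordLen; omega)
    (fun x _ => by rw [hm]; rfl)

/-- Replacing |ρ|m by its integer part raises m - |ρ|m to the next integer, and this does not change
the rounded-up half. -/
theorem codeDist_eq {ρ : ℝ} (hρ : |ρ| ≤ 1) (m : ℕ) : codeDist ρ m = ⌈relDist ρ * m⌉₊ := by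
  set b := ⌊|ρ| * (m : ℝ)⌋₊ with hb
  have hbm : b ≤ m := Nat.floor_le_of_le (mul_le_of_le_one_left (Nat.cast_nonneg _) hρ)
  have h1 : (b : ℝ) ≤ |ρ| * m := Nat.floor_le (by positivity)
  have h2 : |ρ| * m < b + 1 := Nat.lt_floor_add_one _
  have hdef : codeDist ρ m = (m - b + 1) / 2 := rfl
  rw [hdef]
  symm
  have hr : relDist ρ * m = (m - |ρ| * m) / 2 := by unfold relDist; ring
  rw [hr]
  refine le_antisymm (Nat.ceil_le.2 ?_) ?_
  · have h3 : m ≤ 2 * ((m - b + 1) / 2) + b := by omega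
    have h4 : (m : ℝ) ≤ 2 * ((m - b + 1) / 2 : ℕ) + b := by exact_mod_cast h3
    linarith
  · by_contra hlt
    push Not at hlt
    have h3 := Nat.le_ceil (((m : ℝ) - |ρ| * m) / 2)
    generalize ⌈((m : ℝ) - |ρ| * m) / 2⌉₊ = c at hlt h3
    have h4 : 2 * c + b + 1 ≤ m := by omega
    have h5 : 2 * (c : ℝ) + b + 1 ≤ m := by exact_mod_cast h4
    linarith

/-! ### The block length -/

/-- The sum differs from n times the harmonic number by at most n, and the harmonic number lies
between ln n and ln n + 1. This makes the natural logarithm accessible to integer arithmetic. -/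
theorem divisorSum_mem {n : ℕ} (hn : 0 < n) :
    n * (Real.log n - 1) ≤ divisorSum n ∧ (divisorSum n : ℝ) ≤ n * (Real.log n + 1) := by
  have hn' : (0 : ℝ) < n := by exact_mod_cast hn
  have hH : ((harmonic n : ℚ) : ℝ) = ∑ i ∈ Finset.range n, ((i : ℝ) + 1)⁻¹ := by
    simp [harmonic]
  have hsum : n * ((harmonic n : ℚ) : ℝ) = ∑ i ∈ Finset.range n, (n : ℝ) / (i + 1) := by
    rw [hH, Finset.mul_sum]; rfl
  have h1 := log_add_one_le_harmonic n
  have h2 := harmonic_le_one_add_log n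
  have h3 : Real.log n ≤ Real.log (n + 1 : ℕ) :=
    Real.log_le_log hn' (by push_cast; linarith)
  have hle : (divisorSum n : ℝ) ≤ n * ((harmonic n : ℚ) : ℝ) := by
    rw [hsum, divisorSum]
    push_cast
    refine Finset.sum_le_sum fun i _ => ?_
    have := Nat.cast_div_le (α := ℝ) (m := n) (n := i + 1)
    push_cast at this
    exact this
  have hge : n * ((harmonic n : ℚ) : ℝ) ≤ divisorSum n + n := by
    rw [hsum, divisorSum]
    push_cast
    calc ∑ i ∈ Finset.range n, (n : ℝ) / (i + 1)
        ≤ ∑ i ∈ Finset.range n, (((n / (i + 1) : ℕ) : ℝ) + 1) := by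
          refine Finset.sum_le_sum fun i _ => ?_
          rw [div_le_iff₀ (by positivity)]
          have := (Nat.lt_mul_div_succ n (Nat.succ_pos i)).le
          have h' : (n : ℝ) ≤ ((i + 1 : ℕ) : ℝ) * ((n / (i + 1) + 1 : ℕ) : ℝ) := by
            exact_mod_cast this
          push_cast at h'
          linarith
      _ = _ := by rw [Finset.sum_add_distrib]; simp
  constructor
  · have := mul_le_mul_of_nonneg_left (h3.trans h1) hn'.le
    linarith
  · have := mul_le_mul_of_nonneg_left h2 hn'.le
    linarith

theorem sampleDim_eq (ρ : ℝ) (n : ℕ) : sampleDim ρ n = 4 * Real.log n / ρ ^ 2 := by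
  have : Real.log 2 ≠ 0 := (Real.log_pos (by norm_num)).ne'
  unfold sampleDim Real.logb
  field_simp

theorem tendsto_log_nat : Tendsto (fun n : ℕ => Real.log n) atTop atTop :=
  Real.tendsto_log_atTop.comp tendsto_natCast_atTop_atTop

theorem tendsto_divisorSum :
    Tendsto (fun n : ℕ => (divisorSum n : ℝ) / (n * Real.log n)) atTop (𝓝 1) := by
  have hinv : Tendsto (fun n : ℕ => (Real.log n)⁻¹) atTop (𝓝 0) :=
    tendsto_inv_atTop_zero.comp tendsto_log_nat
  have hlow : Tendsto (fun n : ℕ => 1 - (Real.log n)⁻¹) atTop (𝓝 1) := by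
    simpa using hinv.const_sub 1
  have hup : Tendsto (fun n : ℕ => 1 + (Real.log n)⁻¹) atTop (𝓝 1) := by
    simpa using hinv.const_add 1
  refine tendsto_of_tendsto_of_tendsto_of_le_of_le' hlow hup ?_ ?_ <;>
  · filter_upwards [tendsto_log_nat.eventually_gt_atTop 0, eventually_gt_atTop 0] with n hL hn
    have hn' : (0 : ℝ) < n := by exact_mod_cast hn
    obtain ⟨h1, h2⟩ := divisorSum_mem hn
    first
    | rw [le_div_iff₀ (by positivity)]
      refine le_trans (le_of_eq ?_) h1
      field_simp
    | rw [div_le_iff₀ (by positivity)]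
      refine h2.trans (le_of_eq ?_)
      field_simp

/-- Up to rounding, the quotient is the ratio of `divisorSum n` to n ln n times the square of |ρ|n /
⌊|ρ|n⌋, and both factors tend to 1. The final integer division costs at most one unit, which is
negligible since `sampleDim` tends to infinity. -/
theorem tendsto_codeDim {ρ : ℝ} (h0 : ρ ≠ 0) :
    Tendsto (fun n => (codeDim ρ n : ℝ) / sampleDim ρ n) atTop (𝓝 1) := by
  have hpos : 0 < |ρ| := abs_pos.2 h0
  have hfloor : Tendsto (fun n : ℕ => (⌊|ρ| * (n : ℝ)⌋₊ : ℝ) / n) atTop (𝓝 |ρ|) :=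
    (tendsto_nat_floor_mul_div_atTop hpos.le).comp tendsto_natCast_atTop_atTop
  have hf : Tendsto (fun n : ℕ => (divisorSum n : ℝ) / (n * Real.log n) *
      (|ρ| / ((⌊|ρ| * (n : ℝ)⌋₊ : ℝ) / n)) ^ 2) atTop (𝓝 1) := by
    have h2 : Tendsto (fun n : ℕ => |ρ| / ((⌊|ρ| * (n : ℝ)⌋₊ : ℝ) / n)) atTop (𝓝 (|ρ| / |ρ|)) :=
      tendsto_const_nhds.div hfloor hpos.ne'
    have h3 := tendsto_divisorSum.mul (h2.pow 2)
    rwa [div_self hpos.ne', one_pow, one_mul] at h3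
  have hinv : Tendsto (fun n : ℕ => ρ ^ 2 / 4 * (Real.log n)⁻¹) atTop (𝓝 0) := by
    simpa using (tendsto_inv_atTop_zero.comp tendsto_log_nat).const_mul (ρ ^ 2 / 4)
  have hlow := hf.sub hinv
  rw [sub_zero] at hlow
  have hmem : ∀ᶠ n : ℕ in atTop,
      (divisorSum n : ℝ) / (n * Real.log n) * (|ρ| / ((⌊|ρ| * (n : ℝ)⌋₊ : ℝ) / n)) ^ 2 -
        ρ ^ 2 / 4 * (Real.log n)⁻¹ ≤ codeDim ρ n / sampleDim ρ n ∧
      codeDim ρ n / sampleDim ρ n ≤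
        (divisorSum n : ℝ) / (n * Real.log n) * (|ρ| / ((⌊|ρ| * (n : ℝ)⌋₊ : ℝ) / n)) ^ 2 := by
    filter_upwards [tendsto_log_nat.eventually_gt_atTop 0, eventually_gt_atTop 0,
      hfloor.eventually (lt_mem_nhds hpos)] with n hL hn ha
    have hn' : (0 : ℝ) < n := by exact_mod_cast hn
    have ha' : (0 : ℝ) < (⌊|ρ| * (n : ℝ)⌋₊ : ℝ) := by
      by_contra h
      have : (⌊|ρ| * (n : ℝ)⌋₊ : ℝ) = 0 := le_antisymm (not_lt.1 h) (Nat.cast_nonneg _)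
      rw [this, zero_div] at ha
      exact lt_irrefl _ ha
    have hdef : codeDim ρ n = 4 * (divisorSum n * n) / (⌊|ρ| * (n : ℝ)⌋₊ * ⌊|ρ| * (n : ℝ)⌋₊) := rfl
    generalize ⌊|ρ| * (n : ℝ)⌋₊ = a at ha' hdef ⊢
    have ha2 : 0 < a * a := by
      have : 0 < a := by exact_mod_cast ha'
      positivity
    have hup : (codeDim ρ n : ℝ) * (a * a) ≤ 4 * (divisorSum n * n) := by
      have := Nat.div_mul_le_self (4 * (divisorSum n * n)) (a * a)
      rw [← hdef] at this
      exact_mod_cast this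
    have hlo : 4 * (divisorSum n * n : ℝ) ≤ (codeDim ρ n + 1) * (a * a) := by
      have := (Nat.lt_mul_div_succ (4 * (divisorSum n * n)) ha2).le
      rw [← hdef, mul_comm (a * a)] at this
      exact_mod_cast this
    rw [sampleDim_eq, ← sq_abs ρ]
    have key : (divisorSum n : ℝ) / (n * Real.log n) * (|ρ| / (a / n)) ^ 2 =
        4 * (divisorSum n * n) / (a * a) * (|ρ| ^ 2 / (4 * Real.log n)) := by
      field_simp
    have key2 : (codeDim ρ n : ℝ) / (4 * Real.log n / |ρ| ^ 2) =
        codeDim ρ n * (|ρ| ^ 2 / (4 * Real.log n)) := by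
      field_simp
    rw [key, key2]
    have hc : 0 ≤ |ρ| ^ 2 / (4 * Real.log n) := by positivity
    constructor
    · have h1 : 4 * (divisorSum n * n : ℝ) / (a * a) ≤ codeDim ρ n + 1 :=
        (div_le_iff₀ (by positivity)).2 hlo
      have h2 := mul_le_mul_of_nonneg_right h1 hc
      have h3 : |ρ| ^ 2 / 4 * (Real.log n)⁻¹ = |ρ| ^ 2 / (4 * Real.log n) := by
        field_simp
      rw [h3]
      linarith
    · exact mul_le_mul_of_nonneg_right ((le_div_iff₀ (by positivity)).2 hup) hc
  exact tendsto_of_tendsto_of_tendsto_of_le_of_le' hlow hf (hmem.mono fun _ h => h.1)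
    (hmem.mono fun _ h => h.2)

/-! ### The running time of the preprocessing -/

/-- Eventually m ≤ 1.0001 · `sampleDim`, and 4 ln 2 · 1.0001 < 2.7729, so 2^m is at most
n^(2.7729/ρ²). The remaining n^(0.0001/ρ²) absorbs all powers of ln n. The loop of length n that
finds the block length is harmless since 2.7729/ρ² ≥ 1. -/
theorem eventually_preTime_le {ρ : ℝ} (h0 : ρ ≠ 0) (h1 : |ρ| ≤ 1) :
    ∀ᶠ n : ℕ in atTop, ((preStepBound ρ n * (2 * preWordLen ρ n + 2) : ℕ) : ℝ) ≤
      (n : ℝ) ^ (2.773 / ρ ^ 2) := by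
  have hρ2 : 0 < ρ ^ 2 := by positivity
  have hρ1 : ρ ^ 2 ≤ 1 := by
    rw [← sq_abs]; exact pow_le_one₀ (abs_nonneg _) h1
  set c : ℝ := 5 / ρ ^ 2 + 3 with hc
  have hcpos : 0 < c := by positivity
  have hβ : 0 < 0.0001 / ρ ^ 2 := by positivity
  -- Here 22590 = 753 · 30 is the product of the constants in the bounds `hstep` and `hword` below.
  have hlittle := ((isLittleO_log_rpow_rpow_atTop 4 hβ).comp_tendsto
    tendsto_natCast_atTop_atTop).bound (show 0 < 1 / (22590 * c ^ 4) by positivity)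
  filter_upwards [hlittle, tendsto_log_nat.eventually_ge_atTop 1, eventually_ge_atTop 2,
    (tendsto_codeDim h0).eventually (gt_mem_nhds (show (1 : ℝ) < 1.0001 by norm_num))]
    with n hlog hL hn hm
  have hn' : (0 : ℝ) < n := by positivity
  have hn1 : (1 : ℝ) ≤ n := by exact_mod_cast (by omega : 1 ≤ n)
  simp only [Function.comp_apply, Real.norm_eq_abs] at hlog
  set L := Real.log n with hLdef
  have hL0 : 0 < L := by linarith
  rw [sampleDim_eq, ← hLdef, div_lt_iff₀ (by positivity)] at hm
  have hmle : (codeDim ρ n : ℝ) ≤ 1.0001 * 4 * (L / ρ ^ 2) := by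
    refine hm.le.trans (le_of_eq ?_); ring
  have hLρ : 0 ≤ L / ρ ^ 2 := by positivity
  set y := c * L with hy
  have hy' : y = 5 * (L / ρ ^ 2) + 3 * L := by rw [hy, hc]; ring
  have hmy : (codeDim ρ n : ℝ) ≤ y := by
    rw [hy']; linarith
  have hsy : (n.size : ℝ) ≤ y := by
    have h2 := size_le_logb hn
    have h3 : Real.logb 2 n ≤ 2 * L := by
      unfold Real.logb
      rw [← hLdef, div_le_iff₀ (Real.log_pos (by norm_num))]
      have := Real.log_two_gt_d9
      nlinarith
    rw [hy']; linarith
  have hy1 : 1 ≤ y := by rw [hy']; linarith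
  set A : ℝ := (n : ℝ) ^ (2.7729 / ρ ^ 2) with hA
  have hnA : (n : ℝ) ≤ A := by
    refine Real.self_le_rpow_of_one_le hn1 ?_
    rw [le_div_iff₀ hρ2]; linarith
  have h2A : (2 : ℝ) ^ codeDim ρ n ≤ A := by
    rw [hA, Real.rpow_def_of_pos hn', ← Real.rpow_natCast,
      Real.rpow_def_of_pos (by norm_num : (0 : ℝ) < 2)]
    refine Real.exp_le_exp.2 ?_
    have h3 := Real.log_two_lt_d9
    have h4 : 0 < Real.log 2 := Real.log_pos (by norm_num)
    calc Real.log 2 * codeDim ρ n ≤ Real.log 2 * (1.0001 * 4 * (L / ρ ^ 2)) := by gcongr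
      _ = (Real.log 2 * 1.0001 * 4) * (L / ρ ^ 2) := by ring
      _ ≤ 2.7729 * (L / ρ ^ 2) := by
        refine mul_le_mul_of_nonneg_right ?_ hLρ
        linarith
      _ = L * (2.7729 / ρ ^ 2) := by ring
  have hA1 : 1 ≤ A := hn1.trans hnA
  have hstep : (preStepBound ρ n : ℝ) ≤ 753 * y ^ 3 * A := by
    unfold preStepBound
    push_cast
    have p1 : y ≤ y ^ 3 := by nlinarith [sq_nonneg y]
    have p2 : 1 ≤ y ^ 3 := by linarith
    have q1 : y ^ 3 ≤ y ^ 3 * A := by nlinarith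
    have q2 : A ≤ y ^ 3 * A := by nlinarith
    have e1 : ((codeDim ρ n : ℝ) + 1) ^ 2 ≤ 4 * y ^ 2 := by
      calc ((codeDim ρ n : ℝ) + 1) ^ 2 ≤ (2 * y) ^ 2 := by gcongr; linarith
        _ = 4 * y ^ 2 := by ring
    have e2 : (2 : ℝ) ^ codeDim ρ n * (codeDim ρ n * 19 + 60) + 100 ≤ 179 * (A * y) := by
      have : (2 : ℝ) ^ codeDim ρ n * (codeDim ρ n * 19 + 60) ≤ A * (79 * y) := by
        gcongr; linarith
      have : 1 ≤ A * y := by nlinarith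
      linarith
    have e3 : ((codeDim ρ n : ℝ) + 1) ^ 2 *
        ((2 : ℝ) ^ codeDim ρ n * (codeDim ρ n * 19 + 60) + 100) ≤
        4 * y ^ 2 * (179 * (A * y)) := by gcongr
    have e4 : 4 * y ^ 2 * (179 * (A * y)) = 716 * (y ^ 3 * A) := by ring
    rw [e4] at e3
    linarith
  have hword : (2 * preWordLen ρ n + 2 : ℝ) ≤ 30 * y := by
    unfold preWordLen; push_cast; linarith
  have hpoly : 22590 * y ^ 4 ≤ (n : ℝ) ^ (0.0001 / ρ ^ 2) := by
    rw [abs_of_nonneg (by positivity), abs_of_nonneg (by positivity), div_mul_eq_mul_div, one_mul,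
      le_div_iff₀ (by positivity)] at hlog
    have h5 : L ^ (4 : ℝ) = L ^ 4 := by exact_mod_cast Real.rpow_natCast L 4
    rw [h5] at hlog
    refine le_trans (le_of_eq ?_) hlog
    rw [hy]; ring
  push_cast
  calc (preStepBound ρ n : ℝ) * (2 * preWordLen ρ n + 2)
      ≤ (753 * y ^ 3 * A) * (30 * y) := by gcongr
    _ = 22590 * y ^ 4 * A := by ring
    _ ≤ (n : ℝ) ^ (0.0001 / ρ ^ 2) * A := by gcongr
    _ = (n : ℝ) ^ (2.773 / ρ ^ 2) := by
      rw [hA, ← Real.rpow_add hn']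
      congr 1
      ring

end LightBulb

open LightBulb in
theorem mainTheorem6 :
    (∃ Q : Prog, ∀ ρ : ℝ, ρ ≠ 0 → |ρ| ≤ 1 →
      ∃ (C : ℝ) (k : ℕ) (c : ℝ) (ε : ℕ → ℝ), Tendsto ε atTop (𝓝 0) ∧
        ∀ n : ℕ, 2 ≤ n → ∀ N : ℕ, c * Real.logb 2 n ^ 2 ≤ N →
          Solves Q n N ρ (fun _ => 0)
            (C * (n * Real.logb 2 n ^ k) *
              (2 : ℝ) ^ ((1 - kappaZ (relDist ρ) - relDist ρ) * sampleDim ρ n * (1 + ε n)))) ∧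
    (∃ P Q : Prog, ∀ ρ : ℝ, ρ ≠ 0 → |ρ| ≤ 1 →
      ∃ (C : ℝ) (k : ℕ) (c : ℝ) (ε : ℕ → ℝ) (m : ℕ → ℕ) (n₀ : ℕ), Tendsto ε atTop (𝓝 0) ∧
        Tendsto (fun n => (m n : ℝ) / sampleDim ρ n) atTop (𝓝 1) ∧
        ∀ n : ℕ, 2 ≤ n → ∀ ω' : ℕ → Bool, ∃ (s : State) (t : ℕ),
          Exec (preEnv ρ ω') P (start n ρ fun _ => 0) s t ∧
          (n₀ ≤ n → (t : ℝ) ≤ (n : ℝ) ^ (2.773 / ρ ^ 2)) ∧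
          (∃ K, IsGilbertCode (m n) ⌈relDist ρ * m n⌉₊ K ∧
            HoldsDecodingTable (m n) ⌈relDist ρ * m n⌉₊ K s.mem) ∧
          ∀ N : ℕ, c * Real.logb 2 n ^ 2 ≤ N →
            Solves Q n N ρ s.mem
              (C * (n * Real.logb 2 n ^ k) *
                (2 : ℝ) ^ ((H2 (relDist ρ) - relDist ρ) * sampleDim ρ n * (1 + ε n)))) := by
  refine ⟨⟨lightBulbProg, fun ρ h0 h1 => ?_⟩, ⟨preProg, lightBulbProg, fun ρ h0 h1 => ?_⟩⟩
  · obtain ⟨C, c, hC, hsol⟩ := exists_solves h0 h1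
    refine ⟨C, 5, c, fun _ => 0, tendsto_const_nhds, fun n hn N hN => ?_⟩
    -- By `kappaZ_le`, the exponent required here is at least the one already achieved, so that no
    -- error term is needed.
    refine (hsol n hn N hN _).mono ?_
    have hl := one_le_logb hn
    have hk := kappaZ_le (relDist_mem h1).1 (relDist_le_half ρ)
    have hS : 0 ≤ sampleDim ρ n := by
      have := Real.log_pos (show (1 : ℝ) < 2 by norm_num)
      unfold sampleDim; positivity
    rw [add_zero, mul_one]
    refine mul_le_mul_of_nonneg_left ?_ (by positivity)
    refine Real.rpow_le_rpow_of_exponent_le (by norm_num) ?_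
    exact mul_le_mul_of_nonneg_right (by linarith) hS
  · obtain ⟨C, c, hC, hsol⟩ := exists_solves h0 h1
    obtain ⟨n₀, hn₀⟩ := eventually_atTop.1 (eventually_preTime_le h0 h1)
    refine ⟨C, 5, c, fun _ => 0, codeDim ρ, n₀, tendsto_const_nhds, tendsto_codeDim h0,
      fun n hn ω' => ?_⟩
    obtain ⟨s, t, hex, ht, -, hK⟩ := runs_preProg h1 n ω'
    rw [codeDist_eq h1] at hK
    refine ⟨s, t, hex, fun hle => ?_, hK, fun N hN => ?_⟩
    · exact le_trans (by exact_mod_cast ht) (hn₀ n hle)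
    -- The search leaves the decoding table unused: its bound holds for every initial memory.
    · simpa using hsol n hn N hN s.mem
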